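/- Let $\mathbb{R}^6_2$ be $\mathbb{R}^6$ with its standard orientation and $\langle x,x\rangle=x_1^2+\dots+x_4^2-x_5^2-x_6^2$, and let $Q^4_1=\{[x]\in\mathbb{R}P^5 : x\neq 0,\ \langle x,x\rangle=0\}$. Let $M$ be a Riemann surface. A smooth map $y:M\to Q^4_1$ is a *conformal spacelike surface* if $\langle Y_z,Y_z\rangle=0$ and $\langle Y_z,Y_{\bar z}\rangle>0$ for every smooth local lift $Y$ of $y$ to $\mathbb{R}^6_2\setminus\{0\}$ and every complex coordinate $z=u+iv$. Then there are locally a lift $Y$ (the canonical lift, unique up to sign) with $|dY|^2=|dz|^2$, a section $N$ of the rank-$4$ Lorentzian bundle $V=\mathrm{Span}\{Y,dY,Y_{z\bar z}\}$ determined by $\langle N,Y_z\rangle=\langle N,N\rangle=0$, $\langle N,Y\rangle=-1$, and null sections $L,R$ of $V^\perp$ with $\langle L,R\rangle=-1$ such that the frame $\{Y,Y_u,Y_v,N,R,L\}$ is positively oriented. The maps $[L],[R]:M\to Q^4_1$ are well defined and are called the left and the right polar surface of $y$. The component of $Y_{zz}$ in $V^\perp\otimes\mathbb{C}$ is $\kappa=\lambda_1L+\lambda_2R$;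 whether $\lambda_1$ or $\lambda_2$ vanishes at a point does not depend on the choices. The Willmore functional of a spacelike immersion is $W(y)=\frac i2\int\langle\kappa,\bar\kappa\rangle\,dz\wedge d\bar z$, where $z$ is a complex coordinate for the conformal structure and orientation induced on the surface. A conformal spacelike surface is *Willmore* if it is critical for $W$ under all smooth compactly supported variations of the map $y$ (which need not preserve conformality). Its conformal Gauss map is represented by the bivector $L\wedge R$ of its normal plane, a map into the Grassmannian $G_{1,1}(\mathbb{R}^6_2)$ of Lorentzian planes. **Theorem.** Let $y=[Y]:M\to Q^4_1$ be a spacelike Willmore surface. 1. The left polar surface $[L]$ is an immersion at a point exactly if $\lambda_2\neq 0$ there. On the open set $\{\lambda_2\ne0\}$ it is again a conformal spacelike Willmore surface, its right polar surface is $y$, and its conformal Gauss map (which is $Y\wedge\hat Y$ up to sign, where $[\hat Y]$ denotes the left polar surface of $[L]$ and $\langle Y,\hat Y\rangle=-1$) is harmonic. 2. The right polar surface $[R]$ is an immersion at a point exactly if $\lambda_1\neq 0$ there. On the open set $\{\lambda_1\ne0\}$ it is again a conformal spacelike Willmore surface, its left polar surface is $y$, and its conformal Gauss map is harmonic. 3.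 Consequently the two-step (adjoint) transforms of $y$ are Willmore as well: the left polar surface $[\hat Y]$ of $[L]|_{\{\lambda_2\neq0\}}$ and the right polar surface $[\tilde Y]$ of $[R]|_{\{\lambda_1\neq0\}}$ are conformal spacelike Willmore surfaces on the open sets where they are immersions. -/

import Mathlib

open scoped Manifold ContDiff LinearAlgebra.Projectivization

namespace SpacelikeWillmore

noncomputable section

/-! ### The space `ℝ⁶₂` and the quadric `Q⁴₁` -/

/-- The vector space underlying `ℝ⁶₂`. -/
abbrev R62 : Type := Fin 6 → ℝ

/-- Its complexification. -/
abbrev C62 : Type := Fin 6 → ℂ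

/-- The signs `(+,+,+,+,-,-)` of the quadratic form. -/
def sgn (i : Fin 6) : ℝ := if i.val < 4 then 1 else -1

/-- The scalar product of `ℝ⁶₂`. -/
def ip (x y : R62) : ℝ := ∑ i, sgn i * x i * y i

/-- Its complex bilinear extension. -/
def ipC (x y : C62) : ℂ := ∑ i, (sgn i : ℂ) * x i * y i

/-- A real vector as a complex one. -/
def toC (x : R62) : C62 := fun i => (x i : ℂ)

/-- The projectivized light cone. -/
def Q41 : Type := {p : ℙ ℝ R62 // ip p.rep p.rep = 0}

/-- `v` is a homogeneous coordinate vector of `p`, that is, `[v] = p`. -/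
def Represents (v : R62) (p : Q41) : Prop :=
  ∃ h : v ≠ 0, Projectivization.mk ℝ v h = p.1

/-- The representative of `p` in the affine chart of projective space around `p₀`: the vector `v`
with `[v] = p` whose Euclidean product with a fixed representative of `p₀` is `1`. It does not
depend on the representative of `p` (and it is `0` when `p` lies outside that affine chart). -/
def affineRep (p₀ p : Q41) : R62 := (dotProduct p₀.1.rep p.1.rep)⁻¹ • p.1.rep

/-! ### Calculus in a coordinate `z = u + i v` -/

section Calculus

variable {F : Type*} [NormedAddCommGroup F] [NormedSpace ℝ F]

/-- `∂f/∂u`. -/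
def du (f : ℂ → F) (z : ℂ) : F := fderiv ℝ f z 1

/-- `∂f/∂v`. -/
def dv (f : ℂ → F) (z : ℂ) : F := fderiv ℝ f z Complex.I

/-- `f_uu + f_vv = 4 f_{z z̄}`. -/
def lap (f : ℂ → F) (z : ℂ) : F := du (du f) z + dv (dv f) z

/-- The second derivative of `f` at `z` in the directions `a`, `b`. -/
def hess (f : ℂ → F) (z a b : ℂ) : F := fderiv ℝ (fderiv ℝ f) z a b

end Calculus

/-- `∂f/∂z = (f_u - i f_v) / 2`. -/
def dz (f : ℂ → C62) (z : ℂ) : C62 := (1 / 2 : ℂ) • (du f z - Complex.I • dv f z)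

/-- `∂f/∂z̄ = (f_u + i f_v) / 2`. -/
def dzbar (f : ℂ → C62) (z : ℂ) : C62 := (1 / 2 : ℂ) • (du f z + Complex.I • dv f z)

/-! ### The Willmore integrand of a spacelike immersion in an arbitrary coordinate -/

/-- The integrand, with respect to `du dv`, of the Willmore functional of the spacelike immersion
`[Y]`, for an arbitrary lift `Y` and an arbitrary (not necessarily isothermal) coordinate.

`e₁, e₂` is the oriented orthonormal basis that the Gram-Schmidt process makes of `∂_u, ∂_v` for
the induced metric `⟨dY, dY⟩`. With `Z = (e₁ - i e₂) / 2`, the conformal Hopf differential is the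
component `κ = a - i b` of the second derivative `Y(Z, Z)` in the orthogonal complement of
`V = Span {Y, dY, Y(e₁, e₁) + Y(e₂, e₂)}`; here `{Y, X₁, X₂, N}` is a frame of `V` with
`⟨Xᵢ, Xⱼ⟩ = δᵢⱼ`, `⟨N, Xᵢ⟩ = ⟨N, N⟩ = 0`, `⟨N, Y⟩ = -1`. The integrand is `⟨κ, κ̄⟩` times the area
density of the induced metric. It does not change if the lift is rescaled, and it transforms as a
density under changes of coordinates; for an isothermal coordinate and the lift with
`|dY|² = |dz|²` it is `⟨κ, κ̄⟩` with `κ` the normal component of `Y_zz`. -/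
def willmoreIntegrand (Y : ℂ → R62) (z : ℂ) : ℝ :=
  let E := ip (du Y z) (du Y z)
  let F := ip (du Y z) (dv Y z)
  let G := ip (dv Y z) (dv Y z)
  let e₁ : ℂ := ((1 / √E : ℝ) : ℂ)
  let e₂ : ℂ := ((√E / √(E * G - F ^ 2) : ℝ) : ℂ) * (Complex.I - ((F / E : ℝ) : ℂ))
  let X₁ := fderiv ℝ Y z e₁
  let X₂ := fderiv ℝ Y z e₂
  let H := hess Y z e₁ e₁ + hess Y z e₂ e₂
  let N₀ := (1 / 2 : ℝ) • (H - ip H X₁ • X₁ - ip H X₂ • X₂)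
  let N := N₀ + (ip N₀ N₀ / 2) • Y z
  let nor : R62 → R62 := fun X => X - ip X X₁ • X₁ - ip X X₂ • X₂ + ip X N • Y z + ip X (Y z) • N
  let a := nor ((1 / 4 : ℝ) • (hess Y z e₁ e₁ - hess Y z e₂ e₂))
  let b := nor ((1 / 2 : ℝ) • hess Y z e₁ e₂)
  (ip a a + ip b b) * √(E * G - F ^ 2)

/-! ### Bivectors -/

/-- The components of the bivector `x ∧ y`. -/
def wedge (x y : R62) : Fin 6 → Fin 6 → ℝ := fun i j => x i * y j - x j * y i

/-- The scalar product `⟨B, a ∧ b⟩` of bivectors, normalized by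
`⟨x ∧ y, a ∧ b⟩ = ⟨x, a⟩ ⟨y, b⟩ - ⟨x, b⟩ ⟨y, a⟩`. -/
def bivectorPairing (B : Fin 6 → Fin 6 → ℝ) (a b : R62) : ℝ :=
  ∑ i, ∑ j, sgn i * sgn j * B i j * a i * b j

/-! ### Surfaces in `Q⁴₁` -/

section Surfaces

variable {M : Type*} [TopologicalSpace M] [ChartedSpace ℂ M]

/-- `y : M → Q⁴₁` is smooth (in the real sense) at `p`. -/
def SmoothAt (y : M → Q41) (p : M) : Prop :=
  ContMDiffAt 𝓘(ℝ, ℂ) 𝓘(ℝ, R62) ∞ (fun q => affineRep (y p) (y q)) p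

/-- `e` is a complex coordinate on an open subset of the Riemann surface `M`. -/
def IsCoord (e : OpenPartialHomeomorph M ℂ) : Prop :=
  e ∈ IsManifold.maximalAtlas 𝓘(ℂ) ω M

/-- `Y` is a smooth local lift of `y`, defined on the open set `s` of values of the coordinate
`e`. -/
structure IsLocalLift (y : M → Q41) (e : OpenPartialHomeomorph M ℂ) (s : Set ℂ)
    (Y : ℂ → R62) : Prop where
  coord : IsCoord e
  isOpen : IsOpen s
  subset : s ⊆ e.target
  smooth : ContDiffOn ℝ ∞ Y s
  lift : ∀ z ∈ s, Represents (Y z) (y (e.symm z))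

/-- `y` is an immersion at `p`: for a local lift, `Y, Y_u, Y_v` are linearly independent. -/
def IsImmersionAt (y : M → Q41) (p : M) : Prop :=
  ∃ (e : OpenPartialHomeomorph M ℂ) (s : Set ℂ) (Y : ℂ → R62),
    IsLocalLift y e s Y ∧ p ∈ e.source ∧ e p ∈ s ∧
      LinearIndependent ℝ ![Y (e p), du Y (e p), dv Y (e p)]

/-- On the open set `U`, `y` is a conformal spacelike surface: it is smooth, and
`⟨Y_z, Y_z⟩ = 0`, `⟨Y_z, Y_z̄⟩ > 0` for any local lift and any complex coordinate. -/
structure IsConformalSpacelikeOn (y : M → Q41) (U : Set M) : Prop where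
  isOpen : IsOpen U
  smooth : ∀ p ∈ U, SmoothAt y p
  conformal : ∀ (e : OpenPartialHomeomorph M ℂ) (s : Set ℂ) (Y : ℂ → R62),
    IsLocalLift y e s Y → ∀ z ∈ s, e.symm z ∈ U →
      ipC (dz (fun w => toC (Y w)) z) (dz (fun w => toC (Y w)) z) = 0 ∧
      0 < (ipC (dz (fun w => toC (Y w)) z) (dzbar (fun w => toC (Y w)) z)).re

/-! ### The Willmore functional and Willmore surfaces -/

/-- The Willmore integrand of `y` in the coordinate `e`. -/
def willmoreDensity (e : OpenPartialHomeomorph M ℂ) (y : M → Q41) (z : ℂ) : ℝ :=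
  willmoreIntegrand (fun w => affineRep (y (e.symm z)) (y (e.symm w))) z

/-- The sets `A i` are finitely many disjoint pieces of `U`, each of them relatively compact in
the domain of the coordinate `e i`, and they cover `K`. -/
structure IsDissection (U K : Set M) {n : ℕ} (e : Fin n → OpenPartialHomeomorph M ℂ)
    (A : Fin n → Set M) : Prop where
  coord : ∀ i, IsCoord (e i)
  compact : ∀ i, ∃ C : Set M, IsCompact C ∧ A i ⊆ C ∧ C ⊆ (e i).source ∩ U
  measurable : ∀ i, MeasurableSet (e i '' A i)
  disjoint : Pairwise fun i j => Disjoint (A i) (A j)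
  cover : K ⊆ ⋃ i, A i

/-- The Willmore functional of `y` over the region `⋃ i, A i`, computed piece by piece in
coordinates. -/
def willmoreFunctional (y : M → Q41) {n : ℕ} (e : Fin n → OpenPartialHomeomorph M ℂ)
    (A : Fin n → Set M) : ℝ :=
  ∑ i, ∫ z in e i '' A i, willmoreDensity (e i) y z

/-- `f` is a smooth variation of `y` on `U` with support in the compact set `K`. -/
structure IsVariation (y : M → Q41) (U K : Set M) (f : ℝ → M → Q41) : Prop where
  compact : IsCompact K
  subset : K ⊆ U
  start : f 0 = y
  fixed : ∀ t, ∀ p ∉ K, f t p = y p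
  smooth : ∃ ε > 0, ∀ t, |t| < ε → ∀ p ∈ U,
    ContMDiffAt (𝓘(ℝ, ℝ).prod 𝓘(ℝ, ℂ)) 𝓘(ℝ, R62) ∞
      (fun q : ℝ × M => affineRep (f t p) (f q.1 q.2)) (t, p)

/-- On `U`, `y` is a spacelike Willmore surface: a conformal spacelike surface that is critical
for the Willmore functional with respect to all compactly supported variations of the map `y`
(which need not be conformal; the functional of the varied surface is taken with respect to the
conformal structure that it induces). -/
structure IsSpacelikeWillmoreOn (y : M → Q41) (U : Set M) : Prop where
  spacelike : IsConformalSpacelikeOn y U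
  critical : ∀ (K : Set M) (f : ℝ → M → Q41), IsVariation y U K f →
    ∀ (n : ℕ) (e : Fin n → OpenPartialHomeomorph M ℂ) (A : Fin n → Set M),
      IsDissection U K e A → HasDerivAt (fun t => willmoreFunctional (f t) e A) 0 0

/-! ### Adapted frames and polar surfaces -/

/-- `{Y, Y_u, Y_v, N, R, L}` is an adapted frame of `y` over the set `s` of values of the complex
coordinate `e`: `Y` is the canonical lift (`|dY|² = |dz|²`), `N` is the section of
`V = Span {Y, dY, Y_{z z̄}}` with `⟨N, Y_z⟩ = ⟨N, N⟩ = 0`, `⟨N, Y⟩ = -1`, the normal plane is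
spanned by the null vectors `L, R` with `⟨L, R⟩ = -1`, and the frame is positively oriented. -/
structure IsAdaptedFrame (y : M → Q41) (e : OpenPartialHomeomorph M ℂ) (s : Set ℂ)
    (Y N L R : ℂ → R62) : Prop where
  lift : IsLocalLift y e s Y
  smooth_N : ContDiffOn ℝ ∞ N s
  smooth_L : ContDiffOn ℝ ∞ L s
  smooth_R : ContDiffOn ℝ ∞ R s
  canonical : ∀ z ∈ s, ip (du Y z) (du Y z) = 1 ∧ ip (dv Y z) (dv Y z) = 1 ∧
    ip (du Y z) (dv Y z) = 0
  N_mem : ∀ z ∈ s, N z ∈ Submodule.span ℝ {Y z, du Y z, dv Y z, lap Y z}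
  N_eq : ∀ z ∈ s, ip (N z) (du Y z) = 0 ∧ ip (N z) (dv Y z) = 0 ∧ ip (N z) (N z) = 0 ∧
    ip (N z) (Y z) = -1
  normal : ∀ z ∈ s, ∀ x ∈ Submodule.span ℝ {Y z, du Y z, dv Y z, lap Y z},
    ip (L z) x = 0 ∧ ip (R z) x = 0
  null : ∀ z ∈ s, ip (L z) (L z) = 0 ∧ ip (R z) (R z) = 0 ∧ ip (L z) (R z) = -1
  oriented : ∀ z ∈ s, 0 < Matrix.det (Matrix.of ![Y z, du Y z, dv Y z, N z, R z, L z])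

/-- On `U`, `l` is the left polar surface `[L]` of `y`. -/
def IsLeftPolarOn (y l : M → Q41) (U : Set M) : Prop :=
  ∀ p ∈ U, ∃ (e : OpenPartialHomeomorph M ℂ) (s : Set ℂ) (Y N L R : ℂ → R62),
    IsAdaptedFrame y e s Y N L R ∧ p ∈ e.source ∧ e p ∈ s ∧
      ∀ z ∈ s, Represents (L z) (l (e.symm z))

/-- On `U`, `r` is the right polar surface `[R]` of `y`. -/
def IsRightPolarOn (y r : M → Q41) (U : Set M) : Prop :=
  ∀ p ∈ U, ∃ (e : OpenPartialHomeomorph M ℂ) (s : Set ℂ) (Y N L R : ℂ → R62),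
    IsAdaptedFrame y e s Y N L R ∧ p ∈ e.source ∧ e p ∈ s ∧
      ∀ z ∈ s, Represents (R z) (r (e.symm z))

/-- The Schwarzian `σ` and the coefficients of the conformal Hopf differential
`κ = l₁ L + l₂ R`, at `z`: `Y_zz = -(σ / 2) Y + l₁ L + l₂ R`. -/
def HopfCoefficients (Y L R : ℂ → R62) (z σ l₁ l₂ : ℂ) : Prop :=
  dz (dz fun w => toC (Y w)) z = -(σ / 2) • toC (Y z) + l₁ • toC (L z) + l₂ • toC (R z)

/-- The points at which `λ₁ ≠ 0`, where `κ = λ₁ L + λ₂ R`. (Whether `λ₁` vanishes does not depend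
on the coordinate and the frame.) -/
def lam1NeZero (y : M → Q41) : Set M :=
  {p | ∃ (e : OpenPartialHomeomorph M ℂ) (s : Set ℂ) (Y N L R : ℂ → R62) (σ l₁ l₂ : ℂ),
    IsAdaptedFrame y e s Y N L R ∧ p ∈ e.source ∧ e p ∈ s ∧
      HopfCoefficients Y L R (e p) σ l₁ l₂ ∧ l₁ ≠ 0}

/-- The points at which `λ₂ ≠ 0`, where `κ = λ₁ L + λ₂ R`. -/
def lam2NeZero (y : M → Q41) : Set M :=
  {p | ∃ (e : OpenPartialHomeomorph M ℂ) (s : Set ℂ) (Y N L R : ℂ → R62) (σ l₁ l₂ : ℂ),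
    IsAdaptedFrame y e s Y N L R ∧ p ∈ e.source ∧ e p ∈ s ∧
      HopfCoefficients Y L R (e p) σ l₁ l₂ ∧ l₂ ≠ 0}

/-- On `U`, the conformal Gauss map of `y`, represented by the bivector `L ∧ R` of the normal
plane, is harmonic as a map into the Grassmannian `G_{1,1}(ℝ⁶₂)`: its Laplacian is orthogonal to
the tangent space of the Grassmannian, which is spanned by the bivectors `a ∧ b` with `a` in the
normal plane and `b` in its orthogonal complement `V`. -/
def HasHarmonicGaussMapOn (y : M → Q41) (U : Set M) : Prop :=
  ∀ (e : OpenPartialHomeomorph M ℂ) (s : Set ℂ) (Y N L R : ℂ → R62),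
    IsAdaptedFrame y e s Y N L R → ∀ z ∈ s, e.symm z ∈ U →
      ∀ a ∈ Submodule.span ℝ {L z, R z},
        ∀ b ∈ Submodule.span ℝ {Y z, du Y z, dv Y z, lap Y z},
          bivectorPairing (lap (fun w => wedge (L w) (R w)) z) a b = 0

end Surfaces

end

end SpacelikeWillmore

open SpacelikeWillmore

namespace SpacelikeWillmore

noncomputable section

open MeasureTheory

/-! ### Linear algebra of `ℝ⁶₂` -/

-- Everything reduces to identities in the moving frame `Y, Y_u, Y_v, N, L, R` of a canonical lift.
-- Let `p = (Y_uu - Y_vv)/2`, `q = Y_uv`, `P = ⟨p, L⟩`, `Q = ⟨q, L⟩`. Then `λ₂ = -(P - iQ)/2`, and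
-- `L_u, L_v` have `dY`-components `(-P, -Q)` and `(-Q, P)`, with no component along `N` or `R`.
-- Hence `[L]` is conformal with metric `(P² + Q²)|dz|²` (`IsFrame.metric_L`), and it is an
-- immersion exactly where `λ₂ ≠ 0`.
--
-- Being Willmore becomes a differential equation. The integrand is a function of the two-jet of a
-- lift (`willmoreIntegrand_eq_jetWillmore`), independent of the lift and a density under
-- holomorphic changes of coordinate. Its linearization at a canonical lift is `⟨E, w⟩` plus a
-- divergence, with `E = eulerLagrange Y` (`linWillmore_eq`). Invariance under rescaling and
-- reparametrization makes `E` orthogonal to `Y, Y_u, Y_v`; velocities of null lifts are orthogonal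
-- to `Y`, so only `⟨E, L⟩` and `⟨E, R⟩` matter. The variations `[Y + tφL]` show that they vanish on
-- a Willmore surface (`IsSpacelikeWillmoreOn.eulerLagrange`). Conversely, if they vanish, a
-- partition of unity reduces an arbitrary variation to ones supported in single frames
-- (`IsConformalSpacelikeOn.isSpacelikeWillmoreOn`).
--
-- The condition `⟨E, L⟩ = 0` says that `ΔL = 2(⟨R_u, L⟩ L_u + ⟨R_v, L⟩ L_v)` modulo `L, R`: the
-- components other than the `N`-component hold on every surface by the Codazzi equations
-- (`IsFrame.harmonicEq`). This equation and its mirror image for `R` are the harmonicity of `L ∧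
-- R`.
--
-- Where `λ₂ ≠ 0`, rescale `L` so that `P² + Q² = 1`; then `L` is its own canonical lift. The field
-- `Y` is null and orthogonal to `L, dL, ΔL`, so it spans one null normal line of `[L]`. The other
-- is spanned by the null vector `Ŷ` in `Span {Y, dY, N}` orthogonal to `dL`; the equation for `ΔL`
-- gives `⟨ΔL, Ŷ⟩ = 0` (`IsFrame.polar`). A determinant of scalar products shows that the
-- orientation is preserved (`IsFrame.polar_frameDet`), so `y` is the right polar surface of `[L]`.
-- The Euler-Lagrange equations of `[L]` along `Y` and `Ŷ` are checked in this frame; the second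
-- uses the equations of `y` along both `L` and `R` (`polar_eulerLagrange_right`,
-- `polar_eulerLagrange_left`).
--
-- Exchanging `L` and `R` reverses the orientation, so a sign `ε` in `IsOrientedFrame` treats both
-- polar surfaces at once. The two-step statement applies the result to the polar surface itself.

theorem ip_comm (x y : R62) : ip x y = ip y x := by
  unfold ip; exact Finset.sum_congr rfl fun i _ => by ring

theorem ip_add_left (x y z : R62) : ip (x + y) z = ip x z + ip y z := by
  unfold ip; rw [← Finset.sum_add_distrib]
  exact Finset.sum_congr rfl fun i _ => by simp only [Pi.add_apply]; ring

theorem ip_smul_left (c : ℝ) (x z : R62) : ip (c • x) z = c * ip x z := by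
  unfold ip; rw [Finset.mul_sum]
  exact Finset.sum_congr rfl fun i _ => by simp only [Pi.smul_apply, smul_eq_mul]; ring

theorem ip_add_right (x y z : R62) : ip x (y + z) = ip x y + ip x z := by
  rw [ip_comm, ip_add_left, ip_comm y, ip_comm z]

theorem ip_smul_right (c : ℝ) (x z : R62) : ip x (c • z) = c * ip x z := by
  rw [ip_comm, ip_smul_left, ip_comm]

theorem ip_neg_left (x z : R62) : ip (-x) z = -ip x z := by
  rw [← neg_one_smul ℝ, ip_smul_left]; ring

theorem ip_sub_left (x y z : R62) : ip (x - y) z = ip x z - ip y z := by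
  rw [sub_eq_add_neg, ip_add_left, ip_neg_left]; ring

theorem ip_sub_right (x y z : R62) : ip x (y - z) = ip x y - ip x z := by
  rw [ip_comm, ip_sub_left, ip_comm y, ip_comm z]

theorem ip_zero_left (x : R62) : ip 0 x = 0 := by simp [ip]

theorem ip_zero_right (x : R62) : ip x 0 = 0 := by simp [ip]

/-- The scalar product as a continuous bilinear map. -/
def ipL : R62 →L[ℝ] R62 →L[ℝ] ℝ :=
  (LinearMap.mk₂ ℝ ip ip_add_left ip_smul_left ip_add_right
    ip_smul_right).toContinuousBilinearMap

theorem ipL_apply (x y : R62) : ipL x y = ip x y := rfl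

theorem sgn_mul_sgn (i : Fin 6) : sgn i * sgn i = 1 := by
  unfold sgn; split_ifs <;> norm_num

theorem ip_single (x : R62) (i : Fin 6) : ip x (Pi.single i (sgn i)) = x i := by
  unfold ip
  rw [Finset.sum_eq_single i]
  · rw [Pi.single_eq_same]; linear_combination x i * sgn_mul_sgn i
  · intro j _ hj; rw [Pi.single_eq_of_ne hj]; ring
  · simp

/-- The scalar product is nondegenerate. -/
theorem eq_of_forall_ip_eq {x y : R62} (h : ∀ b, ip x b = ip y b) : x = y := by
  ext i; rw [← ip_single x i, ← ip_single y i, h]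

/-- The diagonal matrix of the scalar product. -/
def signMatrix : Matrix (Fin 6) (Fin 6) ℝ := Matrix.diagonal sgn

theorem signMatrix_mul_self : signMatrix * signMatrix = 1 := by
  unfold signMatrix
  rw [Matrix.diagonal_mul_diagonal]
  simp only [sgn_mul_sgn]; exact Matrix.diagonal_one

theorem det_signMatrix : signMatrix.det = 1 := by
  unfold signMatrix
  rw [Matrix.det_diagonal]
  simp [Fin.prod_univ_six, sgn]

theorem mul_signMatrix_mul_transpose (f g : Fin 6 → R62) :
    Matrix.of f * signMatrix * (Matrix.of g).transpose = Matrix.of fun i j => ip (f i) (g j) := by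
  ext i j
  rw [Matrix.mul_apply]
  simp only [signMatrix, Matrix.mul_diagonal, Matrix.of_apply, Matrix.transpose_apply, ip]
  exact Finset.sum_congr rfl fun k _ => by ring

/-- The product of the determinants of two systems of six vectors is the determinant of their
mutual scalar products. -/
theorem det_mul_det_eq_det_gram (f g : Fin 6 → R62) :
    (Matrix.of f).det * (Matrix.of g).det = (Matrix.of fun i j => ip (f i) (g j)).det := by
  rw [← mul_signMatrix_mul_transpose, Matrix.det_mul, Matrix.det_mul, Matrix.det_transpose,
    det_signMatrix, mul_one]

/-- Six vectors with the scalar products of an adapted frame. -/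
structure IsNullFrame (Y U V N L R : R62) : Prop where
  YY : ip Y Y = 0
  YU : ip Y U = 0
  YV : ip Y V = 0
  YN : ip Y N = -1
  YL : ip Y L = 0
  YR : ip Y R = 0
  UU : ip U U = 1
  UV : ip U V = 0
  UN : ip U N = 0
  UL : ip U L = 0
  UR : ip U R = 0
  VV : ip V V = 1
  VN : ip V N = 0
  VL : ip V L = 0
  VR : ip V R = 0
  NN : ip N N = 0
  NL : ip N L = 0
  NR : ip N R = 0
  LL : ip L L = 0
  LR : ip L R = -1
  RR : ip R R = 0

/-- The matrix of scalar products of an adapted frame `Y, U, V, N, R, L`. -/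
def frameGram : Matrix (Fin 6) (Fin 6) ℝ :=
  !![0, 0, 0, -1, 0, 0; 0, 1, 0, 0, 0, 0; 0, 0, 1, 0, 0, 0; -1, 0, 0, 0, 0, 0;
     0, 0, 0, 0, 0, -1; 0, 0, 0, 0, -1, 0]

theorem frameGram_mul_self : frameGram * frameGram = 1 := by
  ext i j
  fin_cases i <;> fin_cases j <;>
    simp [frameGram, Matrix.mul_apply, Fin.sum_univ_six]

namespace IsNullFrame

variable {Y U V N L R : R62}

theorem gram (h : IsNullFrame Y U V N L R) :
    (Matrix.of fun i j => ip (![Y, U, V, N, R, L] i) (![Y, U, V, N, R, L] j)) = frameGram := by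
  ext i j
  fin_cases i <;> fin_cases j <;>
    simp [frameGram, h.YY, h.YU, h.YV, h.YN, h.YL, h.YR, h.UU, h.UV, h.UN, h.UL, h.UR, h.VV, h.VN,
      h.VL, h.VR, h.NN, h.NL, h.NR, h.LL, h.LR, h.RR, ip_comm U Y, ip_comm V Y, ip_comm N Y,
      ip_comm L Y, ip_comm R Y, ip_comm V U, ip_comm N U, ip_comm L U, ip_comm R U, ip_comm N V,
      ip_comm L V, ip_comm R V, ip_comm L N, ip_comm R N, ip_comm R L]

/-- The completeness relation of the frame: its Gram matrix is an involution, so the frame is its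
own dual basis up to signs and the exchanges of `Y` with `N` and of `L` with `R`. -/
theorem ip_expand (h : IsNullFrame Y U V N L R) (x y : R62) :
    ip x y = -(ip x Y * ip y N) - ip x N * ip y Y + ip x U * ip y U + ip x V * ip y V
      - ip x L * ip y R - ip x R * ip y L := by
  set f : Fin 6 → R62 := ![Y, U, V, N, R, L]
  set F := Matrix.of f
  have h1 : F * (signMatrix * F.transpose * frameGram) = 1 := by
    rw [← Matrix.mul_assoc, ← Matrix.mul_assoc, mul_signMatrix_mul_transpose, h.gram,
      frameGram_mul_self]
  have h2 : signMatrix * F.transpose * frameGram * F = 1 := mul_eq_one_comm.mp h1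
  -- A one-sided inverse of a square matrix is two-sided; this turns `F J Fᵀ = G` into `Fᵀ G F = J`.
  have h3 : F.transpose * frameGram * F = signMatrix := by
    have := congrArg (signMatrix * ·) h2
    simpa [← Matrix.mul_assoc, signMatrix_mul_self] using this
  -- The vectors `x`, `y` are repeated as all six rows so that the Gram formula for square matrices
  -- applies; only the entry `(0, 0)` is used.
  have h4 : (Matrix.of fun _ : Fin 6 => x) * signMatrix * (F.transpose * frameGram * F) * signMatrix
      * (Matrix.of fun _ : Fin 6 => y).transpose
      = (Matrix.of fun _ : Fin 6 => x) * signMatrix * (Matrix.of fun _ : Fin 6 => y).transpose := by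
    rw [h3, Matrix.mul_assoc _ signMatrix signMatrix, signMatrix_mul_self, Matrix.mul_one]
  have h5 : (Matrix.of fun _ : Fin 6 => x) * signMatrix * (F.transpose * frameGram * F) * signMatrix
      * (Matrix.of fun _ : Fin 6 => y).transpose
      = ((Matrix.of fun _ : Fin 6 => x) * signMatrix * F.transpose) * frameGram *
        (F * signMatrix * (Matrix.of fun _ : Fin 6 => y).transpose) := by
    simp only [Matrix.mul_assoc]
  rw [h5, mul_signMatrix_mul_transpose, mul_signMatrix_mul_transpose,
    mul_signMatrix_mul_transpose] at h4
  have h6 := congrFun (congrFun h4 0) 0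
  simp only [Matrix.mul_apply, Fin.sum_univ_six, Matrix.of_apply, f, frameGram] at h6
  simp at h6
  rw [← h6, ip_comm y N, ip_comm y Y, ip_comm y U, ip_comm y V, ip_comm y R, ip_comm y L]
  ring

theorem expand (h : IsNullFrame Y U V N L R) (x : R62) :
    x = -(ip x N) • Y - ip x Y • N + ip x U • U + ip x V • V - ip x R • L - ip x L • R := by
  refine eq_of_forall_ip_eq fun b => ?_
  rw [h.ip_expand x b]
  simp only [ip_add_left, ip_sub_left, ip_smul_left, ip_comm b]
  ring

end IsNullFrame

/-! ### Homogeneous coordinates -/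

theorem Represents.ne_zero {v : R62} {p : Q41} (h : Represents v p) : v ≠ 0 := h.1

theorem represents_rep (p : Q41) : Represents p.1.rep p :=
  ⟨p.1.rep_nonzero, p.1.mk_rep⟩

theorem Represents.exists_smul {v w : R62} {p : Q41} (hv : Represents v p) (hw : Represents w p) :
    ∃ c : ℝ, c ≠ 0 ∧ w = c • v := by
  obtain ⟨h1, h2⟩ := hv
  obtain ⟨h3, h4⟩ := hw
  obtain ⟨a, ha⟩ := (Projectivization.mk_eq_mk_iff' ℝ w v h3 h1).1 (h4.trans h2.symm)
  refine ⟨a, ?_, ha.symm⟩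
  rintro rfl
  exact h3 (by rw [← ha, zero_smul])

theorem Represents.smul {v : R62} {p : Q41} (h : Represents v p) {c : ℝ} (hc : c ≠ 0) :
    Represents (c • v) p := by
  obtain ⟨h1, h2⟩ := h
  refine ⟨smul_ne_zero hc h1, ?_⟩
  rw [← h2]
  exact (Projectivization.mk_eq_mk_iff' ℝ _ _ _ _).2 ⟨c, rfl⟩

theorem Represents.ip_self {v : R62} {p : Q41} (h : Represents v p) : ip v v = 0 := by
  obtain ⟨c, _, rfl⟩ := (represents_rep p).exists_smul h
  rw [ip_smul_left, ip_smul_right, p.2]; ring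

theorem Represents.unique {v : R62} {p p' : Q41} (h : Represents v p) (h' : Represents v p') :
    p = p' := by
  obtain ⟨h1, h2⟩ := h
  obtain ⟨h3, h4⟩ := h'
  exact Subtype.ext (h2.symm.trans h4)

theorem exists_represents {v : R62} (h0 : v ≠ 0) (h : ip v v = 0) : ∃ p, Represents v p := by
  obtain ⟨a, ha⟩ := Projectivization.exists_smul_eq_mk_rep ℝ v h0
  refine ⟨⟨Projectivization.mk ℝ v h0, ?_⟩, h0, rfl⟩
  rw [← ha]
  change ip ((a : ℝ) • v) ((a : ℝ) • v) = 0
  rw [ip_smul_left, ip_smul_right, h]; ring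

theorem affineRep_eq {v : R62} {p : Q41} (h : Represents v p) (p₀ : Q41) :
    affineRep p₀ p = (dotProduct p₀.1.rep v)⁻¹ • v := by
  obtain ⟨c, hc, hv⟩ := h.exists_smul (represents_rep p)
  unfold affineRep
  rw [hv, dotProduct_smul, smul_eq_mul, mul_inv, smul_smul]
  congr 1
  field_simp

theorem affineRep_represents {p₀ p : Q41} (h : dotProduct p₀.1.rep p.1.rep ≠ 0) :
    Represents (affineRep p₀ p) p :=
  (represents_rep p).smul (inv_ne_zero h)

theorem dotProduct_rep_self_ne_zero (p : Q41) : dotProduct p.1.rep p.1.rep ≠ 0 := by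
  intro h
  exact p.1.rep_nonzero (dotProduct_self_eq_zero.1 h)

theorem affineRep_self_represents (p : Q41) : Represents (affineRep p p) p :=
  affineRep_represents (dotProduct_rep_self_ne_zero p)

theorem affineRep_ne_zero_iff {p₀ p : Q41} :
    affineRep p₀ p ≠ 0 ↔ dotProduct p₀.1.rep p.1.rep ≠ 0 := by
  unfold affineRep
  rw [smul_ne_zero_iff]
  simp [p.1.rep_nonzero]

/-! ### Calculus in the plane -/

section PlaneCalculus

variable {F : Type*} [NormedAddCommGroup F] [NormedSpace ℝ F] {s : Set ℂ} {z : ℂ}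

theorem smooth_at {f : ℂ → F} (hs : IsOpen s) (hf : ContDiffOn ℝ ∞ f s) (hz : z ∈ s) :
    ContDiffAt ℝ ∞ f z := hf.contDiffAt (hs.mem_nhds hz)

theorem diff_at {f : ℂ → F} (hs : IsOpen s) (hf : ContDiffOn ℝ ∞ f s) (hz : z ∈ s) :
    DifferentiableAt ℝ f z := (smooth_at hs hf hz).differentiableAt (by simp)

theorem smooth_fderiv {f : ℂ → F} (hs : IsOpen s) (hf : ContDiffOn ℝ ∞ f s) :
    ContDiffOn ℝ ∞ (fderiv ℝ f) s := hf.fderiv_of_isOpen hs (by simp)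

theorem smooth_du {f : ℂ → F} (hs : IsOpen s) (hf : ContDiffOn ℝ ∞ f s) :
    ContDiffOn ℝ ∞ (du f) s := (smooth_fderiv hs hf).clm_apply contDiffOn_const

theorem smooth_dv {f : ℂ → F} (hs : IsOpen s) (hf : ContDiffOn ℝ ∞ f s) :
    ContDiffOn ℝ ∞ (dv f) s := (smooth_fderiv hs hf).clm_apply contDiffOn_const

theorem smooth_lap {f : ℂ → F} (hs : IsOpen s) (hf : ContDiffOn ℝ ∞ f s) :
    ContDiffOn ℝ ∞ (lap f) s :=
  (smooth_du hs (smooth_du hs hf)).add (smooth_dv hs (smooth_dv hs hf))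

theorem smooth_ip {f g : ℂ → R62} (hf : ContDiffOn ℝ ∞ f s) (hg : ContDiffOn ℝ ∞ g s) :
    ContDiffOn ℝ ∞ (fun w => ip (f w) (g w)) s :=
  (contDiffOn_const (c := ipL)).clm_apply hf |>.clm_apply hg

theorem fderiv_congr_on {f g : ℂ → F} (hs : IsOpen s) (h : Set.EqOn f g s) (hz : z ∈ s) :
    fderiv ℝ f z = fderiv ℝ g z :=
  (h.eventuallyEq_of_mem (hs.mem_nhds hz)).fderiv_eq

theorem du_congr_on {f g : ℂ → F} (hs : IsOpen s) (h : Set.EqOn f g s) :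
    Set.EqOn (du f) (du g) s := fun z hz => by
  unfold du; rw [fderiv_congr_on hs h hz]

theorem dv_congr_on {f g : ℂ → F} (hs : IsOpen s) (h : Set.EqOn f g s) :
    Set.EqOn (dv f) (dv g) s := fun z hz => by
  unfold dv; rw [fderiv_congr_on hs h hz]

theorem fderiv_ip {f g : ℂ → R62} (hf : DifferentiableAt ℝ f z) (hg : DifferentiableAt ℝ g z)
    (a : ℂ) : fderiv ℝ (fun w => ip (f w) (g w)) z a
      = ip (fderiv ℝ f z a) (g z) + ip (f z) (fderiv ℝ g z a) := by
  have h := (ipL.hasFDerivAt_of_bilinear hf.hasFDerivAt hg.hasFDerivAt).fderiv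
  simp only [ipL_apply] at h
  rw [h]
  simp [ipL_apply, add_comm]

theorem du_ip {f g : ℂ → R62} (hf : DifferentiableAt ℝ f z) (hg : DifferentiableAt ℝ g z) :
    du (fun w => ip (f w) (g w)) z = ip (du f z) (g z) + ip (f z) (du g z) := fderiv_ip hf hg 1

theorem dv_ip {f g : ℂ → R62} (hf : DifferentiableAt ℝ f z) (hg : DifferentiableAt ℝ g z) :
    dv (fun w => ip (f w) (g w)) z = ip (dv f z) (g z) + ip (f z) (dv g z) :=
  fderiv_ip hf hg Complex.I

/-- The product rule for a constant scalar product. -/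
theorem ip_du_of_const {f g : ℂ → R62} {c : ℝ} (hs : IsOpen s) (hf : ContDiffOn ℝ ∞ f s)
    (hg : ContDiffOn ℝ ∞ g s) (h : ∀ w ∈ s, ip (f w) (g w) = c) (hz : z ∈ s) :
    ip (du f z) (g z) + ip (f z) (du g z) = 0 := by
  rw [← du_ip (diff_at hs hf hz) (diff_at hs hg hz)]
  refine (du_congr_on (g := fun _ => c) hs (fun w hw => h w hw) hz).trans ?_
  simp [du]

theorem ip_dv_of_const {f g : ℂ → R62} {c : ℝ} (hs : IsOpen s) (hf : ContDiffOn ℝ ∞ f s)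
    (hg : ContDiffOn ℝ ∞ g s) (h : ∀ w ∈ s, ip (f w) (g w) = c) (hz : z ∈ s) :
    ip (dv f z) (g z) + ip (f z) (dv g z) = 0 := by
  rw [← dv_ip (diff_at hs hf hz) (diff_at hs hg hz)]
  refine (dv_congr_on (g := fun _ => c) hs (fun w hw => h w hw) hz).trans ?_
  simp [dv]

theorem du_add {f g : ℂ → F} (hf : DifferentiableAt ℝ f z) (hg : DifferentiableAt ℝ g z) :
    du (fun w => f w + g w) z = du f z + du g z := by
  unfold du; rw [fderiv_fun_add hf hg]; rfl

theorem dv_add {f g : ℂ → F} (hf : DifferentiableAt ℝ f z) (hg : DifferentiableAt ℝ g z) :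
    dv (fun w => f w + g w) z = dv f z + dv g z := by
  unfold dv; rw [fderiv_fun_add hf hg]; rfl

theorem du_sub {f g : ℂ → F} (hf : DifferentiableAt ℝ f z) (hg : DifferentiableAt ℝ g z) :
    du (fun w => f w - g w) z = du f z - du g z := by
  unfold du; rw [fderiv_fun_sub hf hg]; rfl

theorem dv_sub {f g : ℂ → F} (hf : DifferentiableAt ℝ f z) (hg : DifferentiableAt ℝ g z) :
    dv (fun w => f w - g w) z = dv f z - dv g z := by
  unfold dv; rw [fderiv_fun_sub hf hg]; rfl

theorem du_smul {c : ℂ → ℝ} {f : ℂ → F} (hc : DifferentiableAt ℝ c z)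
    (hf : DifferentiableAt ℝ f z) :
    du (fun w => c w • f w) z = c z • du f z + du c z • f z := by
  unfold du; rw [fderiv_fun_smul hc hf]; simp

theorem dv_smul {c : ℂ → ℝ} {f : ℂ → F} (hc : DifferentiableAt ℝ c z)
    (hf : DifferentiableAt ℝ f z) :
    dv (fun w => c w • f w) z = c z • dv f z + dv c z • f z := by
  unfold dv; rw [fderiv_fun_smul hc hf]; simp

theorem du_const_smul (c : ℝ) {f : ℂ → F} (hf : DifferentiableAt ℝ f z) :
    du (fun w => c • f w) z = c • du f z := by
  unfold du; rw [fderiv_fun_const_smul hf]; rfl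

theorem dv_const_smul (c : ℝ) {f : ℂ → F} (hf : DifferentiableAt ℝ f z) :
    dv (fun w => c • f w) z = c • dv f z := by
  unfold dv; rw [fderiv_fun_const_smul hf]; rfl

theorem fderiv_fderiv_apply {f : ℂ → F} (hf : ContDiffAt ℝ ∞ f z) (a b : ℂ) :
    fderiv ℝ (fun w => fderiv ℝ f w b) z a = hess f z a b := by
  have h : DifferentiableAt ℝ (fderiv ℝ f) z :=
    (hf.fderiv_right (m := 1) (WithTop.coe_le_coe.2 le_top)).differentiableAt (by simp)
  unfold hess
  rw [fderiv_clm_apply h (differentiableAt_const b)]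
  simp

theorem hess_comm {f : ℂ → F} (hf : ContDiffAt ℝ ∞ f z) (a b : ℂ) :
    hess f z a b = hess f z b a :=
  (hf.isSymmSndFDerivAt (by simpa using ENat.LEInfty.out)).eq a b

theorem dv_du_comm {f : ℂ → F} (hf : ContDiffAt ℝ ∞ f z) : dv (du f) z = du (dv f) z := by
  unfold dv du
  rw [fderiv_fderiv_apply hf, fderiv_fderiv_apply hf, hess_comm hf]

theorem fderiv_complex_apply (f : ℂ → F) (a : ℂ) :
    fderiv ℝ f z a = a.re • du f z + a.im • dv f z := by
  have : a = a.re • (1 : ℂ) + a.im • Complex.I := by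
    conv_lhs => rw [← Complex.re_add_im a]
    simp
  conv_lhs => rw [this]
  rw [map_add, map_smul, map_smul]; rfl

theorem hess_complex_apply {f : ℂ → F} (hf : ContDiffAt ℝ ∞ f z) (a b : ℂ) :
    hess f z a b = (a.re * b.re) • du (du f) z + (a.re * b.im + a.im * b.re) • du (dv f) z
      + (a.im * b.im) • dv (dv f) z := by
  have h1 : ∀ c : ℂ, hess f z c 1 = fderiv ℝ (du f) z c := fun c =>
    (fderiv_fderiv_apply hf c 1).symm
  have h2 : ∀ c : ℂ, hess f z c Complex.I = fderiv ℝ (dv f) z c := fun c =>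
    (fderiv_fderiv_apply hf c Complex.I).symm
  have hb : b = b.re • (1 : ℂ) + b.im • Complex.I := by
    conv_lhs => rw [← Complex.re_add_im b]
    simp
  have : hess f z a b = b.re • hess f z a 1 + b.im • hess f z a Complex.I := by
    conv_lhs => rw [hb]
    unfold hess
    rw [map_add, map_smul, map_smul]
  rw [this, h1, h2, fderiv_complex_apply, fderiv_complex_apply, dv_du_comm hf]
  module

/-- Chain rule for a holomorphic change of coordinate. -/
theorem du_comp {f : ℂ → F} {φ : ℂ → ℂ} {φ' : ℂ} (hf : DifferentiableAt ℝ f (φ z))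
    (hφ : HasDerivAt φ φ' z) :
    du (fun w => f (φ w)) z = φ'.re • du f (φ z) + φ'.im • dv f (φ z) := by
  have h := (hf.hasFDerivAt.comp z (hφ.hasFDerivAt.restrictScalars ℝ)).fderiv
  unfold du
  rw [show (fun w => f (φ w)) = f ∘ φ from rfl, h]
  simp [fderiv_complex_apply f φ', du]

theorem dv_comp {f : ℂ → F} {φ : ℂ → ℂ} {φ' : ℂ} (hf : DifferentiableAt ℝ f (φ z))
    (hφ : HasDerivAt φ φ' z) :
    dv (fun w => f (φ w)) z = -φ'.im • du f (φ z) + φ'.re • dv f (φ z) := by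
  have h := (hf.hasFDerivAt.comp z (hφ.hasFDerivAt.restrictScalars ℝ)).fderiv
  unfold dv
  rw [show (fun w => f (φ w)) = f ∘ φ from rfl, h]
  have hI := fderiv_complex_apply (z := φ z) f (Complex.I * φ')
  simp [hI, dv]

/-- The Laplacian of a constant scalar product. -/
theorem ip_lap_of_const {f g : ℂ → R62} {c : ℝ} (hs : IsOpen s) (hf : ContDiffOn ℝ ∞ f s)
    (hg : ContDiffOn ℝ ∞ g s) (h : ∀ w ∈ s, ip (f w) (g w) = c) (hz : z ∈ s) :
    ip (lap f z) (g z) + 2 * ip (du f z) (du g z) + 2 * ip (dv f z) (dv g z)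
      + ip (f z) (lap g z) = 0 := by
  have hu : ∀ w ∈ s, ip (du f w) (g w) + ip (f w) (du g w) = 0 := fun w hw =>
    ip_du_of_const hs hf hg h hw
  have hv : ∀ w ∈ s, ip (dv f w) (g w) + ip (f w) (dv g w) = 0 := fun w hw =>
    ip_dv_of_const hs hf hg h hw
  have h1 := du_congr_on (g := fun _ => (0 : ℝ)) hs hu hz
  have h2 := dv_congr_on (g := fun _ => (0 : ℝ)) hs hv hz
  rw [du_add (diff_at hs (smooth_ip (smooth_du hs hf) hg) hz)
      (diff_at hs (smooth_ip hf (smooth_du hs hg)) hz),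
    du_ip (diff_at hs (smooth_du hs hf) hz) (diff_at hs hg hz),
    du_ip (diff_at hs hf hz) (diff_at hs (smooth_du hs hg) hz)] at h1
  rw [dv_add (diff_at hs (smooth_ip (smooth_dv hs hf) hg) hz)
      (diff_at hs (smooth_ip hf (smooth_dv hs hg)) hz),
    dv_ip (diff_at hs (smooth_dv hs hf) hz) (diff_at hs hg hz),
    dv_ip (diff_at hs hf hz) (diff_at hs (smooth_dv hs hg) hz)] at h2
  have h3 : du (fun _ : ℂ => (0 : ℝ)) z = 0 := by simp [du]
  have h4 : dv (fun _ : ℂ => (0 : ℝ)) z = 0 := by simp [dv]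
  rw [h3] at h1
  rw [h4] at h2
  unfold lap
  rw [ip_add_left, ip_add_right]
  linarith

end PlaneCalculus

/-! ### Integration by parts -/

open MeasureTheory in
/-- The integral of a derivative of a compactly supported function vanishes. -/
theorem setIntegral_fderiv_eq_zero {g : ℂ → ℝ} {s k : Set ℂ} (hs : IsOpen s)
    (hg : ContDiffOn ℝ ∞ g s) (hk : IsCompact k) (hks : k ⊆ s) (h0 : ∀ z ∈ s, z ∉ k → g z = 0)
    (a : ℂ) : ∫ z in s, fderiv ℝ g z a = 0 := by
  -- Extension by zero stays smooth on the whole plane, because `g` already vanishes off the compact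
  -- set `k` inside `s`.
  set G : ℂ → ℝ := s.indicator g with hG
  have hGk : ∀ z, z ∉ k → G z = 0 := fun z hz => by
    by_cases hzs : z ∈ s
    · rw [hG, Set.indicator_of_mem hzs, h0 z hzs hz]
    · rw [hG, Set.indicator_of_notMem hzs]
  have hGs : Set.EqOn G g s := fun z hz => Set.indicator_of_mem hz g
  have hsm : ContDiff ℝ ∞ G := by
    rw [contDiff_iff_contDiffAt]
    intro z
    by_cases hz : z ∈ s
    · exact (smooth_at hs hg hz).congr_of_eventuallyEq
        (hGs.eventuallyEq_of_mem (hs.mem_nhds hz))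
    · have : G =ᶠ[nhds z] fun _ => 0 := by
        filter_upwards [hk.isClosed.isOpen_compl.mem_nhds fun h => hz (hks h)] with w hw
        exact hGk w hw
      exact contDiffAt_const.congr_of_eventuallyEq this
  have hcs : HasCompactSupport G := HasCompactSupport.intro hk fun z hz => hGk z hz
  have hcd : HasCompactSupport (fderiv ℝ G) := hcs.fderiv ℝ
  have hcont : Continuous (fderiv ℝ G) := hsm.continuous_fderiv (by simp)
  have h1 : ∫ z, fderiv ℝ G z a = 0 := by
    -- Integration by parts against the constant function `1`.
    have h := integral_bilinear_fderiv_right_eq_neg_left_of_integrable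
      (μ := (volume : Measure ℂ)) (f := fun _ : ℂ => (1 : ℝ)) (g := G) (v := a)
      (B := ContinuousLinearMap.mul ℝ ℝ) (by simp)
      (by simpa using (hcont.clm_apply continuous_const).integrable_of_hasCompactSupport
            (hcd.comp_left (g := fun T : ℂ →L[ℝ] ℝ => T a) rfl))
      (by simpa using hsm.continuous.integrable_of_hasCompactSupport hcs)
      (fun x _ => differentiableAt_const _)
      (fun x _ => (hsm.differentiable (by simp)) x)
    simpa using h
  have h2 : ∫ z in s, fderiv ℝ G z a = ∫ z, fderiv ℝ G z a := by
    refine setIntegral_eq_integral_of_forall_compl_eq_zero fun z hz => ?_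
    have : G =ᶠ[nhds z] fun _ => 0 := by
      filter_upwards [hk.isClosed.isOpen_compl.mem_nhds fun h => hz (hks h)] with w hw
      exact hGk w hw
    rw [this.fderiv_eq]; simp
  rw [← h1, ← h2]
  exact setIntegral_congr_fun hs.measurableSet fun z hz => by
    rw [fderiv_congr_on hs hGs hz]

/-! ### The Willmore integrand as a function of the two-jet -/

/-- The Gram determinant of two vectors. -/
def gramDet (U V : R62) : ℝ := ip U U * ip V V - ip U V ^ 2

/-- The scalar product of the components of `X`, `Z` orthogonal to `U`, `V`, multiplied by the
Gram determinant of `U`, `V`. -/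
def normalPairing (U V X Z : R62) : ℝ :=
  ip X Z * gramDet U V - (ip V V * ip X U * ip Z U
    - ip U V * (ip X U * ip Z V + ip X V * ip Z U) + ip U U * ip X V * ip Z V)

/-- The first and second derivatives of a map at a point. -/
abbrev Jet : Type := R62 × R62 × R62 × R62 × R62

/-- The Willmore integrand in terms of `Y_u, Y_v, Y_uu, Y_uv, Y_vv`. -/
def jetWillmore (j : Jet) : ℝ :=
  (normalPairing j.1 j.2.1
      (ip j.2.1 j.2.1 • j.2.2.1 - (2 * ip j.1 j.2.1) • j.2.2.2.1 + ip j.1 j.1 • j.2.2.2.2)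
      (ip j.2.1 j.2.1 • j.2.2.1 - (2 * ip j.1 j.2.1) • j.2.2.2.1 + ip j.1 j.1 • j.2.2.2.2)
      / gramDet j.1 j.2.1
    - 4 * (normalPairing j.1 j.2.1 j.2.2.1 j.2.2.2.2
      - normalPairing j.1 j.2.1 j.2.2.2.1 j.2.2.2.1))
    / (16 * (gramDet j.1 j.2.1 * √(gramDet j.1 j.2.1)))

/-- The two-jet of `Y` at `z`. -/
def jet (Y : ℂ → R62) (z : ℂ) : Jet :=
  (du Y z, dv Y z, du (du Y) z, du (dv Y) z, dv (dv Y) z)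

-- Algebra of the normal pairing and invariance of the jet integrand.

theorem normalPairing_comm (U V X X' : R62) : normalPairing U V X X' = normalPairing U V X' X := by
  unfold normalPairing; rw [ip_comm X X']; ring

theorem normalPairing_add_left (U V X Y Z : R62) :
    normalPairing U V (X + Y) Z = normalPairing U V X Z + normalPairing U V Y Z := by
  simp only [normalPairing, ip_add_left]; ring

theorem normalPairing_smul_left (U V : R62) (c : ℝ) (X Z : R62) :
    normalPairing U V (c • X) Z = c * normalPairing U V X Z := by
  simp only [normalPairing, ip_smul_left]; ring

theorem normalPairing_sub_left (U V X Y Z : R62) :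
    normalPairing U V (X - Y) Z = normalPairing U V X Z - normalPairing U V Y Z := by
  simp only [normalPairing, ip_sub_left]; ring

theorem normalPairing_add_right (U V X Y Z : R62) :
    normalPairing U V Z (X + Y) = normalPairing U V Z X + normalPairing U V Z Y := by
  simp only [normalPairing, ip_add_left, ip_add_right]; ring

theorem normalPairing_smul_right (U V : R62) (c : ℝ) (X Z : R62) :
    normalPairing U V Z (c • X) = c * normalPairing U V Z X := by
  simp only [normalPairing, ip_smul_left, ip_smul_right]; ring

theorem normalPairing_sub_right (U V X Y Z : R62) :
    normalPairing U V Z (X - Y) = normalPairing U V Z X - normalPairing U V Z Y := by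
  simp only [normalPairing, ip_sub_left, ip_sub_right]; ring

theorem normalPairing_left_U (U V Z : R62) : normalPairing U V U Z = 0 := by
  simp only [normalPairing, gramDet, ip_comm Z]; ring

theorem normalPairing_left_V (U V Z : R62) : normalPairing U V V Z = 0 := by
  simp only [normalPairing, gramDet, ip_comm Z, ip_comm V U]; ring

theorem normalPairing_right_U (U V Z : R62) : normalPairing U V Z U = 0 := by
  rw [normalPairing_comm, normalPairing_left_U]

theorem normalPairing_right_V (U V Z : R62) : normalPairing U V Z V = 0 := by
  rw [normalPairing_comm, normalPairing_left_V]

/-- Change of the lift: effect on the normal product of vectors orthogonal to `Y`. -/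
theorem normalPairing_lift {Y U V X X' : R62} (hY : ip Y Y = 0) (hU : ip U Y = 0) (hV : ip V Y = 0)
    (hX : ip X Y = 0) (hX' : ip X' Y = 0) (ρ a b x x' : ℝ) :
    normalPairing (ρ • U + a • Y) (ρ • V + b • Y) (ρ • X + x • Y) (ρ • X' + x' • Y)
      = ρ ^ 6 * normalPairing U V X X' := by
  simp only [normalPairing, gramDet, ip_add_left, ip_add_right, ip_smul_left, ip_smul_right, hY, hU,
    hV, hX, hX', ip_comm Y U, ip_comm Y V, ip_comm Y X']
  ring

theorem gramDet_lift {Y U V : R62} (hY : ip Y Y = 0) (hU : ip U Y = 0) (hV : ip V Y = 0)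
    (ρ a b : ℝ) : gramDet (ρ • U + a • Y) (ρ • V + b • Y) = ρ ^ 4 * gramDet U V := by
  simp only [gramDet, ip_add_left, ip_add_right, ip_smul_left, ip_smul_right, hY, hU,
    hV, ip_comm Y U, ip_comm Y V]
  ring

/-- The trace of the second derivative, multiplied by the Gram determinant. -/
def jetTrace (j : Jet) : R62 :=
  ip j.2.1 j.2.1 • j.2.2.1 - (2 * ip j.1 j.2.1) • j.2.2.2.1 + ip j.1 j.1 • j.2.2.2.2

/-- The trace of the second derivative of a null lift is not orthogonal to `Y`, but the trace-free
parts are. In this form the independence of the lift can be read off. -/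
theorem jetWillmore_eq_traceless (U V A B C : R62) (hD : gramDet U V ≠ 0) :
    jetWillmore (U, V, A, B, C) =
      (normalPairing U V (B - (ip U V / (2 * gramDet U V)) • jetTrace (U, V, A, B, C))
          (B - (ip U V / (2 * gramDet U V)) • jetTrace (U, V, A, B, C))
        - normalPairing U V (A - (ip U U / (2 * gramDet U V)) • jetTrace (U, V, A, B, C))
          (C - (ip V V / (2 * gramDet U V)) • jetTrace (U, V, A, B, C)))
        / (4 * (gramDet U V * √(gramDet U V))) := by
  rw [show (4 * (gramDet U V * √(gramDet U V))) = (16 * (gramDet U V * √(gramDet U V))) / 4 by ring,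
    div_div_eq_mul_div]
  unfold jetWillmore
  congr 1
  simp only [jetTrace, normalPairing_add_left, normalPairing_add_right, normalPairing_sub_left,
    normalPairing_sub_right, normalPairing_smul_left, normalPairing_smul_right,
    normalPairing_comm U V B A, normalPairing_comm U V C A, normalPairing_comm U V C B]
  have h : gramDet U V = ip U U * ip V V - ip U V ^ 2 := rfl
  generalize gramDet U V = D at *
  generalize normalPairing U V A A = aa
  generalize normalPairing U V A B = ab
  generalize normalPairing U V A C = ac
  generalize normalPairing U V B B = bb
  generalize normalPairing U V B C = bc
  generalize normalPairing U V C C = cc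
  field_simp
  subst h
  ring

/-- The integrand does not depend on the lift. -/
theorem jetWillmore_lift {Y U V A B C : R62} (hY : ip Y Y = 0) (hU : ip U Y = 0)
    (hV : ip V Y = 0) (hA : ip A Y = -ip U U) (hB : ip B Y = -ip U V) (hC : ip C Y = -ip V V)
    (hD : 0 < gramDet U V) {ρ : ℝ} (hρ : ρ ≠ 0) (a b x y z : ℝ) :
    jetWillmore (ρ • U + a • Y, ρ • V + b • Y, ρ • A + (2 * a) • U + x • Y,
      ρ • B + a • V + b • U + y • Y, ρ • C + (2 * b) • V + z • Y) = jetWillmore (U, V, A, B, C) := by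
  have hD' := gramDet_lift hY hU hV ρ a b
  set U' := ρ • U + a • Y with hU'
  set V' := ρ • V + b • Y with hV'
  set D := gramDet U V with hDdef
  have hE : ip U' U' = ρ ^ 2 * ip U U := by
    rw [hU']; simp only [ip_add_left, ip_add_right, ip_smul_left, ip_smul_right, hY, hU,
      ip_comm Y U]; ring
  have hF : ip U' V' = ρ ^ 2 * ip U V := by
    rw [hU', hV']; simp only [ip_add_left, ip_add_right, ip_smul_left, ip_smul_right, hY, hU, hV,
      ip_comm Y V]; ring
  have hG : ip V' V' = ρ ^ 2 * ip V V := by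
    rw [hV']; simp only [ip_add_left, ip_add_right, ip_smul_left, ip_smul_right, hY, hV,
      ip_comm Y V]; ring
  have hρ4 : 0 < ρ ^ 4 := by positivity
  rw [jetWillmore_eq_traceless _ _ _ _ _ hD.ne', jetWillmore_eq_traceless _ _ _ _ _
    (by rw [hD']; positivity), hD', hE, hF, hG]
  have hsqrt : √(ρ ^ 4 * D) = ρ ^ 2 * √D := by
    rw [Real.sqrt_mul hρ4.le, show ρ ^ 4 = (ρ ^ 2) ^ 2 by ring, Real.sqrt_sq (by positivity)]
  set T := jetTrace (U, V, A, B, C) with hT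
  have hTdef : T = ip V V • A - (2 * ip U V) • B + ip U U • C := rfl
  -- This value is what makes the three trace-free parts below orthogonal to `Y`.
  have hTY : ip T Y = -2 * D := by
    rw [hTdef, hDdef]
    simp only [ip_add_left, ip_sub_left, ip_smul_left, hA, hB, hC, gramDet]; ring
  set T' := jetTrace (U', V', ρ • A + (2 * a) • U + x • Y,
      ρ • B + a • V + b • U + y • Y, ρ • C + (2 * b) • V + z • Y) with hT'
  have hT'def : T' = ρ ^ 3 • T + ρ ^ 2 • (ip V V • ((2 * a) • U + x • Y)
      - (2 * ip U V) • (a • V + b • U + y • Y) + ip U U • ((2 * b) • V + z • Y)) := by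
    rw [hT', hTdef, jetTrace]
    simp only [hE, hF, hG]
    module
  -- the three traceless second derivatives
  set A₀ := A - (ip U U / (2 * D)) • T with hA₀
  set B₀ := B - (ip U V / (2 * D)) • T with hB₀
  set C₀ := C - (ip V V / (2 * D)) • T with hC₀
  have hA₀Y : ip A₀ Y = 0 := by
    rw [hA₀, ip_sub_left, ip_smul_left, hTY, hA]; field_simp; ring
  have hB₀Y : ip B₀ Y = 0 := by
    rw [hB₀, ip_sub_left, ip_smul_left, hTY, hB]; field_simp; ring
  have hC₀Y : ip C₀ Y = 0 := by
    rw [hC₀, ip_sub_left, ip_smul_left, hTY, hC]; field_simp; ring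
  -- Tangential terms are annihilated by the normal pairing, and `Y`-terms do not contribute, since
  -- `Y` is null and orthogonal to all vectors involved. Only the factor `ρ⁶` survives; it cancels
  -- against `D√D`.
  have key : ∀ (X X' : R62), ip X Y = 0 → ip X' Y = 0 → ∀ m n k m' n' k' : ℝ,
      normalPairing U' V' (ρ • X + m • U' + n • V' + k • Y) (ρ • X' + m' • U' + n' • V' + k' • Y)
        = ρ ^ 6 * normalPairing U V X X' := by
    intro X X' hX hX' m n k m' n' k'
    rw [show ρ • X + m • U' + n • V' + k • Y = (ρ • X + k • Y) + (m • U' + n • V') by module,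
      show ρ • X' + m' • U' + n' • V' + k' • Y = (ρ • X' + k' • Y) + (m' • U' + n' • V') by module]
    simp only [normalPairing_add_left, normalPairing_add_right, normalPairing_smul_left,
      normalPairing_smul_right, normalPairing_left_U, normalPairing_left_V, normalPairing_right_U,
      normalPairing_right_V]
    have := normalPairing_lift hY hU hV hX hX' ρ a b k k'
    simp only [normalPairing_add_left, normalPairing_add_right, normalPairing_smul_left,
      normalPairing_smul_right] at this
    rw [← hU', ← hV'] at this
    linarith
  have hUeq : U = ρ⁻¹ • U' - (ρ⁻¹ * a) • Y := by
    rw [hU', smul_add, smul_smul, smul_smul, inv_mul_cancel₀ hρ]; module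
  have hVeq : V = ρ⁻¹ • V' - (ρ⁻¹ * b) • Y := by
    rw [hV', smul_add, smul_smul, smul_smul, inv_mul_cancel₀ hρ]; module
  have repr : ∀ (m n k : ℝ), ∃ m' n' k' : ℝ,
      m • U + n • V + k • Y = m' • U' + n' • V' + k' • Y := by
    intro m n k
    refine ⟨m * ρ⁻¹, n * ρ⁻¹, k - m * (ρ⁻¹ * a) - n * (ρ⁻¹ * b), ?_⟩
    rw [hUeq, hVeq]; module
  -- Trace-free parts scale by `ρ` up to combinations of the new tangent vectors and `Y`; the values
  -- of these coefficients are irrelevant by `key`.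
  have form : ∀ (X : R62) (q m n k : ℝ), ∃ m' n' k' : ℝ,
      (ρ • X + m • U + n • V + k • Y) - (ρ ^ 2 * q / (2 * (ρ ^ 4 * D))) • T'
        = ρ • (X - (q / (2 * D)) • T) + m' • U' + n' • V' + k' • Y := by
    intro X q m n k
    set c := ρ ^ 2 * q / (2 * (ρ ^ 4 * D)) with hc
    have hc1 : c * ρ ^ 3 = ρ * (q / (2 * D)) := by rw [hc]; field_simp
    obtain ⟨m', n', k', h⟩ := repr
      (m - c * ρ ^ 2 * (ip V V * (2 * a) - 2 * ip U V * b))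
      (n - c * ρ ^ 2 * (ip U U * (2 * b) - 2 * ip U V * a))
      (k - c * ρ ^ 2 * (ip V V * x - 2 * ip U V * y + ip U U * z))
    refine ⟨m', n', k', ?_⟩
    have : ρ • (X - (q / (2 * D)) • T) + m' • U' + n' • V' + k' • Y
        = ρ • X - (c * ρ ^ 3) • T + (m' • U' + n' • V' + k' • Y) := by rw [hc1]; module
    rw [this, ← h, hT'def]
    module
  obtain ⟨ma, na, ka, hAf⟩ := form A (ip U U) (2 * a) 0 x
  obtain ⟨mb, nb, kb, hBf⟩ := form B (ip U V) b a y
  obtain ⟨mc, nc, kc, hCf⟩ := form C (ip V V) 0 (2 * b) z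
  rw [show ρ • A + (2 * a) • U + x • Y = ρ • A + (2 * a) • U + (0 : ℝ) • V + x • Y by module, hAf,
    show ρ • B + a • V + b • U + y • Y = ρ • B + b • U + a • V + y • Y by module, hBf,
    show ρ • C + (2 * b) • V + z • Y = ρ • C + (0 : ℝ) • U + (2 * b) • V + z • Y by module, hCf,
    key _ _ hB₀Y hB₀Y, key _ _ hA₀Y hC₀Y, hsqrt]
  have hsD : √D ≠ 0 := (Real.sqrt_pos.2 hD).ne'
  rw [← hDdef]
  field_simp

/-- Behaviour of the integrand under a conformal change of coordinate. -/
theorem jetWillmore_conformal (U V A B C : R62) {a b : ℝ} (hab : 0 < a ^ 2 + b ^ 2)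
    (hD : 0 < gramDet U V) (m n : ℝ) :
    jetWillmore (a • U + b • V, -b • U + a • V,
      a ^ 2 • A + (2 * a * b) • B + b ^ 2 • C + m • U + n • V,
      (-(a * b)) • A + (a ^ 2 - b ^ 2) • B + (a * b) • C - n • U + m • V,
      b ^ 2 • A - (2 * a * b) • B + a ^ 2 • C - m • U - n • V)
      = (a ^ 2 + b ^ 2) * jetWillmore (U, V, A, B, C) := by
  have hE : ip (a • U + b • V) (a • U + b • V) = a ^ 2 * ip U U + 2 * a * b * ip U V
      + b ^ 2 * ip V V := by
    simp only [ip_add_left, ip_add_right, ip_smul_left, ip_smul_right, ip_comm V U]; ring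
  have hF : ip (a • U + b • V) (-b • U + a • V) = -(a * b) * ip U U + (a ^ 2 - b ^ 2) * ip U V
      + a * b * ip V V := by
    simp only [ip_add_left, ip_add_right, ip_smul_left, ip_smul_right, ip_comm V U]; ring
  have hG : ip (-b • U + a • V) (-b • U + a • V) = b ^ 2 * ip U U - 2 * a * b * ip U V
      + a ^ 2 * ip V V := by
    simp only [ip_add_left, ip_add_right, ip_smul_left, ip_smul_right, ip_comm V U]; ring
  have hD' : gramDet (a • U + b • V) (-b • U + a • V) = (a ^ 2 + b ^ 2) ^ 2 * gramDet U V := by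
    unfold gramDet; rw [hE, hF, hG]; ring
  have hS : ∀ X X', normalPairing (a • U + b • V) (-b • U + a • V) X X'
      = (a ^ 2 + b ^ 2) ^ 2 * normalPairing U V X X' := by
    intro X X'
    unfold normalPairing
    rw [hD', hE, hF, hG]
    simp only [ip_add_right, ip_smul_right]
    ring
  set μ := a ^ 2 + b ^ 2 with hμ
  have hsqrt : √(μ ^ 2 * gramDet U V) = μ * √(gramDet U V) := by
    rw [Real.sqrt_mul (by positivity), Real.sqrt_sq hab.le]
  have hDU : gramDet U V = ip U U * ip V V - ip U V ^ 2 := rfl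
  unfold jetWillmore
  simp only [hS, hD', hE, hF, hG, hsqrt]
  have hsD : √(gramDet U V) ≠ 0 := (Real.sqrt_pos.2 hD).ne'
  -- The trace is multiplied by `μ²` modulo tangent vectors: the second derivative of the coordinate
  -- change enters only tangentially.
  have hT : ∃ m' n' : ℝ, (b ^ 2 * ip U U - 2 * a * b * ip U V + a ^ 2 * ip V V) •
        (a ^ 2 • A + (2 * a * b) • B + b ^ 2 • C + m • U + n • V)
      - (2 * (-(a * b) * ip U U + (a ^ 2 - b ^ 2) * ip U V + a * b * ip V V)) •
        ((-(a * b)) • A + (a ^ 2 - b ^ 2) • B + (a * b) • C - n • U + m • V)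
      + (a ^ 2 * ip U U + 2 * a * b * ip U V + b ^ 2 * ip V V) •
        (b ^ 2 • A - (2 * a * b) • B + a ^ 2 • C - m • U - n • V)
      = μ ^ 2 • (ip V V • A - (2 * ip U V) • B + ip U U • C) + m' • U + n' • V := by
    refine ⟨(b ^ 2 * ip U U - 2 * a * b * ip U V + a ^ 2 * ip V V) * m
        + (2 * (-(a * b) * ip U U + (a ^ 2 - b ^ 2) * ip U V + a * b * ip V V)) * n
        - (a ^ 2 * ip U U + 2 * a * b * ip U V + b ^ 2 * ip V V) * m,
      (b ^ 2 * ip U U - 2 * a * b * ip U V + a ^ 2 * ip V V) * n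
        - (2 * (-(a * b) * ip U U + (a ^ 2 - b ^ 2) * ip U V + a * b * ip V V)) * m
        - (a ^ 2 * ip U U + 2 * a * b * ip U V + b ^ 2 * ip V V) * n, ?_⟩
    rw [hμ]; module
  obtain ⟨m', n', hT⟩ := hT
  rw [hT]
  generalize ip V V • A - (2 * ip U V) • B + ip U U • C = T
  simp only [normalPairing_add_left, normalPairing_add_right, normalPairing_smul_left,
    normalPairing_smul_right, normalPairing_left_U, normalPairing_left_V, normalPairing_right_U,
    normalPairing_right_V, normalPairing_sub_left, normalPairing_sub_right,
    normalPairing_comm U V B A, normalPairing_comm U V C A, normalPairing_comm U V C B]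
  generalize gramDet U V = D at *
  generalize normalPairing U V A A = aa
  generalize normalPairing U V A B = ab
  generalize normalPairing U V A C = ac
  generalize normalPairing U V B B = bb
  generalize normalPairing U V B C = bc
  generalize normalPairing U V C C = cc
  generalize normalPairing U V T T = tt
  have : μ ≠ 0 := hab.ne'
  field_simp
  rw [hμ]
  ring

/-- The squared length of the normal component. -/
theorem ip_normal_component {Y X₁ X₂ N X : R62} (hY : ip Y Y = 0) (h1 : ip X₁ Y = 0)
    (h2 : ip X₂ Y = 0) (h11 : ip X₁ X₁ = 1) (h12 : ip X₁ X₂ = 0) (h22 : ip X₂ X₂ = 1)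
    (hX : ip X Y = 0) :
    ip (X - ip X X₁ • X₁ - ip X X₂ • X₂ + ip X N • Y + ip X Y • N)
      (X - ip X X₁ • X₁ - ip X X₂ • X₂ + ip X N • Y + ip X Y • N)
      = ip X X - ip X X₁ ^ 2 - ip X X₂ ^ 2 := by
  simp only [ip_add_left, ip_add_right, ip_sub_left, ip_sub_right, ip_smul_left, ip_smul_right, hY,
    h1, h2, h11, h12, h22, hX, ip_comm Y X₁, ip_comm Y X₂, ip_comm Y X, ip_comm X₂ X₁,
    ip_comm X₁ X, ip_comm X₂ X]
  ring

/-- The relations between the two-jet and the value of a null lift. -/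
theorem null_jet {Y : ℂ → R62} {s : Set ℂ} (hs : IsOpen s) (hY : ContDiffOn ℝ ∞ Y s)
    (h0 : ∀ w ∈ s, ip (Y w) (Y w) = 0) {z : ℂ} (hz : z ∈ s) :
    ip (du Y z) (Y z) = 0 ∧ ip (dv Y z) (Y z) = 0 ∧
    ip (du (du Y) z) (Y z) = -ip (du Y z) (du Y z) ∧
    ip (du (dv Y) z) (Y z) = -ip (du Y z) (dv Y z) ∧
    ip (dv (dv Y) z) (Y z) = -ip (dv Y z) (dv Y z) := by
  have hu : ∀ w ∈ s, ip (du Y w) (Y w) = 0 := fun w hw => by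
    have := ip_du_of_const hs hY hY h0 hw
    rw [ip_comm (Y w)] at this; linarith
  have hv : ∀ w ∈ s, ip (dv Y w) (Y w) = 0 := fun w hw => by
    have := ip_dv_of_const hs hY hY h0 hw
    rw [ip_comm (Y w)] at this; linarith
  have h1 := ip_du_of_const hs (smooth_du hs hY) hY hu hz
  have h2 := ip_du_of_const hs (smooth_dv hs hY) hY hv hz
  have h3 := ip_dv_of_const hs (smooth_dv hs hY) hY hv hz
  rw [ip_comm (dv Y z) (du Y z)] at h2
  exact ⟨hu z hz, hv z hz, by linarith, by linarith, by linarith⟩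

/-- The trace-free second derivative is orthogonal to `Y`, so the choice of `N` does not affect the
length of its normal component: projecting off the tangent plane is enough. What remains is a
function of the two-jet, without Gram-Schmidt, that can be differentiated. -/
theorem willmoreIntegrand_eq_jetWillmore {Y : ℂ → R62} {s : Set ℂ} (hs : IsOpen s)
    (hY : ContDiffOn ℝ ∞ Y s) (h0 : ∀ w ∈ s, ip (Y w) (Y w) = 0) {z : ℂ} (hz : z ∈ s)
    (hE : 0 < ip (du Y z) (du Y z)) (hD : 0 < gramDet (du Y z) (dv Y z)) :
    willmoreIntegrand Y z = jetWillmore (jet Y z) := by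
  obtain ⟨hUY, hVY, hAY, hBY, hCY⟩ := null_jet hs hY h0 hz
  have hYY := h0 z hz
  have hsm := smooth_at hs hY hz
  unfold willmoreIntegrand jet
  simp only [hess_complex_apply hsm, fderiv_complex_apply]
  set U := du Y z
  set V := dv Y z
  set A := du (du Y) z
  set B := du (dv Y) z
  set C := dv (dv Y) z
  rw [show ip U U * ip V V - ip U V ^ 2 = gramDet U V from rfl]
  have hDdef : gramDet U V = ip U U * ip V V - ip U V ^ 2 := rfl
  -- With names for the square roots of `E` and of the Gram determinant, the Gram-Schmidt
  -- expressions become rational functions.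
  obtain ⟨e, he, heE⟩ : ∃ e : ℝ, 0 < e ∧ ip U U = e ^ 2 :=
    ⟨√(ip U U), Real.sqrt_pos.2 hE, (Real.sq_sqrt hE.le).symm⟩
  obtain ⟨d, hd, hdD⟩ : ∃ d : ℝ, 0 < d ∧ gramDet U V = d ^ 2 :=
    ⟨√(gramDet U V), Real.sqrt_pos.2 hD, (Real.sq_sqrt hD.le).symm⟩
  have hsE : √(ip U U) = e := by rw [heE, Real.sqrt_sq he.le]
  have hsD : √(gramDet U V) = d := by rw [hdD, Real.sqrt_sq hd.le]
  rw [hsE, hsD]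
  simp only [Complex.ofReal_re, Complex.ofReal_im, Complex.mul_re, Complex.mul_im, Complex.sub_re,
    Complex.sub_im, Complex.I_re, Complex.I_im, zero_smul, add_zero, mul_zero, zero_mul, zero_sub,
    sub_zero, mul_one]
  have hG : ip V V = (d ^ 2 + ip U V ^ 2) / e ^ 2 := by
    rw [← hdD, hDdef, ← heE]; field_simp; ring
  set X₁ : R62 := (1 / e) • U with hX₁
  set X₂ : R62 := (e / d * -(ip U V / ip U U)) • U + (e / d) • V with hX₂
  have h11 : ip X₁ X₁ = 1 := by
    rw [hX₁, ip_smul_left, ip_smul_right, heE]; field_simp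
  have h12 : ip X₁ X₂ = 0 := by
    rw [hX₁, hX₂, ip_smul_left, ip_add_right, ip_smul_right, ip_smul_right, heE]; field_simp; ring
  have h22 : ip X₂ X₂ = 1 := by
    rw [hX₂]
    simp only [ip_add_left, ip_add_right, ip_smul_left, ip_smul_right, heE, ip_comm V U, hG]
    field_simp; ring
  have h1Y : ip X₁ (Y z) = 0 := by rw [hX₁, ip_smul_left, hUY, mul_zero]
  have h2Y : ip X₂ (Y z) = 0 := by
    rw [hX₂, ip_add_left, ip_smul_left, ip_smul_left, hUY, hVY]; ring
  set α : R62 := (1 / 4 : ℝ) • ((1 / e * (1 / e)) • A - ((e / d * -(ip U V / ip U U) *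
    (e / d * -(ip U V / ip U U))) • A + (e / d * -(ip U V / ip U U) * (e / d) + e / d *
    (e / d * -(ip U V / ip U U))) • B + (e / d * (e / d)) • C)) with hα
  set β : R62 := (1 / 2 : ℝ) • ((1 / e * (e / d * -(ip U V / ip U U))) • A +
    (1 / e * (e / d)) • B) with hβ
  have hαY : ip α (Y z) = 0 := by
    rw [hα]
    simp only [ip_add_left, ip_sub_left, ip_smul_left, hAY, hBY, hCY, heE, hG]
    field_simp; ring
  have hβY : ip β (Y z) = 0 := by
    rw [hβ]
    simp only [ip_add_left, ip_smul_left, hAY, hBY, heE]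
    field_simp; ring
  rw [ip_normal_component hYY h1Y h2Y h11 h12 h22 hαY,
    ip_normal_component hYY h1Y h2Y h11 h12 h22 hβY]
  -- The projection formula for the orthonormal basis `X₁, X₂` equals that for the basis `U, V`.
  have hQ : ∀ X, ip X X - ip X X₁ ^ 2 - ip X X₂ ^ 2 = normalPairing U V X X / d ^ 2 := by
    intro X
    rw [hX₁, hX₂, normalPairing, hdD]
    simp only [ip_add_right, ip_smul_right, heE, hG]
    field_simp; ring
  rw [hQ, hQ, hα, hβ, jetWillmore]
  simp only [hdD, Real.sqrt_sq hd.le, normalPairing_add_left, normalPairing_add_right, normalPairing_smul_left,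
    normalPairing_smul_right, normalPairing_sub_left, normalPairing_sub_right,
    normalPairing_comm U V B A, normalPairing_comm U V C A, normalPairing_comm U V C B, heE, hG]
  generalize normalPairing U V A A = aa
  generalize normalPairing U V A B = ab
  generalize normalPairing U V A C = ac
  generalize normalPairing U V B B = bb
  generalize normalPairing U V B C = bc
  generalize normalPairing U V C C = cc
  field_simp
  ring

-- Smoothness and linearization of the jet integrand.

theorem contDiffAt_ip {X : Type*} [NormedAddCommGroup X] [NormedSpace ℝ X] {f g : X → R62} {x : X}
    {n : WithTop ℕ∞} (hf : ContDiffAt ℝ n f x) (hg : ContDiffAt ℝ n g x) :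
    ContDiffAt ℝ n (fun y => ip (f y) (g y)) x :=
  ((contDiffAt_const (c := ipL)).clm_apply hf).clm_apply hg

theorem contDiffAt_gramDet {X : Type*} [NormedAddCommGroup X] [NormedSpace ℝ X] {f g : X → R62}
    {x : X} {n : WithTop ℕ∞} (hf : ContDiffAt ℝ n f x) (hg : ContDiffAt ℝ n g x) :
    ContDiffAt ℝ n (fun y => gramDet (f y) (g y)) x :=
  ((contDiffAt_ip hf hf).mul (contDiffAt_ip hg hg)).sub ((contDiffAt_ip hf hg).pow 2)

theorem contDiffAt_normalPairing {X : Type*} [NormedAddCommGroup X] [NormedSpace ℝ X]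
    {f g h k : X → R62} {x : X} {n : WithTop ℕ∞} (hf : ContDiffAt ℝ n f x)
    (hg : ContDiffAt ℝ n g x) (hh : ContDiffAt ℝ n h x) (hk : ContDiffAt ℝ n k x) :
    ContDiffAt ℝ n (fun y => normalPairing (f y) (g y) (h y) (k y)) x :=
  ((contDiffAt_ip hh hk).mul (contDiffAt_gramDet hf hg)).sub
    (((((contDiffAt_ip hg hg).mul (contDiffAt_ip hh hf)).mul (contDiffAt_ip hk hf)).sub
      ((contDiffAt_ip hf hg).mul (((contDiffAt_ip hh hf).mul (contDiffAt_ip hk hg)).add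
        ((contDiffAt_ip hh hg).mul (contDiffAt_ip hk hf))))).add
      (((contDiffAt_ip hf hf).mul (contDiffAt_ip hh hg)).mul (contDiffAt_ip hk hg)))

theorem contDiffAt_jetWillmore {j : Jet} (hD : 0 < gramDet j.1 j.2.1) (n : WithTop ℕ∞) :
    ContDiffAt ℝ n jetWillmore j := by
  have h1 : ContDiffAt ℝ n (fun j : Jet => j.1) j := contDiffAt_fst
  have h2 : ContDiffAt ℝ n (fun j : Jet => j.2.1) j := contDiffAt_fst.snd''
  have h3 : ContDiffAt ℝ n (fun j : Jet => j.2.2.1) j := by fun_prop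
  have h4 : ContDiffAt ℝ n (fun j : Jet => j.2.2.2.1) j := by fun_prop
  have h5 : ContDiffAt ℝ n (fun j : Jet => j.2.2.2.2) j := by fun_prop
  have hT := (((contDiffAt_ip h2 h2).smul h3).sub
    (((contDiffAt_const (c := (2 : ℝ))).mul (contDiffAt_ip h1 h2)).smul h4)).add
    ((contDiffAt_ip h1 h1).smul h5)
  have hg := contDiffAt_gramDet h1 h2
  refine ContDiffAt.div (((contDiffAt_normalPairing h1 h2 hT hT).div hg hD.ne').sub
    (contDiffAt_const.mul ((contDiffAt_normalPairing h1 h2 h3 h5).sub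
      (contDiffAt_normalPairing h1 h2 h4 h4))))
    (contDiffAt_const.mul (hg.mul (hg.sqrt hD.ne'))) ?_
  have := Real.sqrt_pos.2 hD
  positivity

theorem hasDerivAt_ip {f g : ℝ → R62} {f' g' : R62} {t : ℝ} (hf : HasDerivAt f f' t)
    (hg : HasDerivAt g g' t) :
    HasDerivAt (fun x => ip (f x) (g x)) (ip f' (g t) + ip (f t) g') t := by
  have := (ipL.hasFDerivAt_of_bilinear hf.hasFDerivAt hg.hasFDerivAt).hasDerivAt
  simp only [ipL_apply] at this
  refine this.congr_deriv ?_
  simp [ipL_apply, add_comm]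

/-- The linearized integrand at a lift `Y` with `|dY|² = |dz|²`, where `j` is the jet of `Y` and `k`
that of the variation. -/
def linWillmore (j k : Jet) : ℝ :=
  1 / 4 * ip ((1 / 2 : ℝ) • (j.2.2.1 - j.2.2.2.2)) (k.2.2.1 - k.2.2.2.2)
    + 1 / 2 * ip j.2.2.2.1 k.2.2.2.1
    - 1 / 16 * (ip k.1 j.1 + ip k.2.1 j.2.1)
      * ip (j.2.2.1 + j.2.2.2.2) (j.2.2.1 + j.2.2.2.2)
    - 1 / 4 * (ip k.1 j.1 - ip k.2.1 j.2.1)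
      * ip ((1 / 2 : ℝ) • (j.2.2.1 - j.2.2.2.2)) (j.2.2.1 + j.2.2.2.2)
    - 1 / 4 * (ip k.1 j.2.1 + ip k.2.1 j.1) * ip j.2.2.2.1 (j.2.2.1 + j.2.2.2.2)

/-- The derivative is taken along a line of jets. The hypotheses are the relations that a canonical
lift satisfies; `hK` is the flatness of its metric and removes the derivative of the density from
the curvature term. -/
theorem fderiv_jetWillmore {U V A B C : R62} (hUU : ip U U = 1) (hUV : ip U V = 0)
    (hVV : ip V V = 1) (hAU : ip A U = 0) (hAV : ip A V = 0) (hBU : ip B U = 0) (hBV : ip B V = 0)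
    (hCU : ip C U = 0) (hCV : ip C V = 0) (hK : ip A C = ip B B) (k : Jet) :
    fderiv ℝ jetWillmore (U, V, A, B, C) k = linWillmore (U, V, A, B, C) k := by
  obtain ⟨u, v, a, b, c⟩ := k
  have hD0 : gramDet U V = 1 := by rw [gramDet, hUU, hUV, hVV]; norm_num
  have hd : DifferentiableAt ℝ jetWillmore (U, V, A, B, C) :=
    (contDiffAt_jetWillmore (by rw [hD0]; norm_num) 1).differentiableAt (by simp)
  have hline : ∀ x y : R62, HasDerivAt (fun t : ℝ => x + t • y) y 0 := fun x y => by
    have := ((hasDerivAt_id (0 : ℝ)).smul_const y).const_add x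
    simpa using this
  have h1 : HasDerivAt (fun t : ℝ => jetWillmore ((U, V, A, B, C) + t • (u, v, a, b, c)))
      (fderiv ℝ jetWillmore (U, V, A, B, C) (u, v, a, b, c)) 0 := by
    have hl : HasDerivAt (fun t : ℝ => ((U, V, A, B, C) : Jet) + t • ((u, v, a, b, c) : Jet))
        ((u, v, a, b, c) : Jet) 0 := by
      have := ((hasDerivAt_id (0 : ℝ)).smul_const ((u, v, a, b, c) : Jet)).const_add
        ((U, V, A, B, C) : Jet)
      simpa using this
    have hd' : HasFDerivAt jetWillmore (fderiv ℝ jetWillmore (U, V, A, B, C))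
        (((U, V, A, B, C) : Jet) + (0 : ℝ) • ((u, v, a, b, c) : Jet)) := by
      rw [zero_smul, add_zero]; exact hd.hasFDerivAt
    exact hd'.comp_hasDerivAt (0 : ℝ) hl
  refine h1.unique ?_
  have hU := hline U u
  have hV := hline V v
  have hA := hline A a
  have hB := hline B b
  have hC := hline C c
  have hE : HasDerivAt (fun t : ℝ => ip (U + t • u) (U + t • u)) (2 * ip u U) 0 :=
    (hasDerivAt_ip hU hU).congr_deriv (by rw [zero_smul, add_zero, ip_comm U u]; ring)
  have hF : HasDerivAt (fun t : ℝ => ip (U + t • u) (V + t • v)) (ip u V + ip v U) 0 :=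
    (hasDerivAt_ip hU hV).congr_deriv (by rw [zero_smul, zero_smul, add_zero, add_zero, ip_comm U v])
  have hG : HasDerivAt (fun t : ℝ => ip (V + t • v) (V + t • v)) (2 * ip v V) 0 :=
    (hasDerivAt_ip hV hV).congr_deriv (by rw [zero_smul, add_zero, ip_comm V v]; ring)
  have hD : HasDerivAt (fun t : ℝ => gramDet (U + t • u) (V + t • v)) (2 * ip u U + 2 * ip v V) 0 :=
    ((hE.mul hG).sub (hF.pow 2)).congr_deriv (by
      simp only [zero_smul, add_zero, hUU, hUV, hVV]; ring)
  have hT : HasDerivAt (fun t : ℝ => jetTrace (((U, V, A, B, C) : Jet) + t • (u, v, a, b, c)))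
      (a + c + (2 * ip v V) • A - (2 * (ip u V + ip v U)) • B + (2 * ip u U) • C) 0 :=
    (((hG.smul hA).sub ((hF.const_mul 2).smul hB)).add (hE.smul hC)).congr_deriv (by
      simp only [zero_smul, add_zero, hUU, hUV, hVV]; module)
  -- At time `0` both arguments are orthogonal to `U` and `V`, so the tangential corrections are
  -- products of two vanishing factors and have zero derivative.
  have hS : ∀ {f g : ℝ → R62} {f' g' x y : R62}, HasDerivAt f f' 0 → HasDerivAt g g' 0 →
      f 0 = x → g 0 = y → ip x U = 0 → ip x V = 0 → ip y U = 0 → ip y V = 0 →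
      HasDerivAt (fun t => normalPairing (U + t • u) (V + t • v) (f t) (g t))
        (ip f' y + ip x g' + ip x y * (2 * ip u U + 2 * ip v V)) 0 := by
    intro f g f' g' x y hf hg hx hy h1 h2 h3 h4
    have := ((hasDerivAt_ip hf hg).mul hD).sub
      (((((hG.mul (hasDerivAt_ip hf hU)).mul (hasDerivAt_ip hg hU)).sub
      (hF.mul (((hasDerivAt_ip hf hU).mul (hasDerivAt_ip hg hV)).add
        ((hasDerivAt_ip hf hV).mul (hasDerivAt_ip hg hU))))).add
      ((hE.mul (hasDerivAt_ip hf hV)).mul (hasDerivAt_ip hg hV))))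
    refine this.congr_deriv ?_
    simp only [zero_smul, add_zero, hx, hy, h1, h2, h3, h4, hUU, hVV, Pi.mul_apply,
      Pi.add_apply, hD0]
    ring
  have hT0 : jetTrace (((U, V, A, B, C) : Jet) + (0 : ℝ) • (u, v, a, b, c)) = A + C := by
    rw [zero_smul, add_zero, jetTrace, hUU, hUV, hVV]; module
  have hT1 : jetTrace (U, V, A, B, C) = A + C := by simpa using hT0
  have hHU : ip (A + C) U = 0 := by rw [ip_add_left, hAU, hCU, add_zero]
  have hHV : ip (A + C) V = 0 := by rw [ip_add_left, hAV, hCV, add_zero]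
  have hST := hS hT hT hT0 hT0 hHU hHV hHU hHV
  have hSAC := hS hA hC (by simp) (by simp) hAU hAV hCU hCV
  have hSBB := hS hB hB (by simp) (by simp) hBU hBV hBU hBV
  have hD00 : gramDet (U + (0 : ℝ) • u) (V + (0 : ℝ) • v) = 1 := by
    rw [zero_smul, zero_smul, add_zero, add_zero, hD0]
  have hsq := hD.sqrt (by rw [hD00]; norm_num)
  have hfin := ((hST.div hD (by rw [hD00]; norm_num)).sub ((hSAC.sub hSBB).const_mul 4)).div
    ((hD.mul hsq).const_mul 16) (by simp [hD0])
  refine hfin.congr_deriv ?_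
  have hn : normalPairing U V (A + C) (A + C) = ip (A + C) (A + C) := by
    simp only [normalPairing, hHU, hHV, hD0]; ring
  have hn1 : normalPairing U V A C = ip A C := by
    simp only [normalPairing, hAU, hAV, hCU, hCV, hD0]; ring
  have hn2 : normalPairing U V B B = ip A C := by
    simp only [normalPairing, hBU, hBV, hD0, hK]; ring
  simp only [Pi.mul_apply, Pi.sub_apply, Pi.div_apply, hD0, zero_smul, add_zero, hT1, hn, hn1,
    hn2, Real.sqrt_one]
  simp only [linWillmore, ip_add_left, ip_add_right, ip_sub_left, ip_sub_right, ip_smul_left,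
    ip_smul_right, ip_comm C A, ip_comm B A, ip_comm C B, ip_comm a A, ip_comm a C, ip_comm c A,
    ip_comm c C, ip_comm b B, hK]
  ring

/-! ### Invariance of the Willmore integrand -/

theorem jet_smul {Y : ℂ → R62} {ρ : ℂ → ℝ} {s : Set ℂ} (hs : IsOpen s)
    (hY : ContDiffOn ℝ ∞ Y s) (hρ : ContDiffOn ℝ ∞ ρ s) {z : ℂ} (hz : z ∈ s) :
    jet (fun w => ρ w • Y w) z =
      (ρ z • du Y z + du ρ z • Y z, ρ z • dv Y z + dv ρ z • Y z,
       ρ z • du (du Y) z + (2 * du ρ z) • du Y z + du (du ρ) z • Y z,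
       ρ z • du (dv Y) z + du ρ z • dv Y z + dv ρ z • du Y z + du (dv ρ) z • Y z,
       ρ z • dv (dv Y) z + (2 * dv ρ z) • dv Y z + dv (dv ρ) z • Y z) := by
  have hu : Set.EqOn (du fun w => ρ w • Y w) (fun w => ρ w • du Y w + du ρ w • Y w) s :=
    fun w hw => du_smul (diff_at hs hρ hw) (diff_at hs hY hw)
  have hv : Set.EqOn (dv fun w => ρ w • Y w) (fun w => ρ w • dv Y w + dv ρ w • Y w) s :=
    fun w hw => dv_smul (diff_at hs hρ hw) (diff_at hs hY hw)
  have hYu := smooth_du hs hY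
  have hYv := smooth_dv hs hY
  have hρu := smooth_du hs hρ
  have hρv := smooth_dv hs hρ
  have dY := diff_at hs hY hz
  have dρ := diff_at hs hρ hz
  have dYu := diff_at hs hYu hz
  have dYv := diff_at hs hYv hz
  have dρu := diff_at hs hρu hz
  have dρv := diff_at hs hρv hz
  unfold jet
  rw [hu hz, hv hz, du_congr_on hs hu hz, du_congr_on hs hv hz, dv_congr_on hs hv hz,
    du_add (dρ.fun_smul dYu) (dρu.fun_smul dY), du_add (dρ.fun_smul dYv) (dρv.fun_smul dY),
    dv_add (dρ.fun_smul dYv) (dρv.fun_smul dY), du_smul dρ dYu, du_smul dρu dY, du_smul dρ dYv,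
    du_smul dρv dY, dv_smul dρ dYv, dv_smul dρv dY]
  simp only [Prod.mk.injEq, true_and]
  exact ⟨by module, by module, by module⟩

/-- The Willmore integrand does not depend on the lift. -/
theorem jetWillmore_smul {Y : ℂ → R62} {ρ : ℂ → ℝ} {s : Set ℂ} (hs : IsOpen s)
    (hY : ContDiffOn ℝ ∞ Y s) (h0 : ∀ w ∈ s, ip (Y w) (Y w) = 0) (hρ : ContDiffOn ℝ ∞ ρ s)
    {z : ℂ} (hz : z ∈ s) (hρz : ρ z ≠ 0) (hD : 0 < gramDet (du Y z) (dv Y z)) :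
    jetWillmore (jet (fun w => ρ w • Y w) z) = jetWillmore (jet Y z) := by
  obtain ⟨hUY, hVY, hAY, hBY, hCY⟩ := null_jet hs hY h0 hz
  rw [jet_smul hs hY hρ hz, jetWillmore_lift (h0 z hz) hUY hVY hAY hBY hCY hD hρz]
  rfl

theorem gramDet_smul {Y : ℂ → R62} {ρ : ℂ → ℝ} {s : Set ℂ} (hs : IsOpen s)
    (hY : ContDiffOn ℝ ∞ Y s) (h0 : ∀ w ∈ s, ip (Y w) (Y w) = 0) (hρ : ContDiffOn ℝ ∞ ρ s)
    {z : ℂ} (hz : z ∈ s) :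
    gramDet (du (fun w => ρ w • Y w) z) (dv (fun w => ρ w • Y w) z)
      = ρ z ^ 4 * gramDet (du Y z) (dv Y z) := by
  obtain ⟨hUY, hVY, -⟩ := null_jet hs hY h0 hz
  rw [du_smul (diff_at hs hρ hz) (diff_at hs hY hz), dv_smul (diff_at hs hρ hz) (diff_at hs hY hz),
    gramDet_lift (h0 z hz) hUY hVY]

theorem ip_fderiv_smul {Y : ℂ → R62} {ρ : ℂ → ℝ} {s : Set ℂ} (hs : IsOpen s)
    (hY : ContDiffOn ℝ ∞ Y s) (h0 : ∀ w ∈ s, ip (Y w) (Y w) = 0) (hρ : ContDiffOn ℝ ∞ ρ s)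
    {z : ℂ} (hz : z ∈ s) :
    ip (du (fun w => ρ w • Y w) z) (du (fun w => ρ w • Y w) z)
        = ρ z ^ 2 * ip (du Y z) (du Y z) ∧
    ip (dv (fun w => ρ w • Y w) z) (dv (fun w => ρ w • Y w) z)
        = ρ z ^ 2 * ip (dv Y z) (dv Y z) ∧
    ip (du (fun w => ρ w • Y w) z) (dv (fun w => ρ w • Y w) z)
        = ρ z ^ 2 * ip (du Y z) (dv Y z) := by
  obtain ⟨hUY, hVY, -⟩ := null_jet hs hY h0 hz
  rw [du_smul (diff_at hs hρ hz) (diff_at hs hY hz), dv_smul (diff_at hs hρ hz) (diff_at hs hY hz)]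
  simp only [ip_add_left, ip_add_right, ip_smul_left, ip_smul_right, hUY, hVY,
    ip_comm (Y z) (du Y z), ip_comm (Y z) (dv Y z), h0 z hz]
  refine ⟨by ring, by ring, by ring⟩

/-- The two-jet after a holomorphic change of coordinate. -/
theorem jet_comp {Y : ℂ → R62} {φ : ℂ → ℂ} {s t : Set ℂ} (hs : IsOpen s) (ht : IsOpen t)
    (hY : ContDiffOn ℝ ∞ Y s) (hφ : DifferentiableOn ℂ φ t) (hm : Set.MapsTo φ t s) {z : ℂ}
    (hz : z ∈ t) :
    ∃ m n : ℝ, ∀ a b : ℝ, a = (deriv φ z).re → b = (deriv φ z).im →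
      jet (fun w => Y (φ w)) z =
      (a • du Y (φ z) + b • dv Y (φ z), -b • du Y (φ z) + a • dv Y (φ z),
        a ^ 2 • du (du Y) (φ z) + (2 * a * b) • du (dv Y) (φ z) + b ^ 2 • dv (dv Y) (φ z)
          + m • du Y (φ z) + n • dv Y (φ z),
        (-(a * b)) • du (du Y) (φ z) + (a ^ 2 - b ^ 2) • du (dv Y) (φ z)
          + (a * b) • dv (dv Y) (φ z) - n • du Y (φ z) + m • dv Y (φ z),
        b ^ 2 • du (du Y) (φ z) - (2 * a * b) • du (dv Y) (φ z) + a ^ 2 • dv (dv Y) (φ z)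
          - m • du Y (φ z) - n • dv Y (φ z)) := by
  have hd : ∀ w ∈ t, HasDerivAt φ (deriv φ w) w := fun w hw =>
    ((hφ w hw).differentiableAt (ht.mem_nhds hw)).hasDerivAt
  have hd2 : HasDerivAt (deriv φ) (deriv (deriv φ) z) z :=
    (((hφ.deriv ht) z hz).differentiableAt (ht.mem_nhds hz)).hasDerivAt
  have hF := hd2.hasFDerivAt.restrictScalars ℝ
  have hre := (Complex.reCLM.hasFDerivAt.comp z hF)
  have him := (Complex.imCLM.hasFDerivAt.comp z hF)
  have e1 : du (fun w => (deriv φ w).re) z = (deriv (deriv φ) z).re := by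
    unfold du
    rw [show (fun w => (deriv φ w).re) = Complex.reCLM ∘ deriv φ from rfl, hre.fderiv]
    simp
  have e2 : dv (fun w => (deriv φ w).re) z = -(deriv (deriv φ) z).im := by
    unfold dv
    rw [show (fun w => (deriv φ w).re) = Complex.reCLM ∘ deriv φ from rfl, hre.fderiv]
    simp
  have e3 : du (fun w => (deriv φ w).im) z = (deriv (deriv φ) z).im := by
    unfold du
    rw [show (fun w => (deriv φ w).im) = Complex.imCLM ∘ deriv φ from rfl, him.fderiv]
    simp
  have e4 : dv (fun w => (deriv φ w).im) z = (deriv (deriv φ) z).re := by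
    unfold dv
    rw [show (fun w => (deriv φ w).im) = Complex.imCLM ∘ deriv φ from rfl, him.fderiv]
    simp
  have dre : DifferentiableAt ℝ (fun w => (deriv φ w).re) z := hre.differentiableAt
  have dim : DifferentiableAt ℝ (fun w => (deriv φ w).im) z := him.differentiableAt
  have dφ : DifferentiableAt ℝ φ z := ((hd z hz).hasFDerivAt.restrictScalars ℝ).differentiableAt
  have hu : Set.EqOn (du fun w => Y (φ w))
      (fun w => (deriv φ w).re • du Y (φ w) + (deriv φ w).im • dv Y (φ w)) t := fun w hw =>
    du_comp (diff_at hs hY (hm hw)) (hd w hw)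
  have hv : Set.EqOn (dv fun w => Y (φ w))
      (fun w => (-(deriv φ w).im) • du Y (φ w) + (deriv φ w).re • dv Y (φ w)) t := fun w hw =>
    dv_comp (diff_at hs hY (hm hw)) (hd w hw)
  have dYu := diff_at hs (smooth_du hs hY) (hm hz)
  have dYv := diff_at hs (smooth_dv hs hY) (hm hz)
  have cYu : DifferentiableAt ℝ (fun w => du Y (φ w)) z := dYu.comp z dφ
  have cYv : DifferentiableAt ℝ (fun w => dv Y (φ w)) z := dYv.comp z dφ
  have e5 : du (fun w => -(deriv φ w).im) z = -(deriv (deriv φ) z).im := by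
    rw [← e3]; unfold du; rw [fderiv_fun_neg]; rfl
  have e6 : dv (fun w => -(deriv φ w).im) z = -(deriv (deriv φ) z).re := by
    rw [← e4]; unfold dv; rw [fderiv_fun_neg]; rfl
  -- The tangential terms come from `φ'' = m + in`, just as `φ' = a + ib`.
  refine ⟨(deriv (deriv φ) z).re, (deriv (deriv φ) z).im, ?_⟩
  rintro a b rfl rfl
  unfold jet
  rw [du_congr_on ht hu hz, du_congr_on ht hv hz, dv_congr_on ht hv hz, hu hz, hv hz,
    du_add (dre.fun_smul cYu) (dim.fun_smul cYv), du_add (dim.fun_neg.fun_smul cYu) (dre.fun_smul cYv),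
    dv_add (dim.fun_neg.fun_smul cYu) (dre.fun_smul cYv), du_smul dre cYu, du_smul dim cYv,
    du_smul dim.fun_neg cYu, du_smul dre cYv, dv_smul dim.fun_neg cYu, dv_smul dre cYv,
    du_comp dYu (hd z hz), du_comp dYv (hd z hz), dv_comp dYu (hd z hz), dv_comp dYv (hd z hz),
    dv_du_comm (smooth_at hs hY (hm hz)), e1, e2, e3, e5, e6]
  simp only [Prod.mk.injEq, true_and]
  refine ⟨by module, by module, by module⟩

/-- The Willmore integrand transforms as a density. -/
theorem jetWillmore_comp {Y : ℂ → R62} {φ : ℂ → ℂ} {s t : Set ℂ} (hs : IsOpen s) (ht : IsOpen t)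
    (hY : ContDiffOn ℝ ∞ Y s) (hφ : DifferentiableOn ℂ φ t) (hm : Set.MapsTo φ t s) {z : ℂ}
    (hz : z ∈ t) (hφz : deriv φ z ≠ 0) (hD : 0 < gramDet (du Y (φ z)) (dv Y (φ z))) :
    jetWillmore (jet (fun w => Y (φ w)) z) = ‖deriv φ z‖ ^ 2 * jetWillmore (jet Y (φ z)) := by
  obtain ⟨m, n, h⟩ := jet_comp hs ht hY hφ hm hz
  have hn : ‖deriv φ z‖ ^ 2 = (deriv φ z).re ^ 2 + (deriv φ z).im ^ 2 := by
    rw [← Complex.normSq_eq_norm_sq, Complex.normSq_apply]; ring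
  rw [h _ _ rfl rfl, hn, jetWillmore_conformal _ _ _ _ _ (by rw [← hn]; positivity) hD]
  rfl

/-! ### Families of lifts -/

section Families

variable {X F : Type*} [NormedAddCommGroup X] [NormedSpace ℝ X] [NormedAddCommGroup F]
  [NormedSpace ℝ F]

/-- The derivative in a fixed direction. -/
def dirDeriv (a : X) (f : X → F) (x : X) : F := fderiv ℝ f x a

theorem smooth_dirDeriv {f : X → F} {O : Set X} (hO : IsOpen O) (hf : ContDiffOn ℝ ∞ f O) (a : X) :
    ContDiffOn ℝ ∞ (dirDeriv a f) O :=
  (hf.fderiv_of_isOpen hO (by simp)).clm_apply contDiffOn_const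

theorem dirDeriv_congr {f g : X → F} {O : Set X} (hO : IsOpen O) (h : Set.EqOn f g O) (a : X) :
    Set.EqOn (dirDeriv a f) (dirDeriv a g) O := fun x hx => by
  unfold dirDeriv; rw [(h.eventuallyEq_of_mem (hO.mem_nhds hx)).fderiv_eq]

theorem dirDeriv_comm {f : X → F} {O : Set X} (hO : IsOpen O) (hf : ContDiffOn ℝ ∞ f O) (a b : X) :
    Set.EqOn (dirDeriv a (dirDeriv b f)) (dirDeriv b (dirDeriv a f)) O := fun x hx => by
  have hx' := hf.contDiffAt (hO.mem_nhds hx)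
  have h : DifferentiableAt ℝ (fderiv ℝ f) x :=
    (hx'.fderiv_right (m := 1) (WithTop.coe_le_coe.2 le_top)).differentiableAt (by simp)
  have key : ∀ c d : X, dirDeriv c (dirDeriv d f) x = fderiv ℝ (fderiv ℝ f) x c d := fun c d => by
    change fderiv ℝ (fun y => fderiv ℝ f y d) x c = _
    rw [fderiv_clm_apply h (differentiableAt_const d)]
    simp
  rw [key, key]
  exact (hx'.isSymmSndFDerivAt (by simpa using ENat.LEInfty.out)).eq a b

variable {f : ℝ × ℂ → F} {O : Set (ℝ × ℂ)}

theorem fderiv_slice (hO : IsOpen O) (hf : ContDiffOn ℝ ∞ f O) {p : ℝ × ℂ} (hp : p ∈ O) (a : ℂ) :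
    fderiv ℝ (fun w => f (p.1, w)) p.2 a = dirDeriv (0, a) f p := by
  have h1 : HasFDerivAt f (fderiv ℝ f p) (p.1, p.2) :=
    ((hf.contDiffAt (hO.mem_nhds hp)).differentiableAt (by simp)).hasFDerivAt
  have h2 : HasFDerivAt (fun w : ℂ => (p.1, w)) (ContinuousLinearMap.inr ℝ ℝ ℂ) p.2 :=
    hasFDerivAt_prodMk_right p.1 p.2
  have := (h1.comp p.2 h2).fderiv
  rw [show (fun w => f (p.1, w)) = f ∘ fun w => (p.1, w) from rfl, this]
  simp [dirDeriv]

theorem isOpen_slice (hO : IsOpen O) (t : ℝ) : IsOpen {w : ℂ | (t, w) ∈ O} :=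
  hO.preimage (by fun_prop)

theorem du_slice (hO : IsOpen O) (hf : ContDiffOn ℝ ∞ f O) {p : ℝ × ℂ} (hp : p ∈ O) :
    du (fun w => f (p.1, w)) p.2 = dirDeriv (0, 1) f p := fderiv_slice hO hf hp 1

theorem dv_slice (hO : IsOpen O) (hf : ContDiffOn ℝ ∞ f O) {p : ℝ × ℂ} (hp : p ∈ O) :
    dv (fun w => f (p.1, w)) p.2 = dirDeriv (0, Complex.I) f p := fderiv_slice hO hf hp Complex.I

theorem smooth_slice (hf : ContDiffOn ℝ ∞ f O) (t : ℝ) :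
    ContDiffOn ℝ ∞ (fun w => f (t, w)) {w : ℂ | (t, w) ∈ O} :=
  hf.comp (by fun_prop) fun _ hw => hw

end Families

/-- The two-jets of the members of a family. -/
def familyJet (Y : ℝ × ℂ → R62) (p : ℝ × ℂ) : Jet :=
  (dirDeriv (0, 1) Y p, dirDeriv (0, Complex.I) Y p,
    dirDeriv (0, 1) (dirDeriv (0, 1) Y) p, dirDeriv (0, 1) (dirDeriv (0, Complex.I) Y) p,
    dirDeriv (0, Complex.I) (dirDeriv (0, Complex.I) Y) p)

variable {Y : ℝ × ℂ → R62} {O : Set (ℝ × ℂ)}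

theorem smooth_familyJet (hO : IsOpen O) (hY : ContDiffOn ℝ ∞ Y O) :
    ContDiffOn ℝ ∞ (familyJet Y) O :=
  (smooth_dirDeriv hO hY _).prodMk ((smooth_dirDeriv hO hY _).prodMk
    ((smooth_dirDeriv hO (smooth_dirDeriv hO hY _) _).prodMk
      ((smooth_dirDeriv hO (smooth_dirDeriv hO hY _) _).prodMk
        (smooth_dirDeriv hO (smooth_dirDeriv hO hY _) _))))

theorem jet_slice (hO : IsOpen O) (hY : ContDiffOn ℝ ∞ Y O) {p : ℝ × ℂ} (hp : p ∈ O) :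
    jet (fun w => Y (p.1, w)) p.2 = familyJet Y p := by
  have ho := isOpen_slice hO p.1
  have hp' : p.2 ∈ {w : ℂ | (p.1, w) ∈ O} := hp
  have hu : Set.EqOn (du fun w => Y (p.1, w)) (fun w => dirDeriv (0, 1) Y (p.1, w))
      {w : ℂ | (p.1, w) ∈ O} := fun w hw => du_slice (p := (p.1, w)) hO hY hw
  have hv : Set.EqOn (dv fun w => Y (p.1, w)) (fun w => dirDeriv (0, Complex.I) Y (p.1, w))
      {w : ℂ | (p.1, w) ∈ O} := fun w hw => dv_slice (p := (p.1, w)) hO hY hw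
  unfold jet familyJet
  rw [hu hp', hv hp', du_congr_on ho hu hp', du_congr_on ho hv hp', dv_congr_on ho hv hp',
    du_slice hO (smooth_dirDeriv hO hY _) hp, du_slice hO (smooth_dirDeriv hO hY _) hp,
    dv_slice hO (smooth_dirDeriv hO hY _) hp]

theorem hasDerivAt_line {F : Type*} [NormedAddCommGroup F] [NormedSpace ℝ F] {f : ℝ × ℂ → F}
    (hO : IsOpen O) (hf : ContDiffOn ℝ ∞ f O) {p : ℝ × ℂ} (hp : p ∈ O) :
    HasDerivAt (fun t => f (t, p.2)) (dirDeriv (1, 0) f p) p.1 := by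
  have h1 : HasFDerivAt f (fderiv ℝ f p) (p.1, p.2) :=
    ((hf.contDiffAt (hO.mem_nhds hp)).differentiableAt (by simp)).hasFDerivAt
  have h2 : HasDerivAt (fun t : ℝ => (t, p.2)) (1, (0 : ℂ)) p.1 :=
    (hasDerivAt_id p.1).prodMk (hasDerivAt_const p.1 p.2)
  exact h1.comp_hasDerivAt p.1 h2

/-- The time derivative of the jets is the jet of the velocity. -/
theorem hasDerivAt_familyJet (hO : IsOpen O) (hY : ContDiffOn ℝ ∞ Y O) {p : ℝ × ℂ} (hp : p ∈ O) :
    HasDerivAt (fun t => familyJet Y (t, p.2))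
      (jet (fun w => dirDeriv (1, 0) Y (p.1, w)) p.2) p.1 := by
  rw [jet_slice hO (smooth_dirDeriv hO hY _) hp]
  have h1 : ∀ a : ℝ × ℂ, HasDerivAt (fun t => dirDeriv a Y (t, p.2))
      (dirDeriv a (dirDeriv (1, 0) Y) p) p.1 := fun a => by
    rw [dirDeriv_comm hO hY a (1, 0) hp]
    exact hasDerivAt_line hO (smooth_dirDeriv hO hY a) hp
  have h2 : ∀ a b : ℝ × ℂ, HasDerivAt (fun t => dirDeriv a (dirDeriv b Y) (t, p.2))
      (dirDeriv a (dirDeriv b (dirDeriv (1, 0) Y)) p) p.1 := fun a b => by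
    rw [dirDeriv_congr hO (dirDeriv_comm hO hY b (1, 0)) a hp,
      dirDeriv_comm hO (smooth_dirDeriv hO hY b) a (1, 0) hp]
    exact hasDerivAt_line hO (smooth_dirDeriv hO (smooth_dirDeriv hO hY b) a) hp
  exact (h1 _).prodMk ((h1 _).prodMk ((h2 _ _).prodMk ((h2 _ _).prodMk (h2 _ _))))

/-! ### Canonical lifts and the Euler-Lagrange equation -/

/-- A smooth null map with `|dY|² = |dz|²`. -/
structure IsCanonical (s : Set ℂ) (Y : ℂ → R62) : Prop where
  isOpen : IsOpen s
  smooth : ContDiffOn ℝ ∞ Y s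
  null : ∀ z ∈ s, ip (Y z) (Y z) = 0
  uu : ∀ z ∈ s, ip (du Y z) (du Y z) = 1
  vv : ∀ z ∈ s, ip (dv Y z) (dv Y z) = 1
  uv : ∀ z ∈ s, ip (du Y z) (dv Y z) = 0

/-- Half the difference of the second derivatives. -/
def hopfRe (Y : ℂ → R62) (z : ℂ) : R62 := (1 / 2 : ℝ) • (du (du Y) z - dv (dv Y) z)

/-- The section `N` of a canonical lift. -/
def dualN (Y : ℂ → R62) (z : ℂ) : R62 :=
  (1 / 2 : ℝ) • lap Y z + (ip (lap Y z) (lap Y z) / 8) • Y z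

/-- The first component of the stress field of the Willmore functional. -/
def stressU (Y : ℂ → R62) (z : ℂ) : R62 :=
  (1 / 4 * ip (lap Y z) (lap Y z) + ip (hopfRe Y z) (lap Y z)) • du Y z
    + ip (du (dv Y) z) (lap Y z) • dv Y z

/-- The second component of the stress field of the Willmore functional. -/
def stressV (Y : ℂ → R62) (z : ℂ) : R62 :=
  (1 / 4 * ip (lap Y z) (lap Y z) - ip (hopfRe Y z) (lap Y z)) • dv Y z
    + ip (du (dv Y) z) (lap Y z) • du Y z

/-- The Euler-Lagrange field of the Willmore functional at a canonical lift. -/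
def eulerLagrange (Y : ℂ → R62) (z : ℂ) : R62 :=
  (1 / 8 : ℝ) • lap (lap Y) z + (1 / 4 : ℝ) • (du (stressU Y) z + dv (stressV Y) z)

namespace IsCanonical

variable {s : Set ℂ} {Y : ℂ → R62} {z : ℂ}

theorem mono (h : IsCanonical s Y) {t : Set ℂ} (ht : IsOpen t) (hts : t ⊆ s) :
    IsCanonical t Y :=
  ⟨ht, h.smooth.mono hts, fun z hz => h.null z (hts hz), fun z hz => h.uu z (hts hz),
    fun z hz => h.vv z (hts hz), fun z hz => h.uv z (hts hz)⟩

theorem smooth_hopfRe (h : IsCanonical s Y) : ContDiffOn ℝ ∞ (hopfRe Y) s :=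
  ((smooth_du h.isOpen (smooth_du h.isOpen h.smooth)).sub
    (smooth_dv h.isOpen (smooth_dv h.isOpen h.smooth))).const_smul (1 / 2 : ℝ)

theorem smooth_hopfIm (h : IsCanonical s Y) : ContDiffOn ℝ ∞ (du (dv Y)) s :=
  smooth_du h.isOpen (smooth_dv h.isOpen h.smooth)

theorem smooth_H (h : IsCanonical s Y) : ContDiffOn ℝ ∞ (lap Y) s := smooth_lap h.isOpen h.smooth

theorem smooth_dualN (h : IsCanonical s Y) : ContDiffOn ℝ ∞ (dualN Y) s :=
  (h.smooth_H.const_smul (1 / 2 : ℝ)).add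
    (((smooth_ip h.smooth_H h.smooth_H).div_const 8).smul h.smooth)

theorem smooth_stressU (h : IsCanonical s Y) : ContDiffOn ℝ ∞ (stressU Y) s :=
  (((contDiffOn_const.mul (smooth_ip h.smooth_H h.smooth_H)).add
    (smooth_ip h.smooth_hopfRe h.smooth_H)).smul (smooth_du h.isOpen h.smooth)).add
    ((smooth_ip h.smooth_hopfIm h.smooth_H).smul (smooth_dv h.isOpen h.smooth))

theorem smooth_stressV (h : IsCanonical s Y) : ContDiffOn ℝ ∞ (stressV Y) s :=
  (((contDiffOn_const.mul (smooth_ip h.smooth_H h.smooth_H)).sub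
    (smooth_ip h.smooth_hopfRe h.smooth_H)).smul (smooth_dv h.isOpen h.smooth)).add
    ((smooth_ip h.smooth_hopfIm h.smooth_H).smul (smooth_du h.isOpen h.smooth))

theorem smooth_eulerLagrange (h : IsCanonical s Y) : ContDiffOn ℝ ∞ (eulerLagrange Y) s :=
  ((smooth_lap h.isOpen h.smooth_H).const_smul (1 / 8 : ℝ)).add
    (((smooth_du h.isOpen h.smooth_stressU).add
      (smooth_dv h.isOpen h.smooth_stressV)).const_smul (1 / 4 : ℝ))

theorem uY (h : IsCanonical s Y) (hz : z ∈ s) : ip (du Y z) (Y z) = 0 :=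
  (null_jet h.isOpen h.smooth h.null hz).1

theorem vY (h : IsCanonical s Y) (hz : z ∈ s) : ip (dv Y z) (Y z) = 0 :=
  (null_jet h.isOpen h.smooth h.null hz).2.1

theorem uuY (h : IsCanonical s Y) (hz : z ∈ s) : ip (du (du Y) z) (Y z) = -1 := by
  rw [(null_jet h.isOpen h.smooth h.null hz).2.2.1, h.uu z hz]

theorem uvY (h : IsCanonical s Y) (hz : z ∈ s) : ip (du (dv Y) z) (Y z) = 0 := by
  rw [(null_jet h.isOpen h.smooth h.null hz).2.2.2.1, h.uv z hz, neg_zero]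

theorem vvY (h : IsCanonical s Y) (hz : z ∈ s) : ip (dv (dv Y) z) (Y z) = -1 := by
  rw [(null_jet h.isOpen h.smooth h.null hz).2.2.2.2, h.vv z hz]

theorem comm (h : IsCanonical s Y) (hz : z ∈ s) : dv (du Y) z = du (dv Y) z :=
  dv_du_comm (smooth_at h.isOpen h.smooth hz)

theorem uuu (h : IsCanonical s Y) (hz : z ∈ s) : ip (du (du Y) z) (du Y z) = 0 := by
  have hu := smooth_du h.isOpen h.smooth
  have := ip_du_of_const h.isOpen hu hu h.uu hz
  rw [ip_comm (du Y z)] at this; linarith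

theorem uvu (h : IsCanonical s Y) (hz : z ∈ s) : ip (du (dv Y) z) (du Y z) = 0 := by
  have hu := smooth_du h.isOpen h.smooth
  have := ip_dv_of_const h.isOpen hu hu h.uu hz
  rw [ip_comm (du Y z), h.comm hz] at this; linarith

theorem uvv (h : IsCanonical s Y) (hz : z ∈ s) : ip (du (dv Y) z) (dv Y z) = 0 := by
  have hv := smooth_dv h.isOpen h.smooth
  have := ip_du_of_const h.isOpen hv hv h.vv hz
  rw [ip_comm (dv Y z)] at this; linarith

theorem vvv (h : IsCanonical s Y) (hz : z ∈ s) : ip (dv (dv Y) z) (dv Y z) = 0 := by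
  have hv := smooth_dv h.isOpen h.smooth
  have := ip_dv_of_const h.isOpen hv hv h.vv hz
  rw [ip_comm (dv Y z)] at this; linarith

theorem uuv (h : IsCanonical s Y) (hz : z ∈ s) : ip (du (du Y) z) (dv Y z) = 0 := by
  have := ip_du_of_const h.isOpen (smooth_du h.isOpen h.smooth) (smooth_dv h.isOpen h.smooth)
    h.uv hz
  rw [ip_comm (du Y z), h.uvu hz] at this; linarith

theorem vvu (h : IsCanonical s Y) (hz : z ∈ s) : ip (dv (dv Y) z) (du Y z) = 0 := by
  have := ip_dv_of_const h.isOpen (smooth_du h.isOpen h.smooth) (smooth_dv h.isOpen h.smooth)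
    h.uv hz
  rw [ip_comm (du Y z), h.comm hz, h.uvv hz] at this; linarith

/-- The induced metric is flat. -/
theorem gauss (h : IsCanonical s Y) (hz : z ∈ s) :
    ip (du (du Y) z) (dv (dv Y) z) = ip (du (dv Y) z) (du (dv Y) z) := by
  have hs := h.isOpen
  have hv := smooth_dv hs h.smooth
  -- Differentiating `⟨Y_uu, Y_v⟩ = 0` in `v` and `⟨Y_uv, Y_v⟩ = 0` in `u` produces the same
  -- third-order term, which cancels.
  have h1 := ip_dv_of_const hs (smooth_du hs (smooth_du hs h.smooth)) hv
    (fun w hw => h.uuv hw) hz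
  have h2 := ip_du_of_const hs (smooth_du hs hv) hv (fun w hw => h.uvv hw) hz
  have h3 : dv (du (du Y)) z = du (du (dv Y)) z := by
    rw [dv_du_comm (smooth_at hs (smooth_du hs h.smooth) hz)]
    exact du_congr_on hs (fun w hw => h.comm hw) hz
  rw [h3] at h1
  linarith

theorem HY (h : IsCanonical s Y) (hz : z ∈ s) : ip (lap Y z) (Y z) = -2 := by
  unfold lap; rw [ip_add_left, h.uuY hz, h.vvY hz]; norm_num

theorem Hu (h : IsCanonical s Y) (hz : z ∈ s) : ip (lap Y z) (du Y z) = 0 := by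
  unfold lap; rw [ip_add_left, h.uuu hz, h.vvu hz]; norm_num

theorem Hv (h : IsCanonical s Y) (hz : z ∈ s) : ip (lap Y z) (dv Y z) = 0 := by
  unfold lap; rw [ip_add_left, h.uuv hz, h.vvv hz]; norm_num

theorem uu_eq (z : ℂ) : du (du Y) z = (1 / 2 : ℝ) • lap Y z + hopfRe Y z := by
  unfold lap hopfRe; module

theorem vv_eq (z : ℂ) : dv (dv Y) z = (1 / 2 : ℝ) • lap Y z - hopfRe Y z := by
  unfold lap hopfRe; module

theorem hopfRe_Y (h : IsCanonical s Y) (hz : z ∈ s) : ip (hopfRe Y z) (Y z) = 0 := by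
  unfold hopfRe; rw [ip_smul_left, ip_sub_left, h.uuY hz, h.vvY hz]; norm_num

theorem hopfRe_u (h : IsCanonical s Y) (hz : z ∈ s) : ip (hopfRe Y z) (du Y z) = 0 := by
  unfold hopfRe; rw [ip_smul_left, ip_sub_left, h.uuu hz, h.vvu hz]; norm_num

theorem hopfRe_v (h : IsCanonical s Y) (hz : z ∈ s) : ip (hopfRe Y z) (dv Y z) = 0 := by
  unfold hopfRe; rw [ip_smul_left, ip_sub_left, h.uuv hz, h.vvv hz]; norm_num

/-- Only the symmetry of third derivatives is involved: the trace-free Hessian has half the gradient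
of the Laplacian as its divergence. -/
theorem codazzi_u (h : IsCanonical s Y) (hz : z ∈ s) :
    du (hopfRe Y) z + dv (du (dv Y)) z = (1 / 2 : ℝ) • du (lap Y) z := by
  have hs := h.isOpen
  have d1 := diff_at hs (smooth_du hs (smooth_du hs h.smooth)) hz
  have d2 := diff_at hs (smooth_dv hs (smooth_dv hs h.smooth)) hz
  unfold hopfRe
  rw [du_const_smul _ (d1.fun_sub d2), du_sub d1 d2,
    dv_du_comm (smooth_at hs (smooth_dv hs h.smooth) hz)]
  change _ = (1 / 2 : ℝ) • du (fun w => du (du Y) w + dv (dv Y) w) z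
  rw [du_add d1 d2]
  module

theorem codazzi_v (h : IsCanonical s Y) (hz : z ∈ s) :
    du (du (dv Y)) z - dv (hopfRe Y) z = (1 / 2 : ℝ) • dv (lap Y) z := by
  have hs := h.isOpen
  have d1 := diff_at hs (smooth_du hs (smooth_du hs h.smooth)) hz
  have d2 := diff_at hs (smooth_dv hs (smooth_dv hs h.smooth)) hz
  have h3 : dv (du (du Y)) z = du (du (dv Y)) z := by
    rw [dv_du_comm (smooth_at hs (smooth_du hs h.smooth) hz)]
    exact du_congr_on hs (fun w hw => h.comm hw) hz
  unfold hopfRe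
  rw [dv_const_smul _ (d1.fun_sub d2), dv_sub d1 d2, ← h3]
  change _ = (1 / 2 : ℝ) • dv (fun w => du (du Y) w + dv (dv Y) w) z
  rw [dv_add d1 d2]
  module

/-- The double divergence of the trace-free Hessian. It supplies the fourth-order term of the
Euler-Lagrange field after two integrations by parts. -/
theorem bilaplacian (h : IsCanonical s Y) (hz : z ∈ s) :
    du (du (hopfRe Y)) z - dv (dv (hopfRe Y)) z + (2 : ℝ) • dv (du (du (dv Y))) z
      = (1 / 2 : ℝ) • lap (lap Y) z := by
  have hs := h.isOpen
  have sp := h.smooth_hopfRe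
  have sq := h.smooth_hopfIm
  have h1 := du_congr_on hs (fun w hw => h.codazzi_u hw) hz
  have h2 := dv_congr_on hs (fun w hw => h.codazzi_v hw) hz
  rw [du_add (diff_at hs (smooth_du hs sp) hz) (diff_at hs (smooth_dv hs sq) hz),
    du_const_smul _ (diff_at hs (smooth_du hs h.smooth_H) hz)] at h1
  rw [dv_sub (diff_at hs (smooth_du hs sq) hz) (diff_at hs (smooth_dv hs sp) hz),
    dv_const_smul _ (diff_at hs (smooth_dv hs h.smooth_H) hz)] at h2
  rw [← dv_du_comm (smooth_at hs sq hz)] at h1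
  change _ = (1 / 2 : ℝ) • (du (du (lap Y)) z + dv (dv (lap Y)) z)
  rw [smul_add, ← h1, ← h2]
  module

theorem fderiv_jetWillmore (h : IsCanonical s Y) (hz : z ∈ s) (k : Jet) :
    fderiv ℝ jetWillmore (jet Y z) k = linWillmore (jet Y z) k :=
  SpacelikeWillmore.fderiv_jetWillmore (h.uu z hz) (h.uv z hz) (h.vv z hz) (h.uuu hz) (h.uuv hz)
    (h.uvu hz) (h.uvv hz) (h.vvu hz) (h.vvv hz) (h.gauss hz) k

end IsCanonical

/-- The first component of the boundary term in the first variation formula. -/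
def fluxU (Y w : ℂ → R62) (z : ℂ) : ℝ :=
  1 / 4 * ip (hopfRe Y z) (du w z) - 1 / 4 * ip (du (hopfRe Y) z) (w z)
    + 1 / 2 * ip (du (dv Y) z) (dv w z) - 1 / 4 * ip (stressU Y z) (w z)

/-- The second component of the boundary term in the first variation formula. -/
def fluxV (Y w : ℂ → R62) (z : ℂ) : ℝ :=
  1 / 4 * ip (dv (hopfRe Y) z) (w z) - 1 / 4 * ip (hopfRe Y z) (dv w z)
    - 1 / 2 * ip (du (du (dv Y)) z) (w z) - 1 / 4 * ip (stressV Y z) (w z)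

-- The first variation formula and its Noether identities.

section FirstVariation

variable {s : Set ℂ} {Y w : ℂ → R62} {z : ℂ}

theorem smooth_fluxU (h : IsCanonical s Y) (hw : ContDiffOn ℝ ∞ w s) :
    ContDiffOn ℝ ∞ (fluxU Y w) s :=
  (((contDiffOn_const.mul (smooth_ip h.smooth_hopfRe (smooth_du h.isOpen hw))).sub
    (contDiffOn_const.mul (smooth_ip (smooth_du h.isOpen h.smooth_hopfRe) hw))).add
    (contDiffOn_const.mul (smooth_ip h.smooth_hopfIm (smooth_dv h.isOpen hw)))).sub
    (contDiffOn_const.mul (smooth_ip h.smooth_stressU hw))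

theorem smooth_fluxV (h : IsCanonical s Y) (hw : ContDiffOn ℝ ∞ w s) :
    ContDiffOn ℝ ∞ (fluxV Y w) s :=
  (((contDiffOn_const.mul (smooth_ip (smooth_dv h.isOpen h.smooth_hopfRe) hw)).sub
    (contDiffOn_const.mul (smooth_ip h.smooth_hopfRe (smooth_dv h.isOpen hw)))).sub
    (contDiffOn_const.mul (smooth_ip (smooth_du h.isOpen h.smooth_hopfIm) hw))).sub
    (contDiffOn_const.mul (smooth_ip h.smooth_stressV hw))

theorem du_const_mul (c : ℝ) {f : ℂ → ℝ} (hf : DifferentiableAt ℝ f z) :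
    du (fun w => c * f w) z = c * du f z := du_const_smul c hf

theorem dv_const_mul (c : ℝ) {f : ℂ → ℝ} (hf : DifferentiableAt ℝ f z) :
    dv (fun w => c * f w) z = c * dv f z := dv_const_smul c hf

/-- The first variation of the Willmore integrand, up to a divergence. -/
theorem linWillmore_eq (h : IsCanonical s Y) (hw : ContDiffOn ℝ ∞ w s) (hz : z ∈ s) :
    linWillmore (jet Y z) (jet w z)
      = ip (eulerLagrange Y z) (w z) + du (fluxU Y w) z + dv (fluxV Y w) z := by
  have hs := h.isOpen
  have dw := diff_at hs hw hz
  have dwu := diff_at hs (smooth_du hs hw) hz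
  have dwv := diff_at hs (smooth_dv hs hw) hz
  have dp := diff_at hs h.smooth_hopfRe hz
  have dpu := diff_at hs (smooth_du hs h.smooth_hopfRe) hz
  have dpv := diff_at hs (smooth_dv hs h.smooth_hopfRe) hz
  have dq := diff_at hs h.smooth_hopfIm hz
  have dqu := diff_at hs (smooth_du hs h.smooth_hopfIm) hz
  have dU := diff_at hs h.smooth_stressU hz
  have dV := diff_at hs h.smooth_stressV hz
  have dip : ∀ {f g : ℂ → R62}, DifferentiableAt ℝ f z → DifferentiableAt ℝ g z →
      DifferentiableAt ℝ (fun x => ip (f x) (g x)) z := fun hf hg =>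
    ((differentiableAt_const ipL).clm_apply hf).clm_apply hg
  have dcip : ∀ {f g : ℂ → R62} (c : ℝ), DifferentiableAt ℝ f z → DifferentiableAt ℝ g z →
      DifferentiableAt ℝ (fun x => c * ip (f x) (g x)) z := fun c hf hg => (dip hf hg).const_mul c
  have hA : du (fluxU Y w) z = 1 / 4 * (ip (du (hopfRe Y) z) (du w z)
      + ip (hopfRe Y z) (du (du w) z)) - 1 / 4 * (ip (du (du (hopfRe Y)) z) (w z)
      + ip (du (hopfRe Y) z) (du w z)) + 1 / 2 * (ip (du (du (dv Y)) z) (dv w z)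
      + ip (du (dv Y) z) (du (dv w) z)) - 1 / 4 * (ip (du (stressU Y) z) (w z)
      + ip (stressU Y z) (du w z)) := by
    unfold fluxU
    rw [du_sub (((dcip _ dp dwu).fun_sub (dcip _ dpu dw)).fun_add (dcip _ dq dwv)) (dcip _ dU dw),
      du_add ((dcip _ dp dwu).fun_sub (dcip _ dpu dw)) (dcip _ dq dwv),
      du_sub (dcip _ dp dwu) (dcip _ dpu dw), du_const_mul _ (dip dp dwu),
      du_const_mul _ (dip dpu dw), du_const_mul _ (dip dq dwv), du_const_mul _ (dip dU dw),
      du_ip dp dwu, du_ip dpu dw, du_ip dq dwv, du_ip dU dw]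
  have hB : dv (fluxV Y w) z = 1 / 4 * (ip (dv (dv (hopfRe Y)) z) (w z)
      + ip (dv (hopfRe Y) z) (dv w z)) - 1 / 4 * (ip (dv (hopfRe Y) z) (dv w z)
      + ip (hopfRe Y z) (dv (dv w) z)) - 1 / 2 * (ip (dv (du (du (dv Y))) z) (w z)
      + ip (du (du (dv Y)) z) (dv w z)) - 1 / 4 * (ip (dv (stressV Y) z) (w z)
      + ip (stressV Y z) (dv w z)) := by
    unfold fluxV
    rw [dv_sub (((dcip _ dpv dw).fun_sub (dcip _ dp dwv)).fun_sub (dcip _ dqu dw)) (dcip _ dV dw),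
      dv_sub ((dcip _ dpv dw).fun_sub (dcip _ dp dwv)) (dcip _ dqu dw),
      dv_sub (dcip _ dpv dw) (dcip _ dp dwv), dv_const_mul _ (dip dp dwv),
      dv_const_mul _ (dip dpv dw), dv_const_mul _ (dip dqu dw), dv_const_mul _ (dip dV dw),
      dv_ip dp dwv, dv_ip dpv dw, dv_ip dqu dw, dv_ip dV dw]
  -- The two fluxes are built so that all derivatives of `w` cancel; what is left over is the double
  -- divergence of the trace-free Hessian paired with `w`.
  have hb := congrArg (fun x => ip x (w z)) (h.bilaplacian hz)
  simp only [ip_add_left, ip_sub_left, ip_smul_left] at hb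
  rw [hA, hB, eulerLagrange]
  change 1 / 4 * ip (hopfRe Y z) (du (du w) z - dv (dv w) z) + 1 / 2 * ip (du (dv Y) z) (du (dv w) z)
    - 1 / 16 * (ip (du w z) (du Y z) + ip (dv w z) (dv Y z)) * ip (lap Y z) (lap Y z)
    - 1 / 4 * (ip (du w z) (du Y z) - ip (dv w z) (dv Y z)) * ip (hopfRe Y z) (lap Y z)
    - 1 / 4 * (ip (du w z) (dv Y z) + ip (dv w z) (du Y z)) * ip (du (dv Y) z) (lap Y z) = _
  have e1 : ip (stressU Y z) (du w z) = (1 / 4 * ip (lap Y z) (lap Y z)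
      + ip (hopfRe Y z) (lap Y z)) * ip (du w z) (du Y z)
      + ip (du (dv Y) z) (lap Y z) * ip (du w z) (dv Y z) := by
    unfold stressU
    rw [ip_add_left, ip_smul_left, ip_smul_left, ip_comm (du w z), ip_comm (du w z)]
  have e2 : ip (stressV Y z) (dv w z) = (1 / 4 * ip (lap Y z) (lap Y z)
      - ip (hopfRe Y z) (lap Y z)) * ip (dv w z) (dv Y z)
      + ip (du (dv Y) z) (lap Y z) * ip (dv w z) (du Y z) := by
    unfold stressV
    rw [ip_add_left, ip_smul_left, ip_smul_left, ip_comm (dv w z), ip_comm (dv w z)]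
  rw [e1, e2]
  simp only [ip_add_left, ip_smul_left, ip_sub_right]
  linear_combination 1 / 4 * hb

/-- The divergence of the stress field. -/
theorem div_stress (h : IsCanonical s Y) (hz : z ∈ s) :
    du (stressU Y) z + dv (stressV Y) z =
      (1 / 2 * ip (du (lap Y) z) (lap Y z) + ip (du (hopfRe Y) z) (lap Y z)
        + ip (hopfRe Y z) (du (lap Y) z) + ip (dv (du (dv Y)) z) (lap Y z)
        + ip (du (dv Y) z) (dv (lap Y) z)) • du Y z
      + (1 / 2 * ip (dv (lap Y) z) (lap Y z) - ip (dv (hopfRe Y) z) (lap Y z)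
        - ip (hopfRe Y z) (dv (lap Y) z) + ip (du (du (dv Y)) z) (lap Y z)
        + ip (du (dv Y) z) (du (lap Y) z)) • dv Y z
      + (1 / 4 * ip (lap Y z) (lap Y z) + ip (hopfRe Y z) (lap Y z)) • du (du Y) z
      + (1 / 4 * ip (lap Y z) (lap Y z) - ip (hopfRe Y z) (lap Y z)) • dv (dv Y) z
      + (2 * ip (du (dv Y) z) (lap Y z)) • du (dv Y) z := by
  have hs := h.isOpen
  have dH := diff_at hs h.smooth_H hz
  have dp := diff_at hs h.smooth_hopfRe hz
  have dq := diff_at hs h.smooth_hopfIm hz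
  have dYu := diff_at hs (smooth_du hs h.smooth) hz
  have dYv := diff_at hs (smooth_dv hs h.smooth) hz
  have dip : ∀ {f g : ℂ → R62}, DifferentiableAt ℝ f z → DifferentiableAt ℝ g z →
      DifferentiableAt ℝ (fun x => ip (f x) (g x)) z := fun hf hg =>
    ((differentiableAt_const ipL).clm_apply hf).clm_apply hg
  have dk : DifferentiableAt ℝ (fun x => 1 / 4 * ip (lap Y x) (lap Y x)) z := (dip dH dH).const_mul _
  unfold stressU stressV
  rw [du_add ((dk.fun_add (dip dp dH)).fun_smul dYu) ((dip dq dH).fun_smul dYv),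
    dv_add ((dk.fun_sub (dip dp dH)).fun_smul dYv) ((dip dq dH).fun_smul dYu),
    du_smul (dk.fun_add (dip dp dH)) dYu, du_smul (dip dq dH) dYv,
    dv_smul (dk.fun_sub (dip dp dH)) dYv, dv_smul (dip dq dH) dYu, du_add dk (dip dp dH),
    dv_sub dk (dip dp dH), du_const_mul _ (dip dH dH), dv_const_mul _ (dip dH dH), du_ip dH dH,
    dv_ip dH dH, du_ip dp dH, dv_ip dp dH, du_ip dq dH, dv_ip dq dH, h.comm hz,
    ip_comm (lap Y z) (du (lap Y) z), ip_comm (lap Y z) (dv (lap Y) z)]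
  module

/-- Scalar products with the Euler-Lagrange field. -/
theorem ip_eulerLagrange (h : IsCanonical s Y) (hz : z ∈ s) (X : R62) :
    ip (eulerLagrange Y z) X = 1 / 8 * ip (lap (lap Y) z) X + 1 / 4 * (
      (ip (du (lap Y) z) (lap Y z) + ip (hopfRe Y z) (du (lap Y) z)
        + ip (du (dv Y) z) (dv (lap Y) z)) * ip (du Y z) X
      + (ip (dv (lap Y) z) (lap Y z) - ip (hopfRe Y z) (dv (lap Y) z)
        + ip (du (dv Y) z) (du (lap Y) z)) * ip (dv Y z) X
      + (1 / 4 * ip (lap Y z) (lap Y z) + ip (hopfRe Y z) (lap Y z)) * ip (du (du Y) z) X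
      + (1 / 4 * ip (lap Y z) (lap Y z) - ip (hopfRe Y z) (lap Y z)) * ip (dv (dv Y) z) X
      + 2 * ip (du (dv Y) z) (lap Y z) * ip (du (dv Y) z) X) := by
  -- The derivatives of the trace-free Hessian in the divergence of the stress field combine, by
  -- Codazzi, into derivatives of `ΔY`.
  have h1 := congrArg (fun x => ip x (lap Y z)) (h.codazzi_u hz)
  have h2 := congrArg (fun x => ip x (lap Y z)) (h.codazzi_v hz)
  simp only [ip_add_left, ip_sub_left, ip_smul_left] at h1 h2
  unfold eulerLagrange
  rw [div_stress h hz]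
  simp only [ip_add_left, ip_smul_left]
  linear_combination 1 / 4 * ip (du Y z) X * h1 + 1 / 4 * ip (dv Y z) X * h2

/-- The Noether identity of the invariance under rescaling of the lift; it follows by
differentiating `⟨ΔY, Y⟩ = -2` and `⟨ΔY, dY⟩ = 0`. -/
theorem eulerLagrange_Y (h : IsCanonical s Y) (hz : z ∈ s) : ip (eulerLagrange Y z) (Y z) = 0 := by
  have hs := h.isOpen
  have h1 := ip_lap_of_const hs h.smooth_H h.smooth (fun w hw => h.HY hw) hz
  have h2 := ip_du_of_const hs h.smooth_H (smooth_du hs h.smooth) (fun w hw => h.Hu hw) hz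
  have h3 := ip_dv_of_const hs h.smooth_H (smooth_dv hs h.smooth) (fun w hw => h.Hv hw) hz
  have h4 : ip (lap Y z) (lap Y z) = ip (lap Y z) (du (du Y) z) + ip (lap Y z) (dv (dv Y) z) :=
    ip_add_right _ _ _
  rw [ip_eulerLagrange h hz, h.uY hz, h.vY hz, h.uuY hz, h.uvY hz, h.vvY hz]
  linear_combination 1 / 8 * h1 - 1 / 4 * h2 - 1 / 4 * h3 - 1 / 4 * h4

/-- The Noether identity of reparametrization invariance: the Laplacian of `⟨ΔY, Y_u⟩ = 0` yields
exactly the tangential terms of the stress field. -/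
theorem eulerLagrange_u (h : IsCanonical s Y) (hz : z ∈ s) :
    ip (eulerLagrange Y z) (du Y z) = 0 := by
  have hs := h.isOpen
  have hu := smooth_du hs h.smooth
  have h1 := ip_lap_of_const hs h.smooth_H hu (fun w hw => h.Hu hw) hz
  have h5 : lap (du Y) z = du (lap Y) z := by
    unfold lap
    rw [dv_congr_on hs (fun w hw => h.comm hw) hz,
      dv_du_comm (smooth_at hs (smooth_dv hs h.smooth) hz)]
    exact (du_add (diff_at hs (smooth_du hs hu) hz)
      (diff_at hs (smooth_dv hs (smooth_dv hs h.smooth)) hz)).symm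
  rw [h5, h.comm hz, IsCanonical.uu_eq, ip_add_right, ip_smul_right, ip_comm (lap Y z)] at h1
  rw [ip_eulerLagrange h hz, h.uu z hz, ip_comm (dv Y z), h.uv z hz, h.uuu hz, h.uvu hz, h.vvu hz,
    ip_comm (hopfRe Y z), ip_comm (du (dv Y) z)]
  linear_combination 1 / 8 * h1

theorem eulerLagrange_v (h : IsCanonical s Y) (hz : z ∈ s) :
    ip (eulerLagrange Y z) (dv Y z) = 0 := by
  have hs := h.isOpen
  have hv := smooth_dv hs h.smooth
  have h1 := ip_lap_of_const hs h.smooth_H hv (fun w hw => h.Hv hw) hz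
  have h5 : lap (dv Y) z = dv (lap Y) z := by
    unfold lap
    have : dv (du (du Y)) z = du (du (dv Y)) z := by
      rw [dv_du_comm (smooth_at hs (smooth_du hs h.smooth) hz)]
      exact du_congr_on hs (fun w hw => h.comm hw) hz
    rw [← this]
    exact (dv_add (diff_at hs (smooth_du hs (smooth_du hs h.smooth)) hz)
      (diff_at hs (smooth_dv hs hv) hz)).symm
  rw [h5, IsCanonical.vv_eq, ip_sub_right, ip_smul_right, ip_comm (lap Y z)] at h1
  rw [ip_eulerLagrange h hz, h.vv z hz, h.uv z hz, h.uuv hz, h.uvv hz, h.vvv hz,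
    ip_comm (hopfRe Y z) (dv (lap Y) z), ip_comm (du (dv Y) z) (du (lap Y) z)]
  linear_combination 1 / 8 * h1

end FirstVariation

/-! ### Null normal frames of a canonical lift -/

/-- `L`, `R` are null sections of the normal bundle of the canonical lift `Y` with
`⟨L, R⟩ = -1`. -/
structure IsFrame (s : Set ℂ) (Y L R : ℂ → R62) : Prop extends IsCanonical s Y where
  smooth_L : ContDiffOn ℝ ∞ L s
  smooth_R : ContDiffOn ℝ ∞ R s
  LY : ∀ z ∈ s, ip (L z) (Y z) = 0
  LU : ∀ z ∈ s, ip (L z) (du Y z) = 0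
  LV : ∀ z ∈ s, ip (L z) (dv Y z) = 0
  LH : ∀ z ∈ s, ip (L z) (lap Y z) = 0
  RY : ∀ z ∈ s, ip (R z) (Y z) = 0
  RU : ∀ z ∈ s, ip (R z) (du Y z) = 0
  RV : ∀ z ∈ s, ip (R z) (dv Y z) = 0
  RH : ∀ z ∈ s, ip (R z) (lap Y z) = 0
  LL : ∀ z ∈ s, ip (L z) (L z) = 0
  RR : ∀ z ∈ s, ip (R z) (R z) = 0
  LR : ∀ z ∈ s, ip (L z) (R z) = -1

/-- The determinant of an adapted frame. -/
def frameDet (Y L R : ℂ → R62) (z : ℂ) : ℝ :=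
  Matrix.det (Matrix.of ![Y z, du Y z, dv Y z, dualN Y z, R z, L z])

/-- The equation `ΔL ≡ 2 (⟨R_u, L⟩ L_u + ⟨R_v, L⟩ L_v)` modulo `L`, `R`. -/
def HarmonicEq (L R : ℂ → R62) (z : ℂ) : Prop :=
  ∀ b, ip b (L z) = 0 → ip b (R z) = 0 → ip (lap L z) b
    = 2 * (ip (du R z) (L z) * ip (du L z) b + ip (dv R z) (L z) * ip (dv L z) b)

namespace IsFrame

variable {s : Set ℂ} {Y L R : ℂ → R62} {z : ℂ}

theorem mono (h : IsFrame s Y L R) {t : Set ℂ} (ht : IsOpen t) (hts : t ⊆ s) :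
    IsFrame t Y L R :=
  { h.toIsCanonical.mono ht hts with
    smooth_L := h.smooth_L.mono hts, smooth_R := h.smooth_R.mono hts
    LY := fun z hz => h.LY z (hts hz), LU := fun z hz => h.LU z (hts hz)
    LV := fun z hz => h.LV z (hts hz), LH := fun z hz => h.LH z (hts hz)
    RY := fun z hz => h.RY z (hts hz), RU := fun z hz => h.RU z (hts hz)
    RV := fun z hz => h.RV z (hts hz), RH := fun z hz => h.RH z (hts hz)
    LL := fun z hz => h.LL z (hts hz), RR := fun z hz => h.RR z (hts hz)
    LR := fun z hz => h.LR z (hts hz) }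

theorem swap (h : IsFrame s Y L R) : IsFrame s Y R L :=
  { h.toIsCanonical with
    smooth_L := h.smooth_R, smooth_R := h.smooth_L, LY := h.RY, LU := h.RU, LV := h.RV, LH := h.RH
    RY := h.LY, RU := h.LU, RV := h.LV, RH := h.LH, LL := h.RR, RR := h.LL
    LR := fun z hz => by rw [ip_comm]; exact h.LR z hz }

theorem nullFrame (h : IsFrame s Y L R) (hz : z ∈ s) :
    IsNullFrame (Y z) (du Y z) (dv Y z) (dualN Y z) (L z) (R z) where
  YY := h.null z hz
  YU := by rw [ip_comm]; exact h.uY hz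
  YV := by rw [ip_comm]; exact h.vY hz
  YN := by
    rw [dualN, ip_add_right, ip_smul_right, ip_smul_right, h.null z hz, ip_comm, h.HY hz]; norm_num
  YL := by rw [ip_comm]; exact h.LY z hz
  YR := by rw [ip_comm]; exact h.RY z hz
  UU := h.uu z hz
  UV := h.uv z hz
  UN := by
    rw [dualN, ip_add_right, ip_smul_right, ip_smul_right, h.uY hz, ip_comm, h.Hu hz]; norm_num
  UL := by rw [ip_comm]; exact h.LU z hz
  UR := by rw [ip_comm]; exact h.RU z hz
  VV := h.vv z hz
  VN := by
    rw [dualN, ip_add_right, ip_smul_right, ip_smul_right, h.vY hz, ip_comm, h.Hv hz]; norm_num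
  VL := by rw [ip_comm]; exact h.LV z hz
  VR := by rw [ip_comm]; exact h.RV z hz
  NN := by
    simp only [dualN, ip_add_right, ip_smul_right, ip_add_left, ip_smul_left, h.null z hz, h.HY hz,
      ip_comm (Y z) (lap Y z)]
    ring
  NL := by
    rw [dualN, ip_add_left, ip_smul_left, ip_smul_left, ip_comm, h.LH z hz, ip_comm (Y z), h.LY z hz]
    norm_num
  NR := by
    rw [dualN, ip_add_left, ip_smul_left, ip_smul_left, ip_comm, h.RH z hz, ip_comm (Y z), h.RY z hz]
    norm_num
  LL := h.LL z hz
  LR := h.LR z hz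
  RR := h.RR z hz

theorem H_eq (z : ℂ) : lap Y z = (2 : ℝ) • dualN Y z - (ip (lap Y z) (lap Y z) / 4) • Y z := by
  unfold dualN; module

theorem LuY (h : IsFrame s Y L R) (hz : z ∈ s) : ip (du L z) (Y z) = 0 := by
  have := ip_du_of_const h.isOpen h.smooth_L h.smooth h.LY hz
  rw [h.LU z hz] at this; linarith

theorem LvY (h : IsFrame s Y L R) (hz : z ∈ s) : ip (dv L z) (Y z) = 0 := by
  have := ip_dv_of_const h.isOpen h.smooth_L h.smooth h.LY hz
  rw [h.LV z hz] at this; linarith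

theorem LuL (h : IsFrame s Y L R) (hz : z ∈ s) : ip (du L z) (L z) = 0 := by
  have := ip_du_of_const h.isOpen h.smooth_L h.smooth_L h.LL hz
  rw [ip_comm (L z)] at this; linarith

theorem LvL (h : IsFrame s Y L R) (hz : z ∈ s) : ip (dv L z) (L z) = 0 := by
  have := ip_dv_of_const h.isOpen h.smooth_L h.smooth_L h.LL hz
  rw [ip_comm (L z)] at this; linarith

theorem LuR (h : IsFrame s Y L R) (hz : z ∈ s) : ip (du L z) (R z) = -ip (du R z) (L z) := by
  have := ip_du_of_const h.isOpen h.smooth_L h.smooth_R h.LR hz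
  rw [ip_comm (L z)] at this; linarith

theorem LvR (h : IsFrame s Y L R) (hz : z ∈ s) : ip (dv L z) (R z) = -ip (dv R z) (L z) := by
  have := ip_dv_of_const h.isOpen h.smooth_L h.smooth_R h.LR hz
  rw [ip_comm (L z)] at this; linarith

theorem uuL (h : IsFrame s Y L R) (hz : z ∈ s) : ip (du (du Y) z) (L z) = ip (hopfRe Y z) (L z) := by
  rw [IsCanonical.uu_eq, ip_add_left, ip_smul_left, ip_comm (lap Y z), h.LH z hz]; ring

theorem vvL (h : IsFrame s Y L R) (hz : z ∈ s) :
    ip (dv (dv Y) z) (L z) = -ip (hopfRe Y z) (L z) := by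
  rw [IsCanonical.vv_eq, ip_sub_left, ip_smul_left, ip_comm (lap Y z), h.LH z hz]; ring

theorem LuU (h : IsFrame s Y L R) (hz : z ∈ s) :
    ip (du L z) (du Y z) = -ip (hopfRe Y z) (L z) := by
  have := ip_du_of_const h.isOpen h.smooth_L (smooth_du h.isOpen h.smooth) h.LU hz
  rw [ip_comm (L z), h.uuL hz] at this; linarith

theorem LvV (h : IsFrame s Y L R) (hz : z ∈ s) :
    ip (dv L z) (dv Y z) = ip (hopfRe Y z) (L z) := by
  have := ip_dv_of_const h.isOpen h.smooth_L (smooth_dv h.isOpen h.smooth) h.LV hz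
  rw [ip_comm (L z), h.vvL hz] at this; linarith

theorem LuV (h : IsFrame s Y L R) (hz : z ∈ s) :
    ip (du L z) (dv Y z) = -ip (du (dv Y) z) (L z) := by
  have := ip_du_of_const h.isOpen h.smooth_L (smooth_dv h.isOpen h.smooth) h.LV hz
  rw [ip_comm (L z)] at this; linarith

theorem LvU (h : IsFrame s Y L R) (hz : z ∈ s) :
    ip (dv L z) (du Y z) = -ip (du (dv Y) z) (L z) := by
  have := ip_dv_of_const h.isOpen h.smooth_L (smooth_du h.isOpen h.smooth) h.LU hz
  rw [ip_comm (L z), h.comm hz] at this; linarith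

theorem LuH (h : IsFrame s Y L R) (hz : z ∈ s) :
    ip (du L z) (lap Y z) = -ip (du (lap Y) z) (L z) := by
  have := ip_du_of_const h.isOpen h.smooth_L h.smooth_H h.LH hz
  rw [ip_comm (L z)] at this; linarith

theorem LvH (h : IsFrame s Y L R) (hz : z ∈ s) :
    ip (dv L z) (lap Y z) = -ip (dv (lap Y) z) (L z) := by
  have := ip_dv_of_const h.isOpen h.smooth_L h.smooth_H h.LH hz
  rw [ip_comm (L z)] at this; linarith

/-- The `L`-component of the second derivative of `Y` is trace-free, because `L` is orthogonal to
`ΔY`. This is what makes `Y` a normal field of `[L]`. -/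
theorem lapL_Y (h : IsFrame s Y L R) (hz : z ∈ s) : ip (lap L z) (Y z) = 0 := by
  have := ip_lap_of_const h.isOpen h.smooth_L h.smooth h.LY hz
  rw [h.LH z hz, h.LuU hz, h.LvV hz] at this; linarith

/-- The derivative of `L` has the induced metric `(⟨p, L⟩² + ⟨q, L⟩²) |dz|²`. -/
theorem metric_L (h : IsFrame s Y L R) (hz : z ∈ s) :
    ip (du L z) (du L z) = ip (hopfRe Y z) (L z) ^ 2 + ip (du (dv Y) z) (L z) ^ 2 ∧
    ip (dv L z) (dv L z) = ip (hopfRe Y z) (L z) ^ 2 + ip (du (dv Y) z) (L z) ^ 2 ∧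
    ip (du L z) (dv L z) = 0 := by
  -- As `L_u, L_v` are orthogonal to both `Y` and `L`, the null pairs contribute nothing and only
  -- the `dY`-components count.
  have hN := h.nullFrame hz
  rw [hN.ip_expand (du L z) (du L z), hN.ip_expand (dv L z) (dv L z),
    hN.ip_expand (du L z) (dv L z), h.LuY hz, h.LvY hz, h.LuL hz, h.LvL hz, h.LuU hz, h.LuV hz,
    h.LvU hz, h.LvV hz]
  refine ⟨by ring, by ring, by ring⟩

/-- The components of the second derivatives orthogonal to `Y`, `dY`. -/
theorem harmonic_u (h : IsFrame s Y L R) (hz : z ∈ s) :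
    ip (lap L z) (du Y z) = 2 * (ip (du R z) (L z) * ip (du L z) (du Y z)
      + ip (dv R z) (L z) * ip (dv L z) (du Y z)) := by
  have hs := h.isOpen
  have hu := smooth_du hs h.smooth
  -- The Laplacian of `⟨L, Y_u⟩ = 0`. In the expansion of its cross terms the normal connection
  -- `⟨dR, L⟩` is all that remains, so this is a Codazzi equation and needs no variational
  -- hypothesis.
  have h1 := ip_lap_of_const hs h.smooth_L hu h.LU hz
  have h5 : lap (du Y) z = du (lap Y) z := by
    unfold lap
    rw [dv_congr_on hs (fun w hw => h.comm hw) hz,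
      dv_du_comm (smooth_at hs (smooth_dv hs h.smooth) hz)]
    exact (du_add (diff_at hs (smooth_du hs hu) hz)
      (diff_at hs (smooth_dv hs (smooth_dv hs h.smooth)) hz)).symm
  have hN := h.nullFrame hz
  rw [h5, h.comm hz, IsCanonical.uu_eq, ip_add_right, ip_smul_right, ip_comm (L z), h.LuH hz,
    hN.ip_expand (du L z) (hopfRe Y z), hN.ip_expand (dv L z) (du (dv Y) z), h.LuY hz, h.LvY hz,
    h.LuL hz, h.LvL hz, h.LuR hz, h.LvR hz, h.hopfRe_Y hz, h.hopfRe_u hz, h.hopfRe_v hz, h.uvY hz,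
    h.uvu hz, h.uvv hz] at h1
  rw [h.LuU hz, h.LvU hz]
  linarith

theorem harmonic_v (h : IsFrame s Y L R) (hz : z ∈ s) :
    ip (lap L z) (dv Y z) = 2 * (ip (du R z) (L z) * ip (du L z) (dv Y z)
      + ip (dv R z) (L z) * ip (dv L z) (dv Y z)) := by
  have hs := h.isOpen
  have hv := smooth_dv hs h.smooth
  have h1 := ip_lap_of_const hs h.smooth_L hv h.LV hz
  have h5 : lap (dv Y) z = dv (lap Y) z := by
    unfold lap
    have : dv (du (du Y)) z = du (du (dv Y)) z := by
      rw [dv_du_comm (smooth_at hs (smooth_du hs h.smooth) hz)]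
      exact du_congr_on hs (fun w hw => h.comm hw) hz
    rw [← this]
    exact (dv_add (diff_at hs (smooth_du hs (smooth_du hs h.smooth)) hz)
      (diff_at hs (smooth_dv hs hv) hz)).symm
  have hN := h.nullFrame hz
  rw [h5, IsCanonical.vv_eq, ip_sub_right, ip_smul_right, ip_comm (L z), h.LvH hz,
    hN.ip_expand (dv L z) (hopfRe Y z), hN.ip_expand (du L z) (du (dv Y) z), h.LuY hz, h.LvY hz,
    h.LuL hz, h.LvL hz, h.LuR hz, h.LvR hz, h.hopfRe_Y hz, h.hopfRe_u hz, h.hopfRe_v hz, h.uvY hz,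
    h.uvu hz, h.uvv hz] at h1
  rw [h.LuV hz, h.LvV hz]
  linarith

/-- The normal component of the Euler-Lagrange field. -/
theorem eulerLagrange_L (h : IsFrame s Y L R) (hz : z ∈ s) :
    8 * ip (eulerLagrange Y z) (L z) = 2 * (ip (du R z) (L z) * ip (du L z) (lap Y z)
      + ip (dv R z) (L z) * ip (dv L z) (lap Y z)) - ip (lap L z) (lap Y z) := by
  have hs := h.isOpen
  -- The Laplacian of `⟨L, ΔY⟩ = 0` brings in `⟨ΔΔY, L⟩`, the leading term of the Euler-Lagrange
  -- field. The derivatives of `⟨ΔY, Y⟩ = -2` and `⟨ΔY, dY⟩ = 0` below evaluate the cross terms.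
  have h1 := ip_lap_of_const hs h.smooth_L h.smooth_H h.LH hz
  have hN := h.nullFrame hz
  have u0 := ip_du_of_const hs h.smooth_H h.smooth (fun w hw => h.HY hw) hz
  have v0 := ip_dv_of_const hs h.smooth_H h.smooth (fun w hw => h.HY hw) hz
  rw [h.Hu hz] at u0
  rw [h.Hv hz] at v0
  have u1 := ip_du_of_const hs h.smooth_H (smooth_du hs h.smooth) (fun w hw => h.Hu hw) hz
  have u2 := ip_du_of_const hs h.smooth_H (smooth_dv hs h.smooth) (fun w hw => h.Hv hw) hz
  have v1 := ip_dv_of_const hs h.smooth_H (smooth_du hs h.smooth) (fun w hw => h.Hu hw) hz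
  have v2 := ip_dv_of_const hs h.smooth_H (smooth_dv hs h.smooth) (fun w hw => h.Hv hw) hz
  rw [IsCanonical.uu_eq, ip_add_right, ip_smul_right, ip_comm _ (hopfRe Y z)] at u1
  rw [IsCanonical.vv_eq, ip_sub_right, ip_smul_right, ip_comm _ (hopfRe Y z)] at v2
  rw [h.comm hz, ip_comm (lap Y z)] at v1
  rw [ip_comm (lap Y z)] at u2
  rw [hN.ip_expand (du L z) (du (lap Y) z), hN.ip_expand (dv L z) (dv (lap Y) z), h.LuY hz,
    h.LvY hz, h.LuL hz, h.LvL hz, h.LuR hz, h.LvR hz, h.LuU hz, h.LuV hz, h.LvU hz, h.LvV hz,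
    ip_comm (L z)] at h1
  rw [ip_eulerLagrange h.toIsCanonical hz, ip_comm (du Y z), ip_comm (dv Y z), h.LU z hz, h.LV z hz,
    h.uuL hz, h.vvL hz, h.LuH hz, h.LvH hz]
  set P := ip (hopfRe Y z) (L z)
  set Q := ip (du (dv Y) z) (L z)
  linear_combination h1 + 2 * P * u1 + 2 * Q * u2 + 2 * Q * v1 - 2 * P * v2
    + 2 * ip (du L z) (dualN Y z) * u0 + 2 * ip (dv L z) (dualN Y z) * v0

/-- The Euler-Lagrange equation in the form of the harmonic map equation. -/
theorem harmonicEq (h : IsFrame s Y L R) (hz : z ∈ s) (hE : ip (eulerLagrange Y z) (L z) = 0) :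
    HarmonicEq L R z := by
  intro b hbL hbR
  have h1 := h.eulerLagrange_L hz
  have hu := h.harmonic_u hz
  have hv := h.harmonic_v hz
  -- `ΔY` is `2N` plus a multiple of `Y`, to which `ΔL`, `L_u`, `L_v` are all orthogonal; the
  -- Willmore equation therefore is the missing component of the harmonic map equation, obtained by
  -- pairing with `N`.
  rw [hE, H_eq z] at h1
  simp only [ip_sub_right, ip_smul_right, h.lapL_Y hz, h.LuY hz, h.LvY hz] at h1
  have hN := h.nullFrame hz
  rw [hN.ip_expand (lap L z) b, hN.ip_expand (du L z) b, hN.ip_expand (dv L z) b, hbL, hbR,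
    h.lapL_Y hz, h.LuY hz, h.LvY hz]
  linear_combination -ip b (Y z) / 2 * h1 + ip b (du Y z) * hu + ip b (dv Y z) * hv

theorem rescale (h : IsFrame s Y L R) {c : ℂ → ℝ} (hc : ContDiffOn ℝ ∞ c s)
    (hc0 : ∀ z ∈ s, c z ≠ 0) :
    IsFrame s Y (fun w => c w • L w) (fun w => (c w)⁻¹ • R w) :=
  { h.toIsCanonical with
    smooth_L := hc.smul h.smooth_L
    smooth_R := (hc.inv hc0).smul h.smooth_R
    LY := fun z hz => by rw [ip_smul_left, h.LY z hz, mul_zero]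
    LU := fun z hz => by rw [ip_smul_left, h.LU z hz, mul_zero]
    LV := fun z hz => by rw [ip_smul_left, h.LV z hz, mul_zero]
    LH := fun z hz => by rw [ip_smul_left, h.LH z hz, mul_zero]
    RY := fun z hz => by rw [ip_smul_left, h.RY z hz, mul_zero]
    RU := fun z hz => by rw [ip_smul_left, h.RU z hz, mul_zero]
    RV := fun z hz => by rw [ip_smul_left, h.RV z hz, mul_zero]
    RH := fun z hz => by rw [ip_smul_left, h.RH z hz, mul_zero]
    LL := fun z hz => by rw [ip_smul_left, ip_smul_right, h.LL z hz]; ring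
    RR := fun z hz => by rw [ip_smul_left, ip_smul_right, h.RR z hz]; ring
    LR := fun z hz => by
      rw [ip_smul_left, ip_smul_right, h.LR z hz]
      have := hc0 z hz
      field_simp }

/-- This sign is what turns statements about left polar surfaces into statements about right ones.
-/
theorem frameDet_swap (z : ℂ) : frameDet Y R L z = -frameDet Y L R z := by
  unfold frameDet
  have h := Matrix.det_permute (Equiv.swap (4 : Fin 6) 5)
    (Matrix.of ![Y z, du Y z, dv Y z, dualN Y z, R z, L z])
  rw [Equiv.Perm.sign_swap (by decide)] at h
  rw [show Matrix.of ![Y z, du Y z, dv Y z, dualN Y z, L z, R z] =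
    (Matrix.of ![Y z, du Y z, dv Y z, dualN Y z, R z, L z]).submatrix (Equiv.swap (4 : Fin 6) 5) id
    from ?_, h]
  · simp
  · ext i j
    fin_cases i <;> rfl

theorem frameDet_rescale (c : ℂ → ℝ) (hc : c z ≠ 0) :
    frameDet Y (fun w => c w • L w) (fun w => (c w)⁻¹ • R w) z = frameDet Y L R z := by
  unfold frameDet
  have : Matrix.of ![Y z, du Y z, dv Y z, dualN Y z, (c z)⁻¹ • R z, c z • L z] =
      Matrix.diagonal ![1, 1, 1, 1, (c z)⁻¹, c z] *
        Matrix.of ![Y z, du Y z, dv Y z, dualN Y z, R z, L z] := by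
    ext i j
    rw [Matrix.diagonal_mul]
    fin_cases i <;> simp
  rw [this, Matrix.det_mul, Matrix.det_diagonal]
  simp [Fin.prod_univ_six, hc]

end IsFrame

/-! ### The frame of the polar surface -/

/-- The first coefficient of the adjoint section. -/
def adjU (Y L : ℂ → R62) (z : ℂ) : ℝ :=
  ip (hopfRe Y z) (L z) * ip (dualN Y z) (du L z) + ip (du (dv Y) z) (L z) * ip (dualN Y z) (dv L z)

/-- The second coefficient of the adjoint section. -/
def adjV (Y L : ℂ → R62) (z : ℂ) : ℝ :=
  ip (du (dv Y) z) (L z) * ip (dualN Y z) (du L z) - ip (hopfRe Y z) (L z) * ip (dualN Y z) (dv L z)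

/-- The adjoint section: the null section of `Span {Y, dY, N}` orthogonal to `dL`. -/
def adjoint (Y L : ℂ → R62) (z : ℂ) : R62 :=
  dualN Y z + adjU Y L z • du Y z + adjV Y L z • dv Y z
    + ((adjU Y L z ^ 2 + adjV Y L z ^ 2) / 2) • Y z

namespace IsFrame

variable {s : Set ℂ} {Y L R : ℂ → R62} {z : ℂ}

theorem smooth_adjU (h : IsFrame s Y L R) : ContDiffOn ℝ ∞ (adjU Y L) s :=
  ((smooth_ip h.smooth_hopfRe h.smooth_L).mul
    (smooth_ip h.smooth_dualN (smooth_du h.isOpen h.smooth_L))).add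
    ((smooth_ip h.smooth_hopfIm h.smooth_L).mul
      (smooth_ip h.smooth_dualN (smooth_dv h.isOpen h.smooth_L)))

theorem smooth_adjV (h : IsFrame s Y L R) : ContDiffOn ℝ ∞ (adjV Y L) s :=
  ((smooth_ip h.smooth_hopfIm h.smooth_L).mul
    (smooth_ip h.smooth_dualN (smooth_du h.isOpen h.smooth_L))).sub
    ((smooth_ip h.smooth_hopfRe h.smooth_L).mul
      (smooth_ip h.smooth_dualN (smooth_dv h.isOpen h.smooth_L)))

theorem smooth_adjoint (h : IsFrame s Y L R) : ContDiffOn ℝ ∞ (adjoint Y L) s :=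
  ((h.smooth_dualN.add (h.smooth_adjU.smul (smooth_du h.isOpen h.smooth))).add
    (h.smooth_adjV.smul (smooth_dv h.isOpen h.smooth))).add
    ((((h.smooth_adjU.pow 2).add (h.smooth_adjV.pow 2)).div_const 2).smul h.smooth)

theorem ip_adjoint (X : R62) : ip (adjoint Y L z) X = ip (dualN Y z) X
    + adjU Y L z * ip (du Y z) X + adjV Y L z * ip (dv Y z) X
    + (adjU Y L z ^ 2 + adjV Y L z ^ 2) / 2 * ip (Y z) X := by
  simp only [adjoint, ip_add_left, ip_smul_left]

theorem adjoint_Y (h : IsFrame s Y L R) (hz : z ∈ s) : ip (adjoint Y L z) (Y z) = -1 := by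
  have hN := h.nullFrame hz
  rw [ip_adjoint, ip_comm (dualN Y z), hN.YN, ip_comm (du Y z), hN.YU, ip_comm (dv Y z), hN.YV,
    hN.YY]
  ring

theorem adjoint_U (h : IsFrame s Y L R) (hz : z ∈ s) :
    ip (adjoint Y L z) (du Y z) = adjU Y L z := by
  have hN := h.nullFrame hz
  rw [ip_adjoint, ip_comm (dualN Y z), hN.UN, hN.UU, ip_comm (dv Y z), hN.UV, hN.YU]
  ring

theorem adjoint_V (h : IsFrame s Y L R) (hz : z ∈ s) :
    ip (adjoint Y L z) (dv Y z) = adjV Y L z := by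
  have hN := h.nullFrame hz
  rw [ip_adjoint, ip_comm (dualN Y z), hN.VN, hN.VV, hN.UV, hN.YV]
  ring

theorem adjoint_L (h : IsFrame s Y L R) (hz : z ∈ s) : ip (adjoint Y L z) (L z) = 0 := by
  have hN := h.nullFrame hz
  rw [ip_adjoint, hN.NL, hN.UL, hN.VL, hN.YL]; ring

theorem adjoint_R (h : IsFrame s Y L R) (hz : z ∈ s) : ip (adjoint Y L z) (R z) = 0 := by
  have hN := h.nullFrame hz
  rw [ip_adjoint, hN.NR, hN.UR, hN.VR, hN.YR]; ring

theorem adjoint_adjoint (h : IsFrame s Y L R) (hz : z ∈ s) :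
    ip (adjoint Y L z) (adjoint Y L z) = 0 := by
  have hN := h.nullFrame hz
  rw [ip_adjoint, ip_comm (dualN Y z), ip_comm (du Y z), ip_comm (dv Y z), ip_comm (Y z),
    h.adjoint_Y hz, h.adjoint_U hz, h.adjoint_V hz, ip_adjoint, hN.NN, hN.UN, hN.VN, hN.YN]
  ring

/-- With `P² + Q² = 1` the matrix with rows `(P, Q)`, `(Q, -P)` is an orthogonal involution. The
coefficients `adjU`, `adjV` are its image of `(⟨N, L_u⟩, ⟨N, L_v⟩)`, so they solve the linear system
that makes the adjoint section orthogonal to `dL`. -/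
theorem adjoint_Lu (h : IsFrame s Y L R)
    (hP : ∀ z ∈ s, ip (hopfRe Y z) (L z) ^ 2 + ip (du (dv Y) z) (L z) ^ 2 = 1) (hz : z ∈ s) :
    ip (adjoint Y L z) (du L z) = 0 := by
  rw [ip_adjoint, ip_comm (du Y z), ip_comm (dv Y z), ip_comm (Y z), h.LuU hz, h.LuV hz, h.LuY hz,
    adjU, adjV]
  linear_combination -ip (dualN Y z) (du L z) * hP z hz

theorem adjoint_Lv (h : IsFrame s Y L R)
    (hP : ∀ z ∈ s, ip (hopfRe Y z) (L z) ^ 2 + ip (du (dv Y) z) (L z) ^ 2 = 1) (hz : z ∈ s) :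
    ip (adjoint Y L z) (dv L z) = 0 := by
  rw [ip_adjoint, ip_comm (du Y z), ip_comm (dv Y z), ip_comm (Y z), h.LvU hz, h.LvV hz, h.LvY hz,
    adjU, adjV]
  linear_combination -ip (dualN Y z) (dv L z) * hP z hz

theorem isCanonical_L (h : IsFrame s Y L R)
    (hP : ∀ z ∈ s, ip (hopfRe Y z) (L z) ^ 2 + ip (du (dv Y) z) (L z) ^ 2 = 1) :
    IsCanonical s L where
  isOpen := h.isOpen
  smooth := h.smooth_L
  null := h.LL
  uu := fun z hz => by rw [(h.metric_L hz).1, hP z hz]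
  vv := fun z hz => by rw [(h.metric_L hz).2.1, hP z hz]
  uv := fun z hz => (h.metric_L hz).2.2

/-- The frame of the polar surface `[L]`. -/
theorem polar (h : IsFrame s Y L R)
    (hP : ∀ z ∈ s, ip (hopfRe Y z) (L z) ^ 2 + ip (du (dv Y) z) (L z) ^ 2 = 1)
    (hE : ∀ z ∈ s, ip (eulerLagrange Y z) (L z) = 0) : IsFrame s L (adjoint Y L) Y :=
  { h.isCanonical_L hP with
    smooth_L := h.smooth_adjoint
    smooth_R := h.smooth
    LY := fun z hz => h.adjoint_L hz
    LU := fun z hz => h.adjoint_Lu hP hz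
    LV := fun z hz => h.adjoint_Lv hP hz
    -- The only field that needs the Willmore equation: tested with a vector orthogonal to `L`, `R`
    -- and `dL`, the harmonic map equation has zero right-hand side.
    LH := fun z hz => by
      rw [ip_comm, h.harmonicEq hz (hE z hz) _ (h.adjoint_L hz) (h.adjoint_R hz),
        ip_comm (du L z), h.adjoint_Lu hP hz, ip_comm (dv L z), h.adjoint_Lv hP hz]
      ring
    RY := fun z hz => by rw [ip_comm]; exact h.LY z hz
    RU := fun z hz => by rw [ip_comm]; exact h.LuY hz
    RV := fun z hz => by rw [ip_comm]; exact h.LvY hz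
    RH := fun z hz => by rw [ip_comm]; exact h.lapL_Y hz
    LL := fun z hz => h.adjoint_adjoint hz
    RR := h.null
    LR := fun z hz => h.adjoint_Y hz }

theorem adjU_eq (h : IsFrame s Y L R) (hz : z ∈ s) :
    ip (du (adjoint Y L) z) (Y z) = -adjU Y L z := by
  have := ip_du_of_const h.isOpen h.smooth_adjoint h.smooth (fun w hw => h.adjoint_Y hw) hz
  rw [h.adjoint_U hz] at this; linarith

theorem adjV_eq (h : IsFrame s Y L R) (hz : z ∈ s) :
    ip (dv (adjoint Y L) z) (Y z) = -adjV Y L z := by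
  have := ip_dv_of_const h.isOpen h.smooth_adjoint h.smooth (fun w hw => h.adjoint_Y hw) hz
  rw [h.adjoint_V hz] at this; linarith

/-- The Euler-Lagrange equation of `[L]` in the direction `Y`. -/
theorem polar_eulerLagrange_right (h : IsFrame s Y L R)
    (hP : ∀ z ∈ s, ip (hopfRe Y z) (L z) ^ 2 + ip (du (dv Y) z) (L z) ^ 2 = 1)
    (hE : ∀ z ∈ s, ip (eulerLagrange Y z) (L z) = 0) (hz : z ∈ s) :
    ip (eulerLagrange L z) (Y z) = 0 := by
  have hat := h.polar hP hE
  -- The identity for `⟨E, L⟩` is applied to the frame of `[L]`, with `Y` as the normal field and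
  -- the adjoint section as its partner.
  have h1 := hat.swap.eulerLagrange_L hz
  have h2 : dualN Y z = adjoint Y L z - adjU Y L z • du Y z - adjV Y L z • dv Y z
    - ((adjU Y L z ^ 2 + adjV Y L z ^ 2) / 2) • Y z := by unfold adjoint; module
  -- In `ΔY`, the `Y`-part and the adjoint section are orthogonal to `ΔL`; only the `dY`-parts of
  -- `N` remain, and they cancel the connection terms.
  have h3 : ip (lap Y z) (lap L z) = -2 * adjU Y L z * ip (du Y z) (lap L z)
      - 2 * adjV Y L z * ip (dv Y z) (lap L z) := by
    conv_lhs => rw [H_eq (Y := Y) z, h2]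
    simp only [ip_sub_left, ip_smul_left, hat.LH z hz, hat.RH z hz]
    ring
  rw [h3, h.adjU_eq hz, h.adjV_eq hz] at h1
  linarith

/-- The Euler-Lagrange equation of `[L]` in the direction of the adjoint section. -/
theorem polar_eulerLagrange_left (h : IsFrame s Y L R)
    (hP : ∀ z ∈ s, ip (hopfRe Y z) (L z) ^ 2 + ip (du (dv Y) z) (L z) ^ 2 = 1)
    (hE : ∀ z ∈ s, ip (eulerLagrange Y z) (L z) = 0)
    (hE' : ∀ z ∈ s, ip (eulerLagrange Y z) (R z) = 0) (hz : z ∈ s) :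
    ip (eulerLagrange L z) (adjoint Y L z) = 0 := by
  have hs := h.isOpen
  have hat := h.polar hP hE
  have hN := h.nullFrame hz
  have hA := h.smooth_adjoint
  have hu := h.adjU_eq hz
  have hv := h.adjV_eq hz
  set A := adjoint Y L with hAdef
  set a := adjU Y L z with ha
  set b := adjV Y L z with hb
  set P := ip (hopfRe Y z) (L z) with hPdef
  set Q := ip (du (dv Y) z) (L z) with hQdef
  have hPQ : P ^ 2 + Q ^ 2 = 1 := hP z hz
  have hYu : ip (du Y z) (A z) = a := by rw [ip_comm]; exact h.adjoint_U hz
  have hYv : ip (dv Y z) (A z) = b := by rw [ip_comm]; exact h.adjoint_V hz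
  -- the equation holds when paired with `L`, `L_u`, `L_v`
  have gL : ip (lap A z) (L z) = 0 := hat.lapL_Y hz
  have guL : ip (du A z) (L z) = 0 := hat.LuY hz
  have gvL : ip (dv A z) (L z) = 0 := hat.LvY hz
  have gu := hat.harmonic_u hz
  have gv := hat.harmonic_v hz
  rw [hYu, hYv] at gu gv
  -- the products `⟨A_i, Y_j⟩`
  have n1 : ip (du L z) (dualN Y z) = a * P + b * Q := by
    rw [ha, hb, adjU, adjV, ← hPdef, ← hQdef, ip_comm (du L z)]
    linear_combination -ip (dualN Y z) (du L z) * hPQ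
  have n2 : ip (dv L z) (dualN Y z) = a * Q - b * P := by
    rw [ha, hb, adjU, adjV, ← hPdef, ← hQdef, ip_comm (dv L z)]
    linear_combination -ip (dualN Y z) (dv L z) * hPQ
  have m11 := hN.ip_expand (du A z) (du L z)
  have m12 := hN.ip_expand (du A z) (dv L z)
  have m21 := hN.ip_expand (dv A z) (du L z)
  have m22 := hN.ip_expand (dv A z) (dv L z)
  rw [hu, guL, n1, h.LuY hz, h.LuU hz, h.LuV hz, h.LuL hz] at m11
  rw [hu, guL, n2, h.LvY hz, h.LvU hz, h.LvV hz, h.LvL hz] at m12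
  rw [hv, gvL, n1, h.LuY hz, h.LuU hz, h.LuV hz, h.LuL hz] at m21
  rw [hv, gvL, n2, h.LvY hz, h.LvU hz, h.LvV hz, h.LvL hz] at m22
  -- The second fundamental form of `[L]` along the adjoint section is trace-free and symmetric.
  have tr : ip (du A z) (du L z) + ip (dv A z) (dv L z) = 0 := by
    rw [hat.LuU hz, hat.LvV hz]; ring
  have sy : ip (du A z) (dv L z) = ip (dv A z) (du L z) := by
    rw [hat.LuV hz, hat.LvU hz]
  set x11 := ip (du A z) (du Y z)
  set x12 := ip (du A z) (dv Y z)
  set x21 := ip (dv A z) (du Y z)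
  set x22 := ip (dv A z) (dv Y z)
  have t1 : (x11 - a ^ 2 - x22 + b ^ 2) * P + (x12 + x21 - 2 * a * b) * Q = 0 := by
    linear_combination m11 + m22 - tr
  have t2 : (x12 + x21 - 2 * a * b) * P - (x11 - a ^ 2 - x22 + b ^ 2) * Q = 0 := by
    linear_combination m21 - m12 + sy
  -- The linear system `t1`, `t2` has determinant `±(P² + Q²) ≠ 0`. Its solution is the Riccati
  -- relation `⟨A_z, Y_z⟩ = ⟨A, Y_z⟩²`, split here into real and imaginary part.
  have d0 : x11 - a ^ 2 - x22 + b ^ 2 = 0 := by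
    linear_combination P * t1 - Q * t2 - (x11 - a ^ 2 - x22 + b ^ 2) * hPQ
  have e0 : x12 + x21 - 2 * a * b = 0 := by
    linear_combination Q * t1 + P * t2 - (x12 + x21 - 2 * a * b) * hPQ
  -- pairing with `R`
  have lR := ip_lap_of_const hs hA h.smooth_R (fun w hw => h.adjoint_R hw) hz
  -- Here the Willmore equation of `y` in the direction `R` enters.
  have hh := h.swap.harmonicEq hz (hE' z hz) (A z) (h.adjoint_R hz) (h.adjoint_L hz)
  have uR : ip (du A z) (R z) = -ip (du R z) (A z) := by
    have := ip_du_of_const hs hA h.smooth_R (fun w hw => h.adjoint_R hw) hz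
    rw [ip_comm (A z)] at this; linarith
  have vR : ip (dv A z) (R z) = -ip (dv R z) (A z) := by
    have := ip_dv_of_const hs hA h.smooth_R (fun w hw => h.adjoint_R hw) hz
    rw [ip_comm (A z)] at this; linarith
  have ruA : ip (du R z) (A z) = ip (du R z) (dualN Y z) - a * ip (hopfRe Y z) (R z)
      - b * ip (du (dv Y) z) (R z) := by
    rw [ip_comm, ip_adjoint, ip_comm (dualN Y z), ip_comm (du Y z), ip_comm (dv Y z), ip_comm (Y z),
      h.swap.LuY hz, h.swap.LuU hz, h.swap.LuV hz, ← ha, ← hb]; ring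
  have rvA : ip (dv R z) (A z) = ip (dv R z) (dualN Y z) - a * ip (du (dv Y) z) (R z)
      + b * ip (hopfRe Y z) (R z) := by
    rw [ip_comm, ip_adjoint, ip_comm (dualN Y z), ip_comm (du Y z), ip_comm (dv Y z), ip_comm (Y z),
      h.swap.LvY hz, h.swap.LvU hz, h.swap.LvV hz, ← ha, ← hb]; ring
  rw [hN.ip_expand (du A z) (du R z), hN.ip_expand (dv A z) (dv R z), hu, hv, guL, gvL, uR, vR,
    h.swap.LuY hz, h.swap.LvY hz, h.swap.LuU hz, h.swap.LuV hz, h.swap.LvU hz, h.swap.LvV hz,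
    ip_comm (A z), hh, h.LuR hz, h.LvR hz] at lR
  have gR : ip (lap A z) (R z) = 2 * (a * ip (du A z) (R z) + b * ip (dv A z) (R z)) := by
    rw [uR, vR]
    linear_combination lR + 2 * ip (hopfRe Y z) (R z) * d0
      + 2 * ip (du (dv Y) z) (R z) * e0 + 2 * a * ruA + 2 * b * rvA
  -- the Laplacian of `L` is a combination of `L`, `R`, `L_u`, `L_v`
  have lapLL : ip (lap L z) (L z) = -2 := hat.HY hz
  have hcomb : lap L z = -(ip (lap L z) (R z) + 2 * ip (du R z) (L z) ^ 2
      + 2 * ip (dv R z) (L z) ^ 2) • L z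
      + (2 : ℝ) • R z + (2 * ip (du R z) (L z)) • du L z + (2 * ip (dv R z) (L z)) • dv L z := by
    refine eq_of_forall_ip_eq fun x => ?_
    -- The test vector is the projection of `x` to the complement of the normal plane.
    have key := h.harmonicEq hz (hE z hz) (x + ip x (R z) • L z + ip x (L z) • R z)
      (by simp only [ip_add_left, ip_smul_left, h.LL z hz, ip_comm (R z), h.LR z hz]; ring)
      (by simp only [ip_add_left, ip_smul_left, h.RR z hz, h.LR z hz]; ring)
    simp only [ip_add_right, ip_smul_right, lapLL, h.LuL hz, h.LvL hz, h.LuR hz, h.LvR hz] at key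
    simp only [ip_add_left, ip_smul_left, ip_comm (L z) x, ip_comm (R z) x]
    linear_combination key
  -- The relation `⟨ΔA, X⟩ = 2(a⟨A_u, X⟩ + b⟨A_v, X⟩)` is now known for `X = L, R, L_u, L_v`, hence
  -- for `X = ΔL`, which is the claim.
  have h1 := hat.eulerLagrange_L hz
  rw [hcomb, hYu, hYv] at h1
  simp only [ip_add_right, ip_smul_right, gL, guL, gvL, gR, gu, gv] at h1
  linarith

/-- The frame of the polar surface has the same orientation as the original one. -/
theorem polar_frameDet (h : IsFrame s Y L R)
    (hP : ∀ z ∈ s, ip (hopfRe Y z) (L z) ^ 2 + ip (du (dv Y) z) (L z) ^ 2 = 1)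
    (hE : ∀ z ∈ s, ip (eulerLagrange Y z) (L z) = 0) (hz : z ∈ s) :
    frameDet L (adjoint Y L) Y z * frameDet Y L R z = 1 := by
  have hat := h.polar hP hE
  have hN := h.nullFrame hz
  have hN' := hat.nullFrame hz
  unfold frameDet
  rw [det_mul_det_eq_det_gram]
  -- The zeros make the unevaluated entries drop out of the determinant, which becomes `P² + Q²`.
  have : (Matrix.of fun i j => ip (![L z, du L z, dv L z, dualN L z, Y z, adjoint Y L z] i)
      (![Y z, du Y z, dv Y z, dualN Y z, R z, L z] j)) =
      !![0, 0, 0, 0, -1, 0;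
        0, -ip (hopfRe Y z) (L z), -ip (du (dv Y) z) (L z), ip (du L z) (dualN Y z),
          ip (du L z) (R z), 0;
        0, -ip (du (dv Y) z) (L z), ip (hopfRe Y z) (L z), ip (dv L z) (dualN Y z),
          ip (dv L z) (R z), 0;
        0, ip (dualN L z) (du Y z), ip (dualN L z) (dv Y z), ip (dualN L z) (dualN Y z),
          ip (dualN L z) (R z), -1;
        0, 0, 0, -1, 0, 0;
        -1, adjU Y L z, adjV Y L z, ip (adjoint Y L z) (dualN Y z), 0, 0] := by
    ext i j
    fin_cases i <;> fin_cases j <;>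
      simp [h.LY z hz, h.LU z hz, h.LV z hz, h.LR z hz, h.LL z hz, h.LuY hz, h.LuU hz, h.LuV hz,
        h.LuL hz, h.LvY hz, h.LvU hz, h.LvV hz, h.LvL hz, hN.YY, hN.YU, hN.YV, hN.YN, hN.YR, hN.YL,
        h.adjoint_Y hz, h.adjoint_U hz, h.adjoint_V hz, h.adjoint_L hz, h.adjoint_R hz, hN'.NR,
        ip_comm (L z) (dualN Y z), hN.NL, ip_comm (dualN L z) (L z), hN'.YN]
  rw [this]
  simp [Matrix.det_succ_row_zero, Fin.sum_univ_succ, Fin.succAbove]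
  linear_combination hP z hz

/-- Two frames of the same surface with the same orientation differ by a rescaling. -/
theorem unique (h : IsFrame s Y L R) {Y' L' R' : ℂ → R62} (h' : IsFrame s Y' L' R') {τ : ℝ}
    (hτ : τ ^ 2 = 1) (hY : ∀ w ∈ s, Y' w = τ • Y w) (hz : z ∈ s)
    (hdet : 0 < frameDet Y L R z * frameDet Y' L' R' z) :
    ∃ c : ℝ, c ≠ 0 ∧ L' z = c • L z ∧ R' z = c⁻¹ • R z := by
  have hs := h.isOpen
  have hτ0 : τ ≠ 0 := by rintro rfl; norm_num at hτ
  have hu : Set.EqOn (du Y') (fun w => τ • du Y w) s := fun w hw => by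
    rw [du_congr_on hs (fun x hx => hY x hx) hw, du_const_smul _ (diff_at hs h.smooth hw)]
  have hv : Set.EqOn (dv Y') (fun w => τ • dv Y w) s := fun w hw => by
    rw [dv_congr_on hs (fun x hx => hY x hx) hw, dv_const_smul _ (diff_at hs h.smooth hw)]
  have hH : lap Y' z = τ • lap Y z := by
    unfold lap
    rw [du_congr_on hs hu hz, dv_congr_on hs hv hz,
      du_const_smul _ (diff_at hs (smooth_du hs h.smooth) hz),
      dv_const_smul _ (diff_at hs (smooth_dv hs h.smooth) hz), smul_add]
  have hNN : dualN Y' z = τ • dualN Y z := by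
    unfold dualN
    rw [hH, hY z hz, ip_smul_left, ip_smul_right,
      show τ * (τ * ip (lap Y z) (lap Y z)) = ip (lap Y z) (lap Y z) by
        linear_combination ip (lap Y z) (lap Y z) * hτ]
    module
  have hN := h.nullFrame hz
  have hN' := h'.nullFrame hz
  rw [hY z hz, hu hz, hv hz, hNN] at hN'
  have cancel : ∀ {x y : R62}, ip (τ • x) y = 0 → ip y x = 0 := fun {x y} hxy => by
    rw [ip_smul_left] at hxy
    rw [ip_comm]; exact (mul_eq_zero.1 hxy).resolve_left hτ0
  have hL1 := cancel hN'.YL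
  have hL2 := cancel hN'.UL
  have hL3 := cancel hN'.VL
  have hL4 := cancel hN'.NL
  have hR1 := cancel hN'.YR
  have hR2 := cancel hN'.UR
  have hR3 := cancel hN'.VR
  have hR4 := cancel hN'.NR
  have eL := hN.expand (L' z)
  have eR := hN.expand (R' z)
  rw [hL1, hL2, hL3, hL4] at eL
  rw [hR1, hR2, hR3, hR4] at eR
  have iLL := hN.ip_expand (L' z) (L' z)
  have iLR := hN.ip_expand (L' z) (R' z)
  have iRR := hN.ip_expand (R' z) (R' z)
  rw [hN'.LL, hL1, hL2, hL3, hL4] at iLL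
  rw [hN'.LR, hL1, hL2, hL3, hL4, hR1, hR2, hR3, hR4] at iLR
  rw [hN'.RR, hR1, hR2, hR3, hR4] at iRR
  -- A Lorentzian plane has only two null lines; the relative orientation, given by a `2 × 2`
  -- determinant, decides which of them contains `L'`.
  have hd : frameDet Y' L' R' z * frameDet Y L R z =
      -(ip (R' z) (R z) * ip (L' z) (L z) - ip (R' z) (L z) * ip (L' z) (R z)) := by
    unfold frameDet
    rw [det_mul_det_eq_det_gram]
    have : (Matrix.of fun i j => ip (![Y' z, du Y' z, dv Y' z, dualN Y' z, R' z, L' z] i)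
        (![Y z, du Y z, dv Y z, dualN Y z, R z, L z] j)) =
        !![0, 0, 0, -τ, 0, 0; 0, τ, 0, 0, 0, 0; 0, 0, τ, 0, 0, 0; -τ, 0, 0, 0, 0, 0;
          0, 0, 0, 0, ip (R' z) (R z), ip (R' z) (L z);
          0, 0, 0, 0, ip (L' z) (R z), ip (L' z) (L z)] := by
      ext i j
      fin_cases i <;> fin_cases j <;>
        simp [hY z hz, hu hz, hv hz, hNN, ip_smul_left, hL1, hL2, hL3, hL4, hR1, hR2, hR3, hR4,
          hN.YY, hN.YU, hN.YV, hN.YN, hN.YL, hN.YR, hN.UU, hN.UV, hN.UN, hN.UL, hN.UR, hN.VV, hN.VN,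
          hN.VL, hN.VR, hN.NN, hN.NL, hN.NR, ip_comm (du Y z) (Y z), ip_comm (dv Y z) (Y z),
          ip_comm (dualN Y z) (Y z), ip_comm (dv Y z) (du Y z), ip_comm (dualN Y z) (du Y z),
          ip_comm (dualN Y z) (dv Y z)]
    rw [this]
    simp [Matrix.det_succ_row_zero, Fin.sum_univ_succ, Fin.succAbove]
    linear_combination (-(τ ^ 2 + 1) * (ip (R' z) (R z) * ip (L' z) (L z)
      - ip (R' z) (L z) * ip (L' z) (R z))) * hτ
  rw [mul_comm, hd] at hdet
  set x := ip (L' z) (L z)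
  set y := ip (L' z) (R z)
  set x' := ip (R' z) (L z)
  set y' := ip (R' z) (R z)
  -- If `L'` had an `R`-component, nullity would put it on the line of `R`, and the orientation
  -- would be reversed.
  have hx : x = 0 := by
    by_contra hx
    have hy : y = 0 := by
      have : x * y = 0 := by linarith
      exact (mul_eq_zero.1 this).resolve_left hx
    rw [hy] at hdet iLR
    nlinarith
  rw [hx] at iLR eL
  have hy : y ≠ 0 := by
    intro hy; rw [hy] at iLR; norm_num at iLR
  have hx' : x' ≠ 0 := by
    intro hx'; rw [hx'] at iLR; norm_num at iLR
  have hy' : y' = 0 := by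
    have : x' * y' = 0 := by linarith
    exact (mul_eq_zero.1 this).resolve_left hx'
  rw [hy'] at eR
  refine ⟨-y, neg_ne_zero.2 hy, ?_, ?_⟩
  · rw [eL]; module
  · have hxy : -x' = (-y)⁻¹ := by
      exact eq_inv_of_mul_eq_one_left (by linarith)
    rw [eR, ← hxy]; module

end IsFrame

/-! ### Complex coordinates -/

theorem contDiffGroupoid_restrictScalars {e : OpenPartialHomeomorph ℂ ℂ}
    (h : e ∈ contDiffGroupoid ω 𝓘(ℂ)) : e ∈ contDiffGroupoid ∞ 𝓘(ℝ, ℂ) := by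
  rw [contDiffGroupoid, mem_groupoid_of_pregroupoid] at h ⊢
  simp only [contDiffPregroupoid, modelWithCornersSelf_coe, modelWithCornersSelf_coe_symm,
    Set.range_id, Set.inter_univ, Function.comp_def, id_eq, Set.preimage_id_eq] at h ⊢
  exact ⟨(h.1.restrict_scalars ℝ).of_le le_top, (h.2.restrict_scalars ℝ).of_le le_top⟩

section

variable {M : Type*} [TopologicalSpace M]

/-- The domain of the transition map from the coordinate `e` to the coordinate `c`. -/
def overlap (e c : OpenPartialHomeomorph M ℂ) : Set ℂ := e.target ∩ e.symm ⁻¹' c.source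

/-- The transition map from the coordinate `e` to the coordinate `c`. -/
def transition (e c : OpenPartialHomeomorph M ℂ) (z : ℂ) : ℂ := c (e.symm z)

variable {e c : OpenPartialHomeomorph M ℂ}

theorem isOpen_overlap (e c : OpenPartialHomeomorph M ℂ) : IsOpen (overlap e c) :=
  e.symm.isOpen_inter_preimage c.open_source

theorem symm_transition {z : ℂ} (hz : z ∈ overlap e c) : c.symm (transition e c z) = e.symm z :=
  c.left_inv hz.2

theorem transition_mem {z : ℂ} (hz : z ∈ overlap e c) : transition e c z ∈ overlap c e :=
  ⟨c.map_source hz.2, by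
    rw [Set.mem_preimage, symm_transition hz]; exact e.map_target hz.1⟩

theorem transition_transition {z : ℂ} (hz : z ∈ overlap e c) :
    transition c e (transition e c z) = z := by
  rw [transition, symm_transition hz, e.right_inv hz.1]

theorem injOn_transition (e c : OpenPartialHomeomorph M ℂ) :
    Set.InjOn (transition e c) (overlap e c) := fun z hz w hw h => by
  rw [← transition_transition hz, h, transition_transition hw]

variable [ChartedSpace ℂ M]

/-- A Riemann surface is a smooth real manifold. -/
theorem isManifold_real [IsManifold 𝓘(ℂ) ω M] : IsManifold 𝓘(ℝ, ℂ) ∞ M :=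
  { compatible := fun he he' =>
      contDiffGroupoid_restrictScalars ((contDiffGroupoid ω 𝓘(ℂ)).compatible he he') }

theorem isCoord_chartAt [IsManifold 𝓘(ℂ) ω M] (p : M) : IsCoord (chartAt ℂ p) :=
  IsManifold.chart_mem_maximalAtlas p

theorem IsCoord.mem_real {e : OpenPartialHomeomorph M ℂ} (he : IsCoord e) :
    e ∈ IsManifold.maximalAtlas 𝓘(ℝ, ℂ) ∞ M := fun e' he' =>
  ⟨contDiffGroupoid_restrictScalars (he e' he').1, contDiffGroupoid_restrictScalars (he e' he').2⟩

theorem differentiableOn_transition [IsManifold 𝓘(ℂ) ω M] (he : IsCoord e) (hc : IsCoord c) :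
    DifferentiableOn ℂ (transition e c) (overlap e c) := by
  have h := StructureGroupoid.compatible_of_mem_maximalAtlas he hc
  rw [contDiffGroupoid, mem_groupoid_of_pregroupoid] at h
  simp only [contDiffPregroupoid, modelWithCornersSelf_coe, modelWithCornersSelf_coe_symm,
    Set.range_id, Set.inter_univ, Function.comp_def, id_eq, Set.preimage_id_eq] at h
  have h1 := h.1.differentiableOn (by simp)
  rw [OpenPartialHomeomorph.trans_source] at h1
  exact h1

theorem smooth_transition [IsManifold 𝓘(ℂ) ω M] (he : IsCoord e) (hc : IsCoord c) :
    ContDiffOn ℝ ∞ (transition e c) (overlap e c) :=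
  ((differentiableOn_transition he hc).contDiffOn (isOpen_overlap e c)).restrict_scalars ℝ

theorem hasDerivAt_transition [IsManifold 𝓘(ℂ) ω M] (he : IsCoord e) (hc : IsCoord c) {z : ℂ}
    (hz : z ∈ overlap e c) : HasDerivAt (transition e c) (deriv (transition e c) z) z :=
  ((differentiableOn_transition he hc).differentiableAt
    ((isOpen_overlap e c).mem_nhds hz)).hasDerivAt

theorem deriv_transition_ne_zero [IsManifold 𝓘(ℂ) ω M] (he : IsCoord e) (hc : IsCoord c) {z : ℂ}
    (hz : z ∈ overlap e c) : deriv (transition e c) z ≠ 0 := fun h0 => by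
  have h1 := hasDerivAt_transition hc he (transition_mem hz)
  have h2 := h1.comp z (hasDerivAt_transition he hc hz)
  have h3 : HasDerivAt (transition c e ∘ transition e c) 1 z :=
    (hasDerivAt_id z).congr_of_eventuallyEq (by
      filter_upwards [(isOpen_overlap e c).mem_nhds hz] with w hw
      exact transition_transition hw)
  have := h2.unique h3
  rw [h0, mul_zero] at this
  exact zero_ne_one this

theorem smooth_deriv_transition [IsManifold 𝓘(ℂ) ω M] (he : IsCoord e) (hc : IsCoord c) :
    ContDiffOn ℝ ∞ (deriv (transition e c)) (overlap e c) :=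
  (((differentiableOn_transition he hc).deriv (isOpen_overlap e c)).contDiffOn
    (isOpen_overlap e c)).restrict_scalars ℝ

/-! ### Smoothness in coordinates -/

section
variable [IsManifold 𝓘(ℂ) ω M]

variable {F : Type*} [NormedAddCommGroup F] [NormedSpace ℝ F]

theorem contMDiffAt_iff_coord (he : IsCoord e) {p : M} (hp : p ∈ e.source) {g : M → F} :
    ContMDiffAt 𝓘(ℝ, ℂ) 𝓘(ℝ, F) ∞ g p ↔ ContDiffAt ℝ ∞ (fun w => g (e.symm w)) (e p) := by
  have := isManifold_real (M := M)
  constructor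
  · intro h
    rw [← contMDiffAt_iff_contDiffAt]
    have h1 := contMDiffAt_symm_of_mem_maximalAtlas he.mem_real (e.map_source hp)
    exact ContMDiffAt.comp (e p) (by rwa [e.left_inv hp]) h1
  · intro h
    rw [← contMDiffAt_iff_contDiffAt] at h
    have h1 := contMDiffAt_of_mem_maximalAtlas he.mem_real hp
    refine (ContMDiffAt.comp p h h1).congr_of_eventuallyEq ?_
    filter_upwards [e.open_source.mem_nhds hp] with q hq
    simp [e.left_inv hq]

theorem contMDiffAt_prod_iff_coord (he : IsCoord e) {t : ℝ} {p : M} (hp : p ∈ e.source)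
    {g : ℝ × M → F} :
    ContMDiffAt (𝓘(ℝ, ℝ).prod 𝓘(ℝ, ℂ)) 𝓘(ℝ, F) ∞ g (t, p) ↔
      ContDiffAt ℝ ∞ (fun q : ℝ × ℂ => g (q.1, e.symm q.2)) (t, e p) := by
  have := isManifold_real (M := M)
  constructor
  · intro h
    rw [← contMDiffAt_iff_contDiffAt]
    have h1 := contMDiffAt_symm_of_mem_maximalAtlas he.mem_real (e.map_source hp)
    have h2 : ContMDiffAt 𝓘(ℝ, ℝ × ℂ) (𝓘(ℝ, ℝ).prod 𝓘(ℝ, ℂ)) ∞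
        (fun q : ℝ × ℂ => (q.1, e.symm q.2)) (t, e p) :=
      contDiffAt_fst.contMDiffAt.prodMk
        (ContMDiffAt.comp (t, e p) (g := e.symm) h1 contDiffAt_snd.contMDiffAt)
    exact ContMDiffAt.comp (t, e p) (by simpa [e.left_inv hp] using h) h2
  · intro h
    rw [← contMDiffAt_iff_contDiffAt] at h
    have h1 := contMDiffAt_of_mem_maximalAtlas he.mem_real hp
    have h2 : ContMDiffAt (𝓘(ℝ, ℝ).prod 𝓘(ℝ, ℂ)) 𝓘(ℝ, ℝ × ℂ) ∞
        (fun q : ℝ × M => (q.1, e q.2)) (t, p) :=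
      contMDiffAt_fst.prodMk_space (ContMDiffAt.comp (t, p) (g := e) h1 contMDiffAt_snd)
    refine (ContMDiffAt.comp (t, p) h h2).congr_of_eventuallyEq ?_
    filter_upwards [(e.open_source.preimage continuous_snd).mem_nhds
      (show (t, p) ∈ Prod.snd ⁻¹' e.source from hp)] with q hq
    simp [e.left_inv hq]

end
end

/-! ### Smooth maps into the quadric and their lifts -/

section MapsToQuadric

variable {X : Type*} [NormedAddCommGroup X] [NormedSpace ℝ X]

/-- Smoothness at a point of a map from a normed space to the quadric. -/
def SmoothMapAt (q : X → Q41) (x : X) : Prop :=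
  ContDiffAt ℝ ∞ (fun x' => affineRep (q x) (q x')) x

theorem SmoothMapAt.eventually_represents {q : X → Q41} {x : X} (hq : SmoothMapAt q x) :
    ∀ᶠ x' in nhds x, Represents (affineRep (q x) (q x')) (q x') := by
  have h0 : affineRep (q x) (q x) ≠ 0 := (affineRep_self_represents (q x)).ne_zero
  filter_upwards [hq.continuousAt.eventually_ne h0] with x' hx'
  exact affineRep_represents (affineRep_ne_zero_iff.1 hx')

theorem contDiffAt_dotProduct {f g : X → R62} {x : X} (hf : ContDiffAt ℝ ∞ f x)
    (hg : ContDiffAt ℝ ∞ g x) : ContDiffAt ℝ ∞ (fun x => f x ⬝ᵥ g x) x := by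
  unfold dotProduct
  exact ContDiffAt.sum fun i _ => ((contDiffAt_pi.1 hf) i).mul ((contDiffAt_pi.1 hg) i)

/-- The affine representative is the lift divided by a linear functional that does not vanish at the
point. -/
theorem smoothMapAt_of_lift {q : X → Q41} {v : X → R62} {x : X} (hv : ContDiffAt ℝ ∞ v x)
    (h : ∀ᶠ x' in nhds x, Represents (v x') (q x')) : SmoothMapAt q x := by
  have h0 : (q x).1.rep ⬝ᵥ v x ≠ 0 := by
    obtain ⟨c, hc, hcv⟩ := (represents_rep (q x)).exists_smul h.self_of_nhds
    rw [hcv, dotProduct_smul, smul_eq_mul]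
    exact mul_ne_zero hc (dotProduct_rep_self_ne_zero _)
  have h1 : ContDiffAt ℝ ∞ (fun x' => ((q x).1.rep ⬝ᵥ v x')⁻¹ • v x') x :=
    ((contDiffAt_dotProduct contDiffAt_const hv).inv h0).smul hv
  refine h1.congr_of_eventuallyEq ?_
  filter_upwards [h] with w hw
  exact affineRep_eq hw _

/-- The homogeneous coordinate vector of `q` whose Euclidean product with `a` is that of `a`
with itself. -/
def projLift (a : R62) (q : Q41) : R62 := (a ⬝ᵥ a / (a ⬝ᵥ q.1.rep)) • q.1.rep

theorem projLift_eq {v : R62} {q : Q41} (h : Represents v q) (a : R62) :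
    projLift a q = (a ⬝ᵥ a / (a ⬝ᵥ v)) • v := by
  obtain ⟨c, hc, rfl⟩ := (represents_rep q).exists_smul h
  rw [projLift, dotProduct_smul, smul_smul, smul_eq_mul]
  congr 1
  field_simp

theorem dotProduct_self_ne_zero {a : R62} (ha : a ≠ 0) : a ⬝ᵥ a ≠ 0 := by
  rwa [Ne, dotProduct_self_eq_zero]

/-- The numerator `a ⬝ᵥ a` in `projLift` is chosen for this: normalizing against a given lift
reproduces it exactly, so a lift of the surface extends to a lift of its variations. -/
theorem projLift_self {v : R62} {q : Q41} (h : Represents v q) : projLift v q = v := by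
  rw [projLift_eq h, div_self (dotProduct_self_ne_zero h.ne_zero), one_smul]

theorem projLift_represents {a : R62} {q : Q41} (ha : a ⬝ᵥ q.1.rep ≠ 0) :
    Represents (projLift a q) q := by
  have h0 : a ≠ 0 := by rintro rfl; simp at ha
  exact (represents_rep q).smul (div_ne_zero (dotProduct_self_ne_zero h0) ha)

theorem dotProduct_rep_ne_zero {v : R62} {q : Q41} (h : Represents v q) {a : R62} :
    a ⬝ᵥ q.1.rep ≠ 0 ↔ a ⬝ᵥ v ≠ 0 := by
  obtain ⟨c, hc, rfl⟩ := (represents_rep q).exists_smul h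
  rw [dotProduct_smul, smul_eq_mul, mul_ne_zero_iff]
  tauto

theorem SmoothMapAt.eventually_dotProduct {q : X → Q41} {a : X → R62} {x : X}
    (hq : SmoothMapAt q x) (ha : ContDiffAt ℝ ∞ a x) (h0 : a x ⬝ᵥ (q x).1.rep ≠ 0) :
    ∀ᶠ x' in nhds x, a x' ⬝ᵥ (q x').1.rep ≠ 0 := by
  have h1 := (dotProduct_rep_ne_zero (affineRep_self_represents (q x))).1 h0
  filter_upwards [hq.eventually_represents,
    (contDiffAt_dotProduct ha hq).continuousAt.eventually_ne h1] with x' hx' hx''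
  exact (dotProduct_rep_ne_zero hx').2 hx''

theorem SmoothMapAt.projLift {q : X → Q41} {a : X → R62} {x : X} (hq : SmoothMapAt q x)
    (ha : ContDiffAt ℝ ∞ a x) (h0 : a x ⬝ᵥ (q x).1.rep ≠ 0) :
    ContDiffAt ℝ ∞ (fun x' => projLift (a x') (q x')) x := by
  have h1 := (dotProduct_rep_ne_zero (affineRep_self_represents (q x))).1 h0
  have h2 : ContDiffAt ℝ ∞ (fun x' => (a x' ⬝ᵥ a x' / (a x' ⬝ᵥ affineRep (q x) (q x')))
      • affineRep (q x) (q x')) x :=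
    ((contDiffAt_dotProduct ha ha).div (contDiffAt_dotProduct ha hq) h1).smul hq
  refine h2.congr_of_eventuallyEq ?_
  filter_upwards [hq.eventually_represents] with x' hx'
  exact projLift_eq hx' _

end MapsToQuadric

/-! ### Local lifts -/

section Lifts

variable {M : Type*} [TopologicalSpace M] [ChartedSpace ℂ M] {e c : OpenPartialHomeomorph M ℂ}
  {y : M → Q41} {s s' : Set ℂ} {Y Y' : ℂ → R62}

theorem smoothAt_iff [IsManifold 𝓘(ℂ) ω M] (he : IsCoord e) {p : M} (hp : p ∈ e.source) :
    SmoothAt y p ↔ SmoothMapAt (fun w => y (e.symm w)) (e p) := by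
  rw [SmoothAt, contMDiffAt_iff_coord he hp, SmoothMapAt, e.left_inv hp]

namespace IsLocalLift

theorem mono (h : IsLocalLift y e s Y) {t : Set ℂ} (ht : IsOpen t) (hts : t ⊆ s) :
    IsLocalLift y e t Y :=
  ⟨h.coord, ht, hts.trans h.subset, h.smooth.mono hts, fun z hz => h.lift z (hts hz)⟩

theorem null (h : IsLocalLift y e s Y) : ∀ z ∈ s, ip (Y z) (Y z) = 0 := fun z hz =>
  (h.lift z hz).ip_self

theorem ne_zero (h : IsLocalLift y e s Y) {z : ℂ} (hz : z ∈ s) : Y z ≠ 0 := (h.lift z hz).ne_zero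

theorem smoothAt [IsManifold 𝓘(ℂ) ω M] (h : IsLocalLift y e s Y) {z : ℂ} (hz : z ∈ s) :
    SmoothAt y (e.symm z) := by
  have hz' := h.subset hz
  rw [smoothAt_iff h.coord (e.map_target hz'), e.right_inv hz']
  exact smoothMapAt_of_lift (smooth_at h.isOpen h.smooth hz)
    (Filter.eventually_of_mem (h.isOpen.mem_nhds hz) h.lift)

/-- Two lifts of a surface differ by a smooth factor. -/
theorem exists_factor (h : IsLocalLift y e s Y) (h' : IsLocalLift y e s' Y') :
    ∃ ρ : ℂ → ℝ, ContDiffOn ℝ ∞ ρ (s ∩ s') ∧ ∀ z ∈ s ∩ s', ρ z ≠ 0 ∧ Y' z = ρ z • Y z := by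
  refine ⟨fun z => (Y z ⬝ᵥ Y' z) / (Y z ⬝ᵥ Y z), fun z hz => ?_, fun z hz => ?_⟩
  · have h1 := smooth_at h.isOpen h.smooth hz.1
    have h2 := smooth_at h'.isOpen h'.smooth hz.2
    exact ((contDiffAt_dotProduct h1 h2).div (contDiffAt_dotProduct h1 h1)
      (dotProduct_self_ne_zero (h.ne_zero hz.1))).contDiffWithinAt
  · obtain ⟨r, hr, hY⟩ := (h.lift z hz.1).exists_smul (h'.lift z hz.2)
    have h0 := dotProduct_self_ne_zero (h.ne_zero hz.1)
    have : (Y z ⬝ᵥ Y' z) / (Y z ⬝ᵥ Y z) = r := by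
      rw [hY, dotProduct_smul, smul_eq_mul]; field_simp
    simp only [this]
    exact ⟨hr, hY⟩

/-- Rescaling of lifts. -/
theorem smul (h : IsLocalLift y e s Y) {ρ : ℂ → ℝ} (hρ : ContDiffOn ℝ ∞ ρ s)
    (h0 : ∀ z ∈ s, ρ z ≠ 0) : IsLocalLift y e s (fun z => ρ z • Y z) :=
  ⟨h.coord, h.isOpen, h.subset, hρ.smul h.smooth, fun z hz => (h.lift z hz).smul (h0 z hz)⟩

/-- Change of coordinates in a lift. -/
theorem comp [IsManifold 𝓘(ℂ) ω M] (h : IsLocalLift y c s Y) (he : IsCoord e) :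
    IsLocalLift y e (overlap e c ∩ transition e c ⁻¹' s) (fun w => Y (transition e c w)) := by
  have ho := (smooth_transition he h.coord).continuousOn.isOpen_inter_preimage
    (isOpen_overlap e c) h.isOpen
  refine ⟨he, ho, fun z hz => hz.1.1, h.smooth.comp
    ((smooth_transition he h.coord).mono fun z hz => hz.1) fun z hz => hz.2, fun z hz => ?_⟩
  rw [← symm_transition hz.1]
  exact h.lift _ hz.2

end IsLocalLift

/-- A smooth surface has local lifts in every coordinate. -/
theorem exists_localLift [IsManifold 𝓘(ℂ) ω M] {U : Set M} (hU : IsOpen U)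
    (hy : ∀ p ∈ U, SmoothAt y p) (he : IsCoord e) {p : M} (hp : p ∈ U) (hpe : p ∈ e.source) :
    ∃ s Y, IsLocalLift y e s Y ∧ e p ∈ s ∧ ∀ z ∈ s, e.symm z ∈ U := by
  -- One fixed vector `a` normalizes the lift on the open set where the representatives are not
  -- Euclidean-orthogonal to it.
  set a : R62 := (y p).1.rep
  set O : Set ℂ := e.target ∩ e.symm ⁻¹' U
  have hO : IsOpen O := e.symm.isOpen_inter_preimage hU
  have hq : ∀ z ∈ O, SmoothMapAt (fun w => y (e.symm w)) z := fun z hz => by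
    have := (smoothAt_iff he (e.map_target hz.1)).1 (hy _ hz.2)
    rwa [e.right_inv hz.1] at this
  refine ⟨{z | z ∈ O ∧ a ⬝ᵥ (y (e.symm z)).1.rep ≠ 0}, fun z => projLift a (y (e.symm z)),
    ⟨he, ?_, fun z hz => hz.1.1, fun z hz => ?_, fun z hz => projLift_represents hz.2⟩, ?_,
    fun z hz => hz.1.2⟩
  · rw [isOpen_iff_mem_nhds]
    intro z hz
    filter_upwards [hO.mem_nhds hz.1, (hq z hz.1).eventually_dotProduct contDiffAt_const hz.2]
      with w h1 h2 using ⟨h1, h2⟩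
  · exact ((hq z hz.1).projLift contDiffAt_const hz.2).contDiffWithinAt
  · refine ⟨⟨e.map_source hpe, ?_⟩, ?_⟩
    · rw [Set.mem_preimage, e.left_inv hpe]; exact hp
    · rw [e.left_inv hpe]; exact dotProduct_rep_self_ne_zero _

/-! ### The conformality relations in real form -/

theorem toC_add (x y : R62) : toC (x + y) = toC x + toC y := by
  ext i; simp [toC]

theorem toC_smul (a : ℝ) (x : R62) : toC (a • x) = (a : ℂ) • toC x := by
  ext i; simp [toC]

theorem ipC_toC (x y : R62) : ipC (toC x) (toC y) = (ip x y : ℂ) := by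
  simp [ipC, ip, toC]

/-- `toC` as a continuous linear map. -/
def toCL : R62 →L[ℝ] C62 :=
  LinearMap.toContinuousLinearMap
    { toFun := toC, map_add' := toC_add, map_smul' := fun a x => by rw [toC_smul]; rfl }

theorem fderiv_toC {Y : ℂ → R62} {z : ℂ} (h : DifferentiableAt ℝ Y z) (a : ℂ) :
    fderiv ℝ (fun w => toC (Y w)) z a = toC (fderiv ℝ Y z a) := by
  have := (toCL.hasFDerivAt.comp z h.hasFDerivAt).fderiv
  change fderiv ℝ (toCL ∘ Y) z a = _
  rw [this]; rfl

theorem ipC_add_left (x y z : C62) : ipC (x + y) z = ipC x z + ipC y z := by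
  simp only [ipC, Pi.add_apply, mul_add, add_mul, Finset.sum_add_distrib]

theorem ipC_smul_left (a : ℂ) (x z : C62) : ipC (a • x) z = a * ipC x z := by
  simp only [ipC, Pi.smul_apply, smul_eq_mul, Finset.mul_sum]
  exact Finset.sum_congr rfl fun _ _ => by ring

theorem ipC_comm (x y : C62) : ipC x y = ipC y x := by
  unfold ipC; exact Finset.sum_congr rfl fun _ _ => by ring

theorem ipC_add_right (x y z : C62) : ipC x (y + z) = ipC x y + ipC x z := by
  rw [ipC_comm, ipC_add_left, ipC_comm y, ipC_comm z]

theorem ipC_smul_right (a : ℂ) (x z : C62) : ipC x (a • z) = a * ipC x z := by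
  rw [ipC_comm, ipC_smul_left, ipC_comm]

theorem conformal_iff {Y : ℂ → R62} {z : ℂ} (h : DifferentiableAt ℝ Y z) :
    (ipC (dz (fun w => toC (Y w)) z) (dz (fun w => toC (Y w)) z) = 0 ∧
      0 < (ipC (dz (fun w => toC (Y w)) z) (dzbar (fun w => toC (Y w)) z)).re) ↔
    ip (du Y z) (du Y z) = ip (dv Y z) (dv Y z) ∧ ip (du Y z) (dv Y z) = 0 ∧
      0 < ip (du Y z) (du Y z) := by
  have hu : du (fun w => toC (Y w)) z = toC (du Y z) := fderiv_toC h 1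
  have hv : dv (fun w => toC (Y w)) z = toC (dv Y z) := fderiv_toC h Complex.I
  have h1 : ipC (dz (fun w => toC (Y w)) z) (dz (fun w => toC (Y w)) z) =
      (((ip (du Y z) (du Y z) - ip (dv Y z) (dv Y z)) / 4 : ℝ) : ℂ)
        + ((-(ip (du Y z) (dv Y z)) / 2 : ℝ) : ℂ) * Complex.I := by
    simp only [dz, hu, hv, sub_eq_add_neg, ← neg_smul, ipC_smul_left, ipC_smul_right, ipC_add_left,
      ipC_add_right, ipC_toC, ip_comm (dv Y z) (du Y z)]
    push_cast
    linear_combination (1 / 4 * (ip (dv Y z) (dv Y z) : ℂ)) * Complex.I_sq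
  have h2 : ipC (dz (fun w => toC (Y w)) z) (dzbar (fun w => toC (Y w)) z) =
      (((ip (du Y z) (du Y z) + ip (dv Y z) (dv Y z)) / 4 : ℝ) : ℂ) := by
    simp only [dz, dzbar, hu, hv, sub_eq_add_neg, ← neg_smul, ipC_smul_left, ipC_smul_right,
      ipC_add_left, ipC_add_right, ipC_toC, ip_comm (dv Y z) (du Y z)]
    push_cast
    linear_combination (-1 / 4 * (ip (dv Y z) (dv Y z) : ℂ)) * Complex.I_sq
  rw [h1, h2, Complex.ofReal_re, Complex.ext_iff]
  simp only [Complex.add_re, Complex.ofReal_re, Complex.mul_re, Complex.I_re, mul_zero,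
    Complex.ofReal_im, Complex.I_im, mul_one, sub_self, add_zero, Complex.zero_re, Complex.add_im,
    Complex.mul_im, zero_add, Complex.zero_im]
  constructor
  · rintro ⟨⟨h3, h4⟩, h5⟩; refine ⟨by linarith, by linarith, by linarith⟩
  · rintro ⟨h3, h4, h5⟩; refine ⟨⟨by linarith, by linarith⟩, by linarith⟩

theorem IsConformalSpacelikeOn.metric {U : Set M} (h : IsConformalSpacelikeOn y U)
    (hY : IsLocalLift y e s Y) {z : ℂ} (hz : z ∈ s) (hU : e.symm z ∈ U) :
    ip (du Y z) (du Y z) = ip (dv Y z) (dv Y z) ∧ ip (du Y z) (dv Y z) = 0 ∧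
      0 < ip (du Y z) (du Y z) :=
  (conformal_iff (diff_at hY.isOpen hY.smooth hz)).1 (h.conformal e s Y hY z hz hU)

end Lifts

/-! ### Lifts of variations and the derivative of the Willmore integrand -/

section FamilyLifts

variable {M : Type*} [TopologicalSpace M] [ChartedSpace ℂ M] {e c : OpenPartialHomeomorph M ℂ}
  {y : M → Q41} {U K : Set M} {f : ℝ → M → Q41} {O : Set (ℝ × ℂ)} {F : ℝ × ℂ → R62}
  {s : Set ℂ} {Y : ℂ → R62} {z : ℂ}

/-- `F` is a smooth lift of the family `f` of surfaces over the open set `O` of values of the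
time and the coordinate `e`. -/
structure IsFamilyLift (e : OpenPartialHomeomorph M ℂ) (f : ℝ → M → Q41) (O : Set (ℝ × ℂ))
    (F : ℝ × ℂ → R62) : Prop where
  coord : IsCoord e
  isOpen : IsOpen O
  subset : ∀ q ∈ O, q.2 ∈ e.target
  smooth : ContDiffOn ℝ ∞ F O
  lift : ∀ q ∈ O, Represents (F q) (f q.1 (e.symm q.2))

theorem IsVariation.smoothMapAt [IsManifold 𝓘(ℂ) ω M] (hf : IsVariation y U K f) (he : IsCoord e) :
    ∃ ε > 0, ∀ t, |t| < ε → ∀ z ∈ e.target, e.symm z ∈ U →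
      SmoothMapAt (fun q : ℝ × ℂ => f q.1 (e.symm q.2)) (t, z) := by
  obtain ⟨ε, hε, h⟩ := hf.smooth
  refine ⟨ε, hε, fun t ht z hz hU => ?_⟩
  have := (contMDiffAt_prod_iff_coord he (e.map_target hz)).1 (h t ht _ hU)
  rwa [e.right_inv hz] at this

/-- A lift of a surface extends to a lift of its variations. -/
theorem IsVariation.exists_familyLift [IsManifold 𝓘(ℂ) ω M] (hf : IsVariation y U K f)
    (hY : IsLocalLift y e s Y) (hs : ∀ z ∈ s, e.symm z ∈ U) :
    ∃ O F, IsFamilyLift e f O F ∧ (∀ q ∈ O, q.2 ∈ s) ∧ (∀ z ∈ s, (0, z) ∈ O ∧ F (0, z) = Y z) ∧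
      ∀ t, ∀ z ∈ s, e.symm z ∉ K → F (t, z) = Y z := by
  obtain ⟨ε, hε, hsm⟩ := hf.smoothMapAt hY.coord
  -- The family is normalized against the moving vector `Y`. It thus starts at `Y` and is constantly
  -- equal to `Y` wherever the variation does nothing.
  set O : Set (ℝ × ℂ) := {q | |q.1| < ε ∧ q.2 ∈ s ∧ Y q.2 ⬝ᵥ (f q.1 (e.symm q.2)).1.rep ≠ 0}
  have hq : ∀ q ∈ O, SmoothMapAt (fun q : ℝ × ℂ => f q.1 (e.symm q.2)) q := fun q hq =>
    hsm q.1 hq.1 q.2 (hY.subset hq.2.1) (hs _ hq.2.1)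
  have ha : ∀ q ∈ O, ContDiffAt ℝ ∞ (fun q : ℝ × ℂ => Y q.2) q := fun q hq =>
    ContDiffAt.comp q (smooth_at hY.isOpen hY.smooth hq.2.1) contDiffAt_snd
  refine ⟨O, fun q => projLift (Y q.2) (f q.1 (e.symm q.2)), ⟨hY.coord, ?_, fun q hq =>
    hY.subset hq.2.1, fun q hqO => ?_, fun q hqO => projLift_represents hqO.2.2⟩,
    fun q hq => hq.2.1, fun z hz => ?_, fun t z hz hK => ?_⟩
  · rw [isOpen_iff_mem_nhds]
    intro q hqO
    have h1 : {q : ℝ × ℂ | |q.1| < ε} ∈ nhds q :=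
      (isOpen_lt (by fun_prop) (by fun_prop)).mem_nhds hqO.1
    have h2 : Prod.snd ⁻¹' s ∈ nhds q := (hY.isOpen.preimage continuous_snd).mem_nhds hqO.2.1
    filter_upwards [h1, h2, (hq q hqO).eventually_dotProduct (ha q hqO) hqO.2.2]
      with x h1 h2 h3 using ⟨h1, h2, h3⟩
  · exact ((hq q hqO).projLift (ha q hqO) hqO.2.2).contDiffWithinAt
  · have h0 : f 0 (e.symm z) = y (e.symm z) := by rw [hf.start]
    refine ⟨⟨by simpa using hε, hz, ?_⟩, ?_⟩
    · rw [h0, dotProduct_rep_ne_zero (hY.lift z hz)]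
      exact dotProduct_self_ne_zero (hY.ne_zero hz)
    · simp only [h0]; exact projLift_self (hY.lift z hz)
  · simp only [hf.fixed t _ hK]; exact projLift_self (hY.lift z hz)

theorem IsFamilyLift.slice (h : IsFamilyLift e f O F) (t : ℝ) :
    IsLocalLift (f t) e {w | (t, w) ∈ O} (fun w => F (t, w)) :=
  ⟨h.coord, isOpen_slice h.isOpen t, fun _ hw => h.subset _ hw, smooth_slice h.smooth t,
    fun _ hw => h.lift _ hw⟩

/-- The Willmore integrand can be computed with any lift. -/
theorem IsLocalLift.willmoreDensity_eq (h : IsLocalLift y e s Y) (hz : z ∈ s)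
    (hE : 0 < ip (du Y z) (du Y z)) (hD : 0 < gramDet (du Y z) (dv Y z)) :
    willmoreDensity e y z = jetWillmore (jet Y z) := by
  set a : R62 := (y (e.symm z)).1.rep
  set s' : Set ℂ := {w | w ∈ s ∧ a ⬝ᵥ Y w ≠ 0}
  have hc : ∀ w ∈ s, ContDiffAt ℝ ∞ (fun w => a ⬝ᵥ Y w) w := fun w hw =>
    contDiffAt_dotProduct contDiffAt_const (smooth_at h.isOpen h.smooth hw)
  have hs' : IsOpen s' := by
    rw [isOpen_iff_mem_nhds]
    intro w hw
    filter_upwards [h.isOpen.mem_nhds hw.1, (hc w hw.1).continuousAt.eventually_ne hw.2]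
      with x h1 h2 using ⟨h1, h2⟩
  have hzs' : z ∈ s' := ⟨hz, (dotProduct_rep_ne_zero (h.lift z hz)).1
    (dotProduct_rep_self_ne_zero _)⟩
  have hsub : s' ⊆ s := fun w hw => hw.1
  -- The factor relating `Y` to the affine representative from which the density is defined.
  set ρ : ℂ → ℝ := fun w => (a ⬝ᵥ Y w)⁻¹
  have hρ : ContDiffOn ℝ ∞ ρ s' := fun w hw => ((hc w hw.1).inv hw.2).contDiffWithinAt
  have hρ0 : ρ z ≠ 0 := inv_ne_zero hzs'.2
  have hY' := h.smooth.mono hsub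
  have hn : ∀ w ∈ s', ip (Y w) (Y w) = 0 := fun w hw => h.null w hw.1
  have hA : Set.EqOn (fun w => affineRep (y (e.symm z)) (y (e.symm w))) (fun w => ρ w • Y w) s' :=
    fun w hw => affineRep_eq (h.lift w hw.1) _
  have hu := du_congr_on hs' hA hzs'
  have hv := dv_congr_on hs' hA hzs'
  have hm := ip_fderiv_smul hs' hY' hn hρ hzs'
  have hρY : ContDiffOn ℝ ∞ (fun w => ρ w • Y w) s' := hρ.smul hY'
  rw [willmoreDensity, willmoreIntegrand_eq_jetWillmore hs' (hρY.congr hA) _ hzs', ← 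
    jetWillmore_smul hs' hY' hn hρ hzs' hρ0 hD]
  · unfold jet
    rw [hu, hv, du_congr_on hs' (fun w hw => du_congr_on hs' hA hw) hzs',
      du_congr_on hs' (fun w hw => dv_congr_on hs' hA hw) hzs',
      dv_congr_on hs' (fun w hw => dv_congr_on hs' hA hw) hzs']
  · rw [hu, hm.1]; positivity
  · rw [hu, hv, gramDet_smul hs' hY' hn hρ hzs']; positivity
  · intro w hw
    simp only [hA hw, ip_smul_left, ip_smul_right, hn w hw, mul_zero]

/-- The family is spacelike near a point where its initial surface is. -/
theorem IsFamilyLift.eventually_spacelike (h : IsFamilyLift e f O F) (hz : (0, z) ∈ O)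
    (hE : 0 < ip (du (fun w => F (0, w)) z) (du (fun w => F (0, w)) z))
    (hD : 0 < gramDet (du (fun w => F (0, w)) z) (dv (fun w => F (0, w)) z)) :
    ∀ᶠ q in nhds ((0 : ℝ), z), q ∈ O ∧
      0 < gramDet (familyJet F q).1 (familyJet F q).2.1 ∧
      willmoreDensity e (f q.1) q.2 = jetWillmore (familyJet F q) := by
  have h1 : ContDiffAt ℝ ∞ (dirDeriv (0, 1) F) (0, z) :=
    (smooth_dirDeriv h.isOpen h.smooth _).contDiffAt (h.isOpen.mem_nhds hz)
  have h2 : ContDiffAt ℝ ∞ (dirDeriv (0, Complex.I) F) (0, z) :=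
    (smooth_dirDeriv h.isOpen h.smooth _).contDiffAt (h.isOpen.mem_nhds hz)
  have hu : ∀ q ∈ O, du (fun w => F (q.1, w)) q.2 = dirDeriv (0, 1) F q := fun q hq =>
    du_slice h.isOpen h.smooth hq
  have hv : ∀ q ∈ O, dv (fun w => F (q.1, w)) q.2 = dirDeriv (0, Complex.I) F q := fun q hq =>
    dv_slice h.isOpen h.smooth hq
  have hu0 := hu _ hz
  have hv0 := hv _ hz
  simp only at hu0 hv0
  rw [hu0] at hE
  rw [hu0, hv0] at hD
  filter_upwards [h.isOpen.mem_nhds hz,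
    (contDiffAt_ip h1 h1).continuousAt.eventually (lt_mem_nhds hE),
    (contDiffAt_gramDet h1 h2).continuousAt.eventually (lt_mem_nhds hD)] with q hq hqE hqD
  refine ⟨hq, hqD, ?_⟩
  rw [← jet_slice h.isOpen h.smooth hq]
  refine (h.slice q.1).willmoreDensity_eq hq ?_ ?_
  · rw [hu q hq]; exact hqE
  · rw [hu q hq, hv q hq]; exact hqD

theorem IsFamilyLift.contDiffAt_density (h : IsFamilyLift e f O F) (hz : (0, z) ∈ O)
    (hE : 0 < ip (du (fun w => F (0, w)) z) (du (fun w => F (0, w)) z))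
    (hD : 0 < gramDet (du (fun w => F (0, w)) z) (dv (fun w => F (0, w)) z)) :
    ContDiffAt ℝ ∞ (fun q : ℝ × ℂ => willmoreDensity e (f q.1) q.2) (0, z) := by
  have hev := h.eventually_spacelike hz hE hD
  have h1 : ContDiffAt ℝ ∞ (fun q => jetWillmore (familyJet F q)) (0, z) :=
    ContDiffAt.comp _ (contDiffAt_jetWillmore hev.self_of_nhds.2.1 ∞)
      ((smooth_familyJet h.isOpen h.smooth).contDiffAt (h.isOpen.mem_nhds hz))
  exact h1.congr_of_eventuallyEq (hev.mono fun q hq => hq.2.2)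

/-- The first variation of the Willmore integrand. -/
theorem IsFamilyLift.hasDerivAt_density (h : IsFamilyLift e f O F) (hz : (0, z) ∈ O)
    (hE : 0 < ip (du (fun w => F (0, w)) z) (du (fun w => F (0, w)) z))
    (hD : 0 < gramDet (du (fun w => F (0, w)) z) (dv (fun w => F (0, w)) z)) :
    HasDerivAt (fun t => willmoreDensity e (f t) z)
      (fderiv ℝ jetWillmore (jet (fun w => F (0, w)) z)
        (jet (fun w => dirDeriv (1, 0) F (0, w)) z)) 0 := by
  have hev := h.eventually_spacelike hz hE hD
  have h0 := hasDerivAt_familyJet h.isOpen h.smooth hz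
  have h1 : HasFDerivAt jetWillmore (fderiv ℝ jetWillmore (familyJet F (0, z)))
      (familyJet F (0, z)) :=
    ((contDiffAt_jetWillmore hev.self_of_nhds.2.1 1).differentiableAt (by simp)).hasFDerivAt
  have h2 := h1.comp_hasDerivAt (0 : ℝ) h0
  have h3 := jet_slice h.isOpen h.smooth hz
  simp only at h3
  rw [h3]
  refine h2.congr_of_eventuallyEq ?_
  have hcont : Filter.Tendsto (fun t : ℝ => (t, z)) (nhds 0) (nhds (0, z)) :=
    (Continuous.prodMk_left z).tendsto 0
  filter_upwards [hcont.eventually hev] with t ht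
  exact ht.2.2

theorem IsConformalSpacelikeOn.gramDet_pos (h : IsConformalSpacelikeOn y U)
    (hY : IsLocalLift y e s Y) (hz : z ∈ s) (hU : e.symm z ∈ U) :
    0 < gramDet (du Y z) (dv Y z) := by
  obtain ⟨h1, h2, h3⟩ := h.metric hY hz hU
  rw [gramDet, h2, ← h1]; nlinarith

/-- The derivative at time `0` of the Willmore integrand of the family `f`. -/
def variationDensity (e : OpenPartialHomeomorph M ℂ) (f : ℝ → M → Q41) (z : ℂ) : ℝ :=
  deriv (fun t => willmoreDensity e (f t) z) 0

theorem IsVariation.spacelike_familyLift (hf : IsVariation y U K f)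
    (hy : IsConformalSpacelikeOn y U) (h : IsFamilyLift e f O F) (hz : (0, z) ∈ O)
    (hU : e.symm z ∈ U) :
    0 < ip (du (fun w => F (0, w)) z) (du (fun w => F (0, w)) z) ∧
      0 < gramDet (du (fun w => F (0, w)) z) (dv (fun w => F (0, w)) z) := by
  have h0 := h.slice 0
  rw [hf.start] at h0
  exact ⟨(hy.metric h0 hz hU).2.2, hy.gramDet_pos h0 hz hU⟩

theorem IsVariation.variationDensity_eq (hf : IsVariation y U K f)
    (hy : IsConformalSpacelikeOn y U) (h : IsFamilyLift e f O F) (hz : (0, z) ∈ O)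
    (hU : e.symm z ∈ U) :
    variationDensity e f z = fderiv ℝ jetWillmore (jet (fun w => F (0, w)) z)
        (jet (fun w => dirDeriv (1, 0) F (0, w)) z) := by
  obtain ⟨hE, hD⟩ := hf.spacelike_familyLift hy h hz hU
  exact (h.hasDerivAt_density hz hE hD).deriv

theorem IsVariation.exists_familyLift_at [IsManifold 𝓘(ℂ) ω M] (hf : IsVariation y U K f)
    (hy : IsConformalSpacelikeOn y U) (he : IsCoord e) (hz : z ∈ e.target) (hU : e.symm z ∈ U) :
    ∃ O F, IsFamilyLift e f O F ∧ (0, z) ∈ O := by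
  obtain ⟨s, Y, hY, hzs, hs⟩ := exists_localLift hy.isOpen hy.smooth he hU (e.map_target hz)
  rw [e.right_inv hz] at hzs
  obtain ⟨O, F, hF, -, h0, -⟩ := hf.exists_familyLift hY hs
  exact ⟨O, F, hF, (h0 z hzs).1⟩

theorem IsVariation.contDiffAt_density [IsManifold 𝓘(ℂ) ω M] (hf : IsVariation y U K f)
    (hy : IsConformalSpacelikeOn y U) (he : IsCoord e) (hz : z ∈ e.target) (hU : e.symm z ∈ U) :
    ContDiffAt ℝ ∞ (fun q : ℝ × ℂ => willmoreDensity e (f q.1) q.2) (0, z) := by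
  obtain ⟨O, F, hF, hzO⟩ := hf.exists_familyLift_at hy he hz hU
  obtain ⟨hE, hD⟩ := hf.spacelike_familyLift hy hF hzO hU
  exact hF.contDiffAt_density hzO hE hD

/-- The Willmore integrand does not change outside the support of a variation. -/
theorem IsVariation.variationDensity_eq_zero [T2Space M] (hf : IsVariation y U K f)
    (hz : z ∈ e.target) (hK : e.symm z ∉ K) : variationDensity e f z = 0 := by
  have h0 : ∀ t, willmoreDensity e (f t) z = willmoreDensity e y z := fun t => by
    unfold willmoreDensity
    rw [hf.fixed t _ hK]
    have hO : IsOpen (e.target ∩ e.symm ⁻¹' Kᶜ) :=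
      e.symm.isOpen_inter_preimage hf.compact.isClosed.isOpen_compl
    -- A compact set in a Hausdorff space is closed, so the surface is unchanged near the point and
    -- all derivatives agree.
    have heq : (fun w => affineRep (y (e.symm z)) (f t (e.symm w))) =ᶠ[nhds z]
        fun w => affineRep (y (e.symm z)) (y (e.symm w)) := by
      filter_upwards [hO.mem_nhds ⟨hz, hK⟩] with w hw
      rw [hf.fixed t _ hw.2]
    have h1 := heq.fderiv (𝕜 := ℝ)
    simp only [willmoreIntegrand, du, dv, hess, h1.eq_of_nhds, h1.fderiv_eq, heq.eq_of_nhds]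
  unfold variationDensity
  simp [h0]

/-- The first variation transforms as a density. -/
theorem IsVariation.variationDensity_transition [IsManifold 𝓘(ℂ) ω M] (hf : IsVariation y U K f)
    (hy : IsConformalSpacelikeOn y U) (he : IsCoord e) (hc : IsCoord c) (hz : z ∈ overlap e c)
    (hU : e.symm z ∈ U) :
    variationDensity e f z
      = ‖deriv (transition e c) z‖ ^ 2 * variationDensity c f (transition e c z) := by
  set φ := transition e c with hφ
  have hφz := transition_mem hz
  have hU' : c.symm (φ z) ∈ U := by rw [symm_transition hz]; exact hU
  obtain ⟨O, F, hF, hzO⟩ := hf.exists_familyLift_at hy hc hφz.1 hU'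
  set O' : Set (ℝ × ℂ) := (Prod.snd ⁻¹' overlap e c) ∩ (fun q => (q.1, φ q.2)) ⁻¹' O
  have hφs := smooth_transition he hc
  have hcd : ContDiffOn ℝ ∞ (fun q : ℝ × ℂ => (q.1, φ q.2)) (Prod.snd ⁻¹' overlap e c) :=
    contDiffOn_fst.prodMk (hφs.comp contDiffOn_snd fun q hq => hq)
  have hO' : IsOpen O' := hcd.continuousOn.isOpen_inter_preimage
    ((isOpen_overlap e c).preimage continuous_snd) hF.isOpen
  have hF' : IsFamilyLift e f O' (fun q => F (q.1, φ q.2)) :=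
    ⟨he, hO', fun q hq => hq.1.1, hF.smooth.comp (hcd.mono fun q hq => hq.1) fun q hq => hq.2,
      fun q hq => by
        rw [← symm_transition hq.1]
        exact hF.lift _ hq.2⟩
  have hzO' : (0, z) ∈ O' := ⟨hz, hzO⟩
  obtain ⟨hE, hD⟩ := hf.spacelike_familyLift hy hF hzO hU'
  obtain ⟨hE', hD'⟩ := hf.spacelike_familyLift hy hF' hzO' hU
  have hev := hF.eventually_spacelike hzO hE hD
  have hev' := hF'.eventually_spacelike hzO' hE' hD'
  have hcont : ∀ w : ℂ, Filter.Tendsto (fun t : ℝ => (t, w)) (nhds 0) (nhds (0, w)) := fun w =>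
    (Continuous.prodMk_left w).tendsto 0
  -- The varied surfaces need not be conformal, but the integrand of any spacelike lift transforms
  -- as a density; the rule is differentiated in time.
  have key : (fun t => willmoreDensity e (f t) z) =ᶠ[nhds 0]
      fun t => ‖deriv φ z‖ ^ 2 * willmoreDensity c (f t) (φ z) := by
    filter_upwards [(hcont _).eventually hev, (hcont _).eventually hev'] with t h1 h2
    obtain ⟨h1, h1D, h1w⟩ := h1
    obtain ⟨h2, -, h2w⟩ := h2
    rw [h1w, h2w, ← jet_slice hF.isOpen hF.smooth h1, ← jet_slice hF'.isOpen hF'.smooth h2]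
    have ht : IsOpen {w | (t, w) ∈ O'} := isOpen_slice hO' t
    refine jetWillmore_comp (isOpen_slice hF.isOpen t) ht (smooth_slice hF.smooth t)
      ((differentiableOn_transition he hc).mono fun w hw => hw.1) (fun w hw => hw.2) h2
      (deriv_transition_ne_zero he hc hz) ?_
    rw [du_slice (p := (t, φ z)) hF.isOpen hF.smooth h1,
      dv_slice (p := (t, φ z)) hF.isOpen hF.smooth h1]
    exact h1D
  unfold variationDensity
  rw [key.deriv_eq]
  exact deriv_const_mul _ (hF.hasDerivAt_density hzO hE hD).differentiableAt

end FamilyLifts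

/-! ### The first variation of the Willmore functional -/

theorem hasDerivAt_fst {g : ℝ × ℂ → ℝ} {t : ℝ} {z : ℂ} (h : DifferentiableAt ℝ g (t, z)) :
    HasDerivAt (fun t => g (t, z)) (fderiv ℝ g (t, z) (1, 0)) t :=
  h.hasFDerivAt.comp_hasDerivAt (f := fun t => (t, z)) t
    ((hasDerivAt_id t).prodMk (hasDerivAt_const t z))

/-- Differentiation under the integral sign over a relatively compact set. -/
theorem hasDerivAt_setIntegral {g : ℝ × ℂ → ℝ} {C A : Set ℂ} (hC : IsCompact C) (hAC : A ⊆ C)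
    (hA : MeasurableSet A) (hg : ∀ z ∈ C, ContDiffAt ℝ ∞ g (0, z)) :
    HasDerivAt (fun t => ∫ z in A, g (t, z)) (∫ z in A, deriv (fun t => g (t, z)) 0) 0 := by
  set W : Set (ℝ × ℂ) := {q | ContDiffAt ℝ 1 g q} with hW
  have hWo : IsOpen W := by
    rw [isOpen_iff_mem_nhds]
    intro q hq
    exact ContDiffAt.eventually hq (by simp)
  -- Compactness gives one time interval on which `g` is smooth over all of `C`; the derivative is
  -- then bounded there, and the constant bound dominates.
  obtain ⟨u, v, hu, hv, hu0, hCv, huv⟩ := generalized_tube_lemma (s := {(0 : ℝ)}) (t := C)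
    isCompact_singleton hC hWo (by
      rintro ⟨t, z⟩ ⟨ht, hz⟩
      rw [Set.mem_singleton_iff] at ht
      subst ht
      exact (hg z hz).of_le (WithTop.coe_le_coe.2 le_top))
  obtain ⟨δ, hδ, hδu⟩ := Metric.nhds_basis_closedBall.mem_iff.1
    (hu.mem_nhds (hu0 (Set.mem_singleton 0)))
  have hsub : ∀ t ∈ Metric.closedBall (0 : ℝ) δ, ∀ z ∈ C, ContDiffAt ℝ 1 g (t, z) :=
    fun t ht z hz => huv ⟨hδu ht, hCv hz⟩
  have hfd : ∀ t ∈ Metric.closedBall (0 : ℝ) δ, ∀ z ∈ C, ContinuousAt (fderiv ℝ g) (t, z) :=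
    fun t ht z hz => ((hsub t ht z hz).fderiv_right (m := 0) (by simp)).continuousAt
  obtain ⟨B, hB⟩ := ((isCompact_closedBall (0 : ℝ) δ).prod hC).exists_bound_of_continuousOn
    (fun q hq => (hfd q.1 hq.1 q.2 hq.2).continuousWithinAt)
  have hline : ∀ t ∈ Metric.closedBall (0 : ℝ) δ, ∀ z ∈ C,
      HasDerivAt (fun t => g (t, z)) (fderiv ℝ g (t, z) (1, 0)) t := fun t ht z hz =>
    hasDerivAt_fst ((hsub t ht z hz).differentiableAt (by simp))
  have hcont : ∀ t ∈ Metric.closedBall (0 : ℝ) δ, ContinuousOn (fun z => g (t, z)) C :=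
    fun t ht z hz => by
      have h1 : ContinuousAt g (t, z) := (hsub t ht z hz).continuousAt
      exact (h1.comp (f := fun z => (t, z)) (by fun_prop)).continuousWithinAt
  have h0 : (0 : ℝ) ∈ Metric.closedBall (0 : ℝ) δ := Metric.mem_closedBall_self hδ.le
  have hAm : ∀ᵐ z ∂(volume.restrict A), z ∈ A := ae_restrict_mem hA
  have hball : Metric.ball (0 : ℝ) δ ∈ nhds (0 : ℝ) := Metric.ball_mem_nhds 0 hδ
  have hfin : IsFiniteMeasure (volume.restrict A) :=
    ⟨by rw [Measure.restrict_apply_univ]; exact (measure_mono hAC).trans_lt hC.measure_lt_top⟩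
  have key := hasDerivAt_integral_of_dominated_loc_of_deriv_le (μ := volume.restrict A)
    (F := fun t z => g (t, z)) (F' := fun t z => fderiv ℝ g (t, z) (1, 0)) (x₀ := (0 : ℝ))
    (bound := fun _ => B) hball
    (by
      filter_upwards [hball] with t ht
      exact ((hcont t (Metric.ball_subset_closedBall ht)).mono hAC).aestronglyMeasurable hA)
    (((hcont 0 h0).integrableOn_compact hC).mono_set hAC)
    (by
      refine ContinuousOn.aestronglyMeasurable (fun z hz => ?_) hA
      exact (((hfd 0 h0 z (hAC hz)).comp (f := fun z => ((0 : ℝ), z)) (by fun_prop)).clm_apply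
        continuousAt_const).continuousWithinAt)
    (by
      filter_upwards [hAm] with z hz t ht
      have h1 := hB (t, z) ⟨Metric.ball_subset_closedBall ht, hAC hz⟩
      refine (ContinuousLinearMap.le_opNorm _ _).trans ?_
      have h2 : ‖((1 : ℝ), (0 : ℂ))‖ = 1 := by simp [Prod.norm_def]
      rw [h2, mul_one]; exact h1)
    (integrable_const B)
    (by
      filter_upwards [hAm] with z hz t ht
      exact hline t (Metric.ball_subset_closedBall ht) z (hAC hz))
  have h2 : ∫ z in A, deriv (fun t => g (t, z)) 0 = ∫ z in A, fderiv ℝ g (0, z) (1, 0) :=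
    setIntegral_congr_fun (f := fun z => deriv (fun t => g (t, z)) 0) hA
      fun z hz => (hline 0 h0 z (hAC hz)).deriv
  rw [h2]
  exact key.2

/-- Measurability refers only to coordinate images, so the intersection with `K` is taken in the
plane, by removing the open image of its complement. -/
theorem measurableSet_image_inter {M : Type*} [TopologicalSpace M] [T2Space M]
    (e : OpenPartialHomeomorph M ℂ) {K A : Set M} (hK : IsCompact K)
    (hAe : A ⊆ e.source) (hA : MeasurableSet (e '' A)) :
    MeasurableSet (e '' (A ∩ K)) := by
  have hO : IsOpen (e.target ∩ e.symm ⁻¹' Kᶜ) :=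
    e.symm.isOpen_inter_preimage hK.isClosed.isOpen_compl
  have : e '' (A ∩ K) = e '' A \ (e.target ∩ e.symm ⁻¹' Kᶜ) := by
    ext z
    constructor
    · rintro ⟨p, hp, rfl⟩
      refine ⟨⟨p, hp.1, rfl⟩, fun h => h.2 ?_⟩
      rw [e.left_inv (hAe hp.1)]; exact hp.2
    · rintro ⟨⟨p, hp, rfl⟩, h⟩
      refine ⟨p, ⟨hp, ?_⟩, rfl⟩
      by_contra hpK
      refine h ⟨e.map_source (hAe hp), ?_⟩
      rw [Set.mem_preimage, e.left_inv (hAe hp)]; exact hpK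
  rw [this]
  exact hA.diff hO.measurableSet

section Functional

variable {M : Type*} [TopologicalSpace M] [ChartedSpace ℂ M] [IsManifold 𝓘(ℂ) ω M]
  {e c : OpenPartialHomeomorph M ℂ} {y : M → Q41} {U K : Set M} {f : ℝ → M → Q41} {s : Set ℂ}
  {z : ℂ}

/-- The first variation of the Willmore functional. -/
theorem IsVariation.hasDerivAt_willmoreFunctional (hf : IsVariation y U K f)
    (hy : IsConformalSpacelikeOn y U) {n : ℕ} {e : Fin n → OpenPartialHomeomorph M ℂ}
    {A : Fin n → Set M} (hA : IsDissection U K e A) :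
    HasDerivAt (fun t => willmoreFunctional (f t) e A)
      (∑ i, ∫ z in e i '' A i, variationDensity (e i) f z) 0 := by
  unfold willmoreFunctional
  refine HasDerivAt.fun_sum fun i _ => ?_
  obtain ⟨C, hC, hAC, hCU⟩ := hA.compact i
  refine hasDerivAt_setIntegral (g := fun q : ℝ × ℂ => willmoreDensity (e i) (f q.1) q.2)
    (C := e i '' C) (hC.image_of_continuousOn
      ((e i).continuousOn.mono fun p hp => (hCU hp).1)) (Set.image_mono hAC) (hA.measurable i) ?_
  rintro _ ⟨p, hp, rfl⟩
  obtain ⟨h1, h2⟩ := hCU hp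
  refine hf.contDiffAt_density hy (hA.coord i) ((e i).map_source h1) ?_
  rwa [(e i).left_inv h1]

theorem IsVariation.continuousOn_variationDensity (hf : IsVariation y U K f)
    (hy : IsConformalSpacelikeOn y U) (he : IsCoord e) :
    ContinuousOn (variationDensity e f) (e.target ∩ e.symm ⁻¹' U) := by
  intro z hz
  have h := hf.contDiffAt_density hy he hz.1 hz.2
  have h1 : ContinuousAt (fderiv ℝ (fun q : ℝ × ℂ => willmoreDensity e (f q.1) q.2)) (0, z) :=
    (ContDiffAt.fderiv_right (m := 0) h (by simp)).continuousAt
  have h2 : ContinuousAt (fun w : ℂ =>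
      fderiv ℝ (fun q : ℝ × ℂ => willmoreDensity e (f q.1) q.2) (0, w) (1, 0)) z :=
    (h1.comp (f := fun w : ℂ => ((0 : ℝ), w)) (by fun_prop)).clm_apply continuousAt_const
  have h3 : ∀ w ∈ e.target ∩ e.symm ⁻¹' U, variationDensity e f w = fderiv ℝ
      (fun q : ℝ × ℂ => willmoreDensity e (f q.1) q.2) (0, w) (1, 0) := fun w hw =>
    (hasDerivAt_fst ((hf.contDiffAt_density hy he hw.1 hw.2).differentiableAt (by simp))).deriv
  exact h2.continuousWithinAt.congr h3 (h3 z hz)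

theorem abs_det_toSpanSingleton (a : ℂ) :
    |((ContinuousLinearMap.toSpanSingleton ℂ a).restrictScalars ℝ : ℂ →L[ℝ] ℂ).det| = ‖a‖ ^ 2 := by
  have h : ((ContinuousLinearMap.toSpanSingleton ℂ a).restrictScalars ℝ : ℂ →L[ℝ] ℂ).det
      = ‖a‖ ^ 2 := by
    rw [ContinuousLinearMap.det, ← LinearMap.det_toMatrix Complex.basisOneI, Matrix.det_fin_two,
      ← Complex.normSq_eq_norm_sq, Complex.normSq_apply]
    simp [LinearMap.toMatrix_apply]
  rw [h, abs_of_nonneg (by positivity)]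

/-- The first variation over a region covered by two coordinates. -/
theorem IsVariation.integral_transition (hf : IsVariation y U K f)
    (hy : IsConformalSpacelikeOn y U) (he : IsCoord e) (hc : IsCoord c) {A : Set M}
    (hAe : A ⊆ e.source) (hAc : A ⊆ c.source) (hAU : A ⊆ U) (hA : MeasurableSet (e '' A)) :
    ∫ z in c '' A, variationDensity c f z = ∫ z in e '' A, variationDensity e f z := by
  have hAo : e '' A ⊆ overlap e c := by
    rintro _ ⟨p, hp, rfl⟩
    exact ⟨e.map_source (hAe hp), by rw [Set.mem_preimage, e.left_inv (hAe hp)]; exact hAc hp⟩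
  have him : transition e c '' (e '' A) = c '' A := by
    rw [Set.image_image]
    exact Set.image_congr fun p hp => by rw [transition, e.left_inv (hAe hp)]
  -- The real Jacobian of a holomorphic map is `|φ'|²`, the factor by which the density transforms.
  rw [← him, integral_image_eq_integral_abs_det_fderiv_smul volume hA
    (fun z hz => ((hasDerivAt_transition he hc (hAo hz)).hasFDerivAt.restrictScalars
      ℝ).hasFDerivWithinAt) ((injOn_transition e c).mono hAo)]
  refine setIntegral_congr_fun hA fun z hz => ?_
  obtain ⟨p, hp, rfl⟩ := hz
  simp only [abs_det_toSpanSingleton, smul_eq_mul]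
  refine (hf.variationDensity_transition hy he hc (hAo ⟨p, hp, rfl⟩) ?_).symm
  rw [e.left_inv (hAe hp)]; exact hAU hp

theorem measurableSet_image_of_coord (he : IsCoord e) (hc : IsCoord c) {A : Set M}
    (hAe : A ⊆ e.source) (hAc : A ⊆ c.source) (hA : MeasurableSet (e '' A)) :
    MeasurableSet (c '' A) := by
  have hAo : e '' A ⊆ overlap e c := by
    rintro _ ⟨p, hp, rfl⟩
    exact ⟨e.map_source (hAe hp), by rw [Set.mem_preimage, e.left_inv (hAe hp)]; exact hAc hp⟩
  have him : transition e c '' (e '' A) = c '' A := by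
    rw [Set.image_image]
    exact Set.image_congr fun p hp => by rw [transition, e.left_inv (hAe hp)]
  rw [← him]
  exact hA.image_of_continuousOn_injOn ((smooth_transition he hc).continuousOn.mono hAo)
    ((injOn_transition e c).mono hAo)

/-- The first variation with respect to a variation that is supported in the domain of the
coordinate `c`. -/
theorem IsVariation.sum_integral_eq [T2Space M] (hf : IsVariation y U K f)
    (hy : IsConformalSpacelikeOn y U) (hc : IsCoord c) (hKc : K ⊆ c.source) {n : ℕ}
    {e : Fin n → OpenPartialHomeomorph M ℂ} {A : Fin n → Set M} (hA : IsDissection U K e A) :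
    ∑ i, ∫ z in e i '' A i, variationDensity (e i) f z = ∫ z in c '' K, variationDensity c f z := by
  have hAe : ∀ i, A i ⊆ (e i).source := fun i => by
    obtain ⟨C, -, h1, h2⟩ := hA.compact i
    exact fun p hp => (h2 (h1 hp)).1
  have hm : ∀ i, MeasurableSet (e i '' (A i ∩ K)) := fun i =>
    measurableSet_image_inter (e i) hf.compact (hAe i) (hA.measurable i)
  -- Outside `K` the density vanishes, so each piece may be cut down to `K` and then moved to the
  -- coordinate `c`.
  have h1 : ∀ i, ∫ z in e i '' A i, variationDensity (e i) f z
      = ∫ z in c '' (A i ∩ K), variationDensity c f z := fun i => by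
    rw [hf.integral_transition hy (hA.coord i) hc (fun p hp => hAe i hp.1) (fun p hp => hKc hp.2)
      (fun p hp => hf.subset hp.2) (hm i)]
    refine setIntegral_eq_of_subset_of_forall_sdiff_eq_zero (hA.measurable i)
      (Set.image_mono Set.inter_subset_left) ?_
    rintro _ ⟨⟨p, hp, rfl⟩, hn⟩
    refine hf.variationDensity_eq_zero ((e i).map_source (hAe i hp)) fun hK => ?_
    rw [(e i).left_inv (hAe i hp)] at hK
    exact hn ⟨p, ⟨hp, hK⟩, rfl⟩
  have hK : c '' K = ⋃ i, c '' (A i ∩ K) := by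
    rw [← Set.image_iUnion, ← Set.iUnion_inter, Set.inter_eq_right.2 hA.cover]
  have hint : IntegrableOn (variationDensity c f) (c '' K) := by
    refine ContinuousOn.integrableOn_compact
      (hf.compact.image_of_continuousOn (c.continuousOn.mono hKc))
      ((hf.continuousOn_variationDensity hy hc).mono ?_)
    rintro _ ⟨p, hp, rfl⟩
    refine ⟨c.map_source (hKc hp), ?_⟩
    rw [Set.mem_preimage, c.left_inv (hKc hp)]; exact hf.subset hp
  rw [Finset.sum_congr rfl fun i _ => h1 i, hK, integral_iUnion_fintype]
  · exact fun i => measurableSet_image_of_coord (hA.coord i) hc (fun p hp => hAe i hp.1)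
      (fun p hp => hKc hp.2) (hm i)
  · intro i j hij
    refine Set.disjoint_image_image ?_ 
    intro p hp q hq h
    have := c.injOn (hKc hp.2) (hKc hq.2) h
    subst this
    exact Set.disjoint_left.1 (hA.disjoint hij) hp.1 hq.1
  · exact fun i => hint.mono_set (Set.image_mono Set.inter_subset_right)

end Functional

/-! ### The Euler-Lagrange equation -/

theorem jet_congr_on {f g : ℂ → R62} {s : Set ℂ} (hs : IsOpen s) (h : Set.EqOn f g s) {z : ℂ}
    (hz : z ∈ s) : jet f z = jet g z := by
  have hu : Set.EqOn (du f) (du g) s := fun w hw => du_congr_on hs h hw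
  have hv : Set.EqOn (dv f) (dv g) s := fun w hw => dv_congr_on hs h hw
  unfold jet
  rw [hu hz, hv hz, du_congr_on hs hu hz, du_congr_on hs hv hz, dv_congr_on hs hv hz]

theorem jet_zero (z : ℂ) : jet (fun _ => 0) z = 0 := by
  have hu : du (fun _ : ℂ => (0 : R62)) = fun _ => 0 := by ext1 w; simp [du]
  have hv : dv (fun _ : ℂ => (0 : R62)) = fun _ => 0 := by ext1 w; simp [dv]
  simp only [jet, hu, hv]; rfl

theorem integrableOn_of_eq_zero {g : ℂ → ℝ} {s k : Set ℂ} (hs : IsOpen s) (hg : ContinuousOn g s)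
    (hk : IsCompact k) (hks : k ⊆ s) (h0 : ∀ z ∈ s, z ∉ k → g z = 0) : IntegrableOn g s :=
  ((hg.mono hks).integrableOn_compact hk).of_forall_sdiff_eq_zero hs.measurableSet
    fun z hz => h0 z hz.1 hz.2

/-- The first variation formula for compactly supported fields. -/
theorem IsCanonical.integral_linWillmore {s k : Set ℂ} {Y w : ℂ → R62} (h : IsCanonical s Y)
    (hw : ContDiffOn ℝ ∞ w s) (hk : IsCompact k) (hks : k ⊆ s)
    (h0 : ∀ z ∈ s, z ∉ k → w z = 0) :
    ∫ z in s, linWillmore (jet Y z) (jet w z) = ∫ z in s, ip (eulerLagrange Y z) (w z) := by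
  have hs := h.isOpen
  -- On this open set `w` vanishes identically, hence so do its derivatives, the fluxes and their
  -- derivatives.
  have hsk : IsOpen (s \ k) := hs.sdiff hk.isClosed
  have hw0 : Set.EqOn w (fun _ => 0) (s \ k) := fun z hz => h0 z hz.1 hz.2
  have hwu : ∀ z ∈ s, z ∉ k → du w z = 0 := fun z hz hzk => by
    rw [du_congr_on hsk hw0 ⟨hz, hzk⟩]; simp [du]
  have hwv : ∀ z ∈ s, z ∉ k → dv w z = 0 := fun z hz hzk => by
    rw [dv_congr_on hsk hw0 ⟨hz, hzk⟩]; simp [dv]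
  have hU0 : ∀ z ∈ s, z ∉ k → fluxU Y w z = 0 := fun z hz hzk => by
    simp [fluxU, h0 z hz hzk, hwu z hz hzk, hwv z hz hzk, ip_zero_right]
  have hV0 : ∀ z ∈ s, z ∉ k → fluxV Y w z = 0 := fun z hz hzk => by
    simp [fluxV, h0 z hz hzk, hwv z hz hzk, ip_zero_right]
  have hU := smooth_fluxU h hw
  have hV := smooth_fluxV h hw
  have hU1 : ∀ z ∈ s, z ∉ k → du (fluxU Y w) z = 0 := fun z hz hzk => by
    rw [du_congr_on hsk (g := fun _ => (0 : ℝ)) (fun x hx => hU0 x hx.1 hx.2) ⟨hz, hzk⟩]; simp [du]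
  have hV1 : ∀ z ∈ s, z ∉ k → dv (fluxV Y w) z = 0 := fun z hz hzk => by
    rw [dv_congr_on hsk (g := fun _ => (0 : ℝ)) (fun x hx => hV0 x hx.1 hx.2) ⟨hz, hzk⟩]; simp [dv]
  have iE := integrableOn_of_eq_zero hs (smooth_ip h.smooth_eulerLagrange hw).continuousOn hk hks
    (fun z hz hzk => by rw [h0 z hz hzk, ip_zero_right])
  have iU := integrableOn_of_eq_zero hs (smooth_du hs hU).continuousOn hk hks hU1
  have iV := integrableOn_of_eq_zero hs (smooth_dv hs hV).continuousOn hk hks hV1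
  have e1 : ∫ z in s, du (fluxU Y w) z = 0 := setIntegral_fderiv_eq_zero hs hU hk hks hU0 1
  have e2 : ∫ z in s, dv (fluxV Y w) z = 0 := setIntegral_fderiv_eq_zero hs hV hk hks hV0 Complex.I
  rw [setIntegral_congr_fun hs.measurableSet (fun z hz => linWillmore_eq h hw hz),
    integral_add (f := fun z => ip (eulerLagrange Y z) (w z) + du (fluxU Y w) z) (iE.add iU) iV,
    integral_add iE iU, e1, e2, add_zero, add_zero]

/-- The variation `[Y + t w]` of the surface `[Y]`. -/
def normalVariation {M : Type*} [TopologicalSpace M] (y : M → Q41) (e : OpenPartialHomeomorph M ℂ)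
    (s : Set ℂ) (Y w : ℂ → R62) (t : ℝ) (p : M) : Q41 :=
  open Classical in
  if h : (p ∈ e.source ∧ e p ∈ s) ∧ ∃ q, Represents (Y (e p) + t • w (e p)) q then h.2.choose
    else y p

theorem normalVariation_represents {M : Type*} [TopologicalSpace M]
    {e : OpenPartialHomeomorph M ℂ} {y : M → Q41} {s : Set ℂ} {Y w : ℂ → R62} {t : ℝ} {p : M} (hp : p ∈ e.source)
    (hps : e p ∈ s) (h : ∃ q, Represents (Y (e p) + t • w (e p)) q) :
    Represents (Y (e p) + t • w (e p)) (normalVariation y e s Y w t p) := by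
  rw [normalVariation, dif_pos ⟨⟨hp, hps⟩, h⟩]
  exact Exists.choose_spec _

section

variable {M : Type*} [TopologicalSpace M] [ChartedSpace ℂ M]
  {e c : OpenPartialHomeomorph M ℂ} {y : M → Q41} {U K : Set M} {f : ℝ → M → Q41} {s : Set ℂ}
  {Y L R : ℂ → R62} {z : ℂ}

/-- The first variation of the Willmore integrand at the canonical lift. -/
theorem IsVariation.variationDensity_eq_linWillmore (hf : IsVariation y U K f)
    (hy : IsConformalSpacelikeOn y U) {O : Set (ℝ × ℂ)} {F : ℝ × ℂ → R62}
    (hF : IsFamilyLift c f O F) (hY : IsCanonical s Y) (h0 : ∀ z ∈ s, (0, z) ∈ O ∧ F (0, z) = Y z)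
    (hs : ∀ z ∈ s, c.symm z ∈ U) (hz : z ∈ s) :
    variationDensity c f z
      = linWillmore (jet Y z) (jet (fun w => dirDeriv (1, 0) F (0, w)) z) := by
  rw [hf.variationDensity_eq hy hF (h0 z hz).1 (hs z hz),
    jet_congr_on hY.isOpen (fun w hw => (h0 w hw).2) hz, hY.fderiv_jetWillmore hz]

theorem setIntegral_variationDensity [T2Space M] (hf : IsVariation y U K f)
    (hy : IsConformalSpacelikeOn y U) {O : Set (ℝ × ℂ)} {F : ℝ × ℂ → R62}
    (hF : IsFamilyLift c f O F) (hY : IsCanonical s Y) (hsc : s ⊆ c.target)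
    (h0 : ∀ z ∈ s, (0, z) ∈ O ∧ F (0, z) = Y z)
    (hs : ∀ z ∈ s, c.symm z ∈ U) (hK : K ⊆ c.source) (hKs : c '' K ⊆ s)
    (hfix : ∀ z ∈ s, c.symm z ∉ K → dirDeriv (1, 0) F (0, z) = 0) :
    ∫ z in c '' K, variationDensity c f z
      = ∫ z in s, ip (eulerLagrange Y z) (dirDeriv (1, 0) F (0, z)) := by
  have hk : IsCompact (c '' K) := hf.compact.image_of_continuousOn (c.continuousOn.mono hK)
  have hmem : ∀ z ∈ s, z ∉ c '' K → c.symm z ∉ K := fun z hz hzK h =>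
    hzK ⟨_, h, c.right_inv (hsc hz)⟩
  have hW : ContDiffOn ℝ ∞ (fun w => dirDeriv (1, 0) F (0, w)) s :=
    (smooth_slice (smooth_dirDeriv hF.isOpen hF.smooth _) 0).mono fun z hz => (h0 z hz).1
  rw [← hY.integral_linWillmore hW hk hKs fun z hz hzK => hfix z hz (hmem z hz hzK),
    ← setIntegral_eq_of_subset_of_forall_sdiff_eq_zero hY.isOpen.measurableSet hKs
      (f := variationDensity c f)]
  · exact setIntegral_congr_fun hY.isOpen.measurableSet fun z hz =>
      hf.variationDensity_eq_linWillmore hy hF hY h0 hs hz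
  · exact fun z hz => hf.variationDensity_eq_zero (hsc hz.1) (hmem z hz.1 hz.2)

/-- Variations supported in the domain of a frame that solves the Euler-Lagrange equation. -/
theorem IsFrame.integral_variationDensity_eq_zero [IsManifold 𝓘(ℂ) ω M] [T2Space M]
    (h : IsFrame s Y L R)
    (hY : IsLocalLift y c s Y) (hE : ∀ z ∈ s, ip (eulerLagrange Y z) (L z) = 0)
    (hE' : ∀ z ∈ s, ip (eulerLagrange Y z) (R z) = 0) (hs : ∀ z ∈ s, c.symm z ∈ U)
    (hy : IsConformalSpacelikeOn y U) (hf : IsVariation y U K f) (hK : K ⊆ c.source)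
    (hKs : c '' K ⊆ s) : ∫ z in c '' K, variationDensity c f z = 0 := by
  obtain ⟨O, F, hF, -, h0, hfix⟩ := hf.exists_familyLift hY hs
  rw [setIntegral_variationDensity hf hy hF h.toIsCanonical hY.subset h0 hs hK hKs]
  · rw [setIntegral_congr_fun (g := fun _ => (0 : ℝ)) h.isOpen.measurableSet]
    · simp
    · intro z hz
      -- The lifts stay on the light cone, so the velocity is tangent to it. This kills the term
      -- with the `N`-component of the Euler-Lagrange field, about which nothing is known.
      have hW : ip (dirDeriv (1, 0) F (0, z)) (Y z) = 0 := by
        have h1 := hasDerivAt_line hF.isOpen hF.smooth (h0 z hz).1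
        have h2 := hasDerivAt_ip h1 h1
        have h3 : HasDerivAt (fun t => ip (F (t, z)) (F (t, z))) 0 0 := by
          refine (hasDerivAt_const (0 : ℝ) (0 : ℝ)).congr_of_eventuallyEq ?_
          have hcont : Filter.Tendsto (fun t : ℝ => (t, z)) (nhds 0) (nhds (0, z)) :=
            (Continuous.prodMk_left z).tendsto 0
          filter_upwards [hcont.eventually (hF.isOpen.mem_nhds (h0 z hz).1)] with t ht
          exact (hF.lift _ ht).ip_self
        have h4 := h2.unique h3
        simp only [(h0 z hz).2, ip_comm (Y z)] at h4
        linarith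
      simp only
      rw [(h.nullFrame hz).ip_expand, eulerLagrange_Y h.toIsCanonical hz, eulerLagrange_u h.toIsCanonical hz,
        eulerLagrange_v h.toIsCanonical hz, hE z hz, hE' z hz, hW]
      ring
  · intro z hz hzK
    have h1 := hasDerivAt_line hF.isOpen hF.smooth (h0 z hz).1
    have h2 : (fun t => F (t, z)) = fun _ => Y z := funext fun t => hfix t z hz hzK
    simp only [h2] at h1
    exact h1.unique (hasDerivAt_const _ _)

theorem normalVariation_eq (hY : IsLocalLift y e s Y) {w : ℂ → R62} {t : ℝ} {p : M}
    (h0 : p ∈ e.source → e p ∈ s → w (e p) = 0) : normalVariation y e s Y w t p = y p := by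
  by_cases hp : p ∈ e.source ∧ e p ∈ s
  · have hl := hY.lift _ hp.2
    rw [e.left_inv hp.1] at hl
    have h1 : Y (e p) + t • w (e p) = Y (e p) := by rw [h0 hp.1 hp.2]; simp
    refine Represents.unique (normalVariation_represents hp.1 hp.2 ?_) ?_ <;> rw [h1]
    exacts [⟨_, hl⟩, hl]
  · rw [normalVariation, dif_neg fun h => hp h.1]

section NormalVariation

variable {φ : ℂ → ℝ}

/-- `Y` and `L` span a totally null plane, so the variation stays on the cone to all orders in `t`;
pairing with `N` shows that the vector is not zero. -/
theorem IsFrame.normalVariation_lift (h : IsFrame s Y L R) (hz : z ∈ s) (t : ℝ) :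
    ∃ q, Represents (Y z + t • φ z • L z) q := by
  refine exists_represents (fun h0 => ?_) ?_
  · have h1 : ip (Y z + t • φ z • L z) (dualN Y z) = -1 := by
      rw [ip_add_left, ip_smul_left, ip_smul_left, (h.nullFrame hz).YN, ip_comm (L z),
        (h.nullFrame hz).NL]
      ring
    rw [h0, ip_zero_left] at h1
    norm_num at h1
  · simp only [ip_add_left, ip_add_right, ip_smul_left, ip_smul_right, h.null z hz, h.LY z hz,
      h.LL z hz, ip_comm (Y z) (L z)]
    ring

theorem IsFrame.isFamilyLift (h : IsFrame s Y L R) (hY : IsLocalLift y e s Y)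
    (hφ : ContDiff ℝ ∞ φ) :
    IsFamilyLift e (normalVariation y e s Y fun z => φ z • L z) (Prod.snd ⁻¹' s)
      (fun q => Y q.2 + q.1 • φ q.2 • L q.2) where
  coord := hY.coord
  isOpen := h.isOpen.preimage continuous_snd
  subset := fun q hq => hY.subset hq
  smooth := by
    have hm : Set.MapsTo Prod.snd (Prod.snd ⁻¹' s : Set (ℝ × ℂ)) s := fun q hq => hq
    exact (h.smooth.comp contDiffOn_snd hm).add (contDiffOn_fst.smul
      ((hφ.contDiffOn.comp contDiffOn_snd hm).smul (h.smooth_L.comp contDiffOn_snd hm)))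
  lift := fun q hq => by
    have h1 := e.right_inv (hY.subset hq)
    have h2 := normalVariation_represents (y := y) (e := e) (s := s) (Y := Y)
      (w := fun z => φ z • L z) (t := q.1) (e.map_target (hY.subset hq)) (by rw [h1]; exact hq)
      (by rw [h1]; exact h.normalVariation_lift hq q.1)
    rw [h1] at h2
    exact h2

theorem IsFrame.isVariation [IsManifold 𝓘(ℂ) ω M] [T2Space M] (h : IsFrame s Y L R)
    (hY : IsLocalLift y e s Y)
    (hs : ∀ z ∈ s, e.symm z ∈ U) (hy : ∀ p ∈ U, SmoothAt y p) (hφ : ContDiff ℝ ∞ φ)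
    (hφc : HasCompactSupport φ) (hφs : tsupport φ ⊆ s) :
    IsVariation y U (e.symm '' tsupport φ) (normalVariation y e s Y fun z => φ z • L z) := by
  have hK : IsCompact (e.symm '' tsupport φ) :=
    hφc.isCompact.image_of_continuousOn (e.continuousOn_symm.mono (hφs.trans hY.subset))
  have hfix : ∀ t, ∀ p ∉ e.symm '' tsupport φ,
      normalVariation y e s Y (fun z => φ z • L z) t p = y p := fun t p hp => by
    refine normalVariation_eq hY fun h1 h2 => ?_
    have h3 : e p ∉ tsupport φ := fun h3 => hp ⟨e p, h3, e.left_inv h1⟩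
    simp [image_eq_zero_of_notMem_tsupport h3]
  have hF := h.isFamilyLift hY hφ
  refine ⟨hK, ?_, ?_, hfix, 1, one_pos, fun t _ p hp => ?_⟩
  · rintro _ ⟨z, hz, rfl⟩; exact hs z (hφs hz)
  · ext1 p
    by_cases hp : p ∈ e.source ∧ e p ∈ s
    · have hl := hY.lift _ hp.2
      rw [e.left_inv hp.1] at hl
      refine Represents.unique (normalVariation_represents hp.1 hp.2 ?_) ?_ <;>
        rw [zero_smul, add_zero]
      exacts [⟨_, hl⟩, hl]
    · rw [normalVariation, dif_neg fun h => hp h.1]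
  -- On the support the explicit lift is smooth; off it, which is open, the family equals `y` and
  -- smoothness is that of `y`.
  · by_cases hpK : p ∈ e.symm '' tsupport φ
    · obtain ⟨z, hz, rfl⟩ := hpK
      have hz' := hφs hz
      have ht := hY.subset hz'
      refine (contMDiffAt_prod_iff_coord hY.coord (e.map_target ht)).2 ?_
      have h1 := smoothMapAt_of_lift
        (q := fun q : ℝ × ℂ => normalVariation y e s Y (fun z => φ z • L z) q.1 (e.symm q.2))
        (hF.smooth.contDiffAt (hF.isOpen.mem_nhds (show (t, z) ∈ Prod.snd ⁻¹' s from hz')))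
        (Filter.eventually_of_mem (hF.isOpen.mem_nhds hz') hF.lift)
      rw [e.right_inv ht]
      exact h1
    · have h1 : ContMDiffAt (𝓘(ℝ, ℝ).prod 𝓘(ℝ, ℂ)) 𝓘(ℝ, R62) ∞
          (fun q : ℝ × M => affineRep (y p) (y q.2)) (t, p) :=
        ContMDiffAt.comp (t, p) (g := fun q => affineRep (y p) (y q)) (hy p hp) contMDiffAt_snd
      rw [hfix t p hpK]
      refine h1.congr_of_eventuallyEq ?_
      filter_upwards [(hK.isClosed.isOpen_compl.preimage continuous_snd).mem_nhds
        (show (t, p) ∈ Prod.snd ⁻¹' (e.symm '' tsupport φ)ᶜ from hpK)] with q hq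
      rw [hfix q.1 q.2 hq]

end NormalVariation

/-- A Willmore surface solves the Euler-Lagrange equation. -/
theorem IsSpacelikeWillmoreOn.eulerLagrange [IsManifold 𝓘(ℂ) ω M] [T2Space M]
    (hy : IsSpacelikeWillmoreOn y U) (hY : IsLocalLift y e s Y) (h : IsFrame s Y L R) (hz : z ∈ s)
    (hU : e.symm z ∈ U) : ip (eulerLagrange Y z) (L z) = 0 := by
  have hso : IsOpen (s ∩ e.symm ⁻¹' U) :=
    (e.continuousOn_symm.mono hY.subset).isOpen_inter_preimage h.isOpen hy.spacelike.isOpen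
  -- The frame may leave `U`; the equation is local, so the domain can be shrunk.
  wlog hs : ∀ z ∈ s, e.symm z ∈ U generalizing s
  · have h1 : s ∩ e.symm ⁻¹' U ⊆ s := Set.inter_subset_left
    refine this (hY.mono hso h1) (h.mono hso h1) ⟨hz, hU⟩ ?_ fun z hz => hz.2
    rwa [Set.inter_assoc, Set.inter_self]
  have hc : ContinuousOn (fun z => ip (SpacelikeWillmore.eulerLagrange Y z) (L z)) s :=
    (smooth_ip h.smooth_eulerLagrange h.smooth_L).continuousOn
  -- The fundamental lemma of the calculus of variations, with `φ` as test function in the variation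
  -- `[Y + tφL]`; continuity upgrades almost everywhere to everywhere.
  have hae := h.isOpen.ae_eq_zero_of_integral_contDiff_smul_eq_zero (μ := volume)
    (hc.locallyIntegrableOn h.isOpen.measurableSet) fun φ hφ hφc hφs => ?_
  · have h1 := Measure.eqOn_open_of_ae_eq (μ := volume) (g := fun _ => (0 : ℝ))
      ((ae_restrict_iff' h.isOpen.measurableSet).2 hae) h.isOpen hc continuousOn_const
    exact h1 hz
  · have hf := h.isVariation hY hs hy.spacelike.smooth hφ hφc hφs
    have hF := h.isFamilyLift hY hφ
    set K := e.symm '' tsupport φ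
    have him : e '' K = tsupport φ := by
      rw [Set.image_image]
      exact (Set.image_congr fun z hz => e.right_inv (hY.subset (hφs hz))).trans (Set.image_id' _)
    have hKe : K ⊆ e.source := by
      rintro _ ⟨z, hz, rfl⟩; exact e.map_target (hY.subset (hφs hz))
    -- The support lies in one coordinate domain, so it serves as a dissection with a single piece.
    have hdis : IsDissection U K (fun _ : Fin 1 => e) (fun _ => K) :=
      { coord := fun _ => hY.coord
        compact := fun _ => ⟨K, hf.compact, subset_rfl, fun p hp => ⟨hKe hp, hf.subset hp⟩⟩
        measurable := fun _ => by rw [him]; exact (isClosed_tsupport φ).measurableSet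
        disjoint := fun i j hij => absurd (Subsingleton.elim i j) hij
        cover := Set.subset_iUnion (fun _ : Fin 1 => K) 0 }
    have h1 := (hf.hasDerivAt_willmoreFunctional hy.spacelike hdis).unique
      (hy.critical K _ hf 1 _ _ hdis)
    have hvel : ∀ z ∈ s, dirDeriv (1, 0) (fun q : ℝ × ℂ => Y q.2 + q.1 • φ q.2 • L q.2) (0, z)
        = φ z • L z := fun z hz => by
      have h2 := hasDerivAt_line hF.isOpen hF.smooth (p := (0, z)) hz
      refine h2.unique ?_
      have h3 := ((hasDerivAt_id (0 : ℝ)).smul_const (φ z • L z)).const_add (Y z)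
      simpa using h3
    simp only [Finset.univ_unique, Finset.sum_singleton] at h1
    rw [setIntegral_variationDensity hf hy.spacelike hF h.toIsCanonical hY.subset
      (fun z hz => ⟨hz, by simp⟩) hs hKe (by rw [him]; exact hφs)] at h1
    · rw [← h1, ← setIntegral_eq_integral_of_forall_compl_eq_zero (s := s)]
      · refine setIntegral_congr_fun h.isOpen.measurableSet fun z hz => ?_
        simp only [hvel z hz, ip_smul_right, smul_eq_mul]
      · intro z hz
        rw [image_eq_zero_of_notMem_tsupport fun h => hz (hφs h), zero_smul]
    · intro z hz hzK
      rw [hvel z hz, image_eq_zero_of_notMem_tsupport fun h => hzK ⟨z, h, rfl⟩, zero_smul]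

end

/-! ### Solutions of the Euler-Lagrange equation are Willmore surfaces -/

theorem jet_add {f g : ℂ → R62} {s : Set ℂ} (hs : IsOpen s) (hf : ContDiffOn ℝ ∞ f s)
    (hg : ContDiffOn ℝ ∞ g s) {z : ℂ} (hz : z ∈ s) :
    jet (fun w => f w + g w) z = jet f z + jet g z := by
  have hu : Set.EqOn (du fun w => f w + g w) (fun w => du f w + du g w) s := fun w hw =>
    du_add (diff_at hs hf hw) (diff_at hs hg hw)
  have hv : Set.EqOn (dv fun w => f w + g w) (fun w => dv f w + dv g w) s := fun w hw =>
    dv_add (diff_at hs hf hw) (diff_at hs hg hw)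
  have fu := smooth_du hs hf
  have fv := smooth_dv hs hf
  have gu := smooth_du hs hg
  have gv := smooth_dv hs hg
  unfold jet
  rw [hu hz, hv hz, du_congr_on hs hu hz, du_congr_on hs hv hz, dv_congr_on hs hv hz,
    du_add (diff_at hs fu hz) (diff_at hs gu hz), du_add (diff_at hs fv hz) (diff_at hs gv hz),
    dv_add (diff_at hs fv hz) (diff_at hs gv hz)]
  rfl

theorem jet_sum {ι : Type*} (T : Finset ι) {g : ι → ℂ → R62} {s : Set ℂ} (hs : IsOpen s)
    (hg : ∀ i, ContDiffOn ℝ ∞ (g i) s) {z : ℂ} (hz : z ∈ s) :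
    jet (fun w => ∑ i ∈ T, g i w) z = ∑ i ∈ T, jet (g i) z := by
  classical
  induction T using Finset.induction_on with
  | empty => simp only [Finset.sum_empty]; exact jet_zero z
  | insert i T hi ih =>
    simp only [Finset.sum_insert hi]
    rw [jet_add hs (hg i) (ContDiffOn.sum fun j _ => hg j) hz, ih]

section

variable {M : Type*} [TopologicalSpace M] [ChartedSpace ℂ M]
  {e c : OpenPartialHomeomorph M ℂ} {y : M → Q41} {U K : Set M} {f : ℝ → M → Q41} {s : Set ℂ}
  {Y L R : ℂ → R62} {z : ℂ} {ψ : M → ℝ}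

/-- A variation whose speed is multiplied by a function. -/
theorem IsVariation.cut (hf : IsVariation y U K f) (hψ : ContMDiff 𝓘(ℝ, ℂ) 𝓘(ℝ, ℝ) ∞ ψ)
    (hψ1 : ∀ p, |ψ p| ≤ 1) : IsVariation y U (K ∩ tsupport ψ) (fun t p => f (t * ψ p) p) := by
  refine ⟨hf.compact.inter_right (isClosed_tsupport ψ), fun p hp => hf.subset hp.1, ?_,
    fun t p hp => ?_, ?_⟩
  · ext1 p; simp [hf.start]
  · by_cases hpK : p ∈ K
    · have h1 : p ∉ tsupport ψ := fun h => hp ⟨hpK, h⟩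
      simp [image_eq_zero_of_notMem_tsupport h1, hf.start]
    · exact hf.fixed _ p hpK
  · obtain ⟨ε, hε, h⟩ := hf.smooth
    refine ⟨ε, hε, fun t ht p hp => ?_⟩
    -- The bound `|ψ| ≤ 1` keeps the rescaled time inside the interval where the family is smooth.
    have h1 : |t * ψ p| < ε := by
      rw [abs_mul]
      exact (mul_le_of_le_one_right (abs_nonneg t) (hψ1 p)).trans_lt ht
    have h2 : ContMDiffAt (𝓘(ℝ, ℝ).prod 𝓘(ℝ, ℂ)) (𝓘(ℝ, ℝ).prod 𝓘(ℝ, ℂ)) ∞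
        (fun q : ℝ × M => (q.1 * ψ q.2, q.2)) (t, p) := by
      refine ContMDiffAt.prodMk ?_ contMDiffAt_snd
      exact contMDiffAt_fst.mul ((hψ p).comp (t, p) contMDiffAt_snd)
    exact ContMDiffAt.comp (t, p) (h _ h1 p hp) h2

/-- Cutting off in time rather than in the target keeps the maps inside the quadric, and the chain
rule multiplies the initial velocity by `ψ`. -/
theorem IsVariation.variationDensity_cut [IsManifold 𝓘(ℂ) ω M] (hf : IsVariation y U K f)
    (hy : IsConformalSpacelikeOn y U) (hψ : ContMDiff 𝓘(ℝ, ℂ) 𝓘(ℝ, ℝ) ∞ ψ)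
    (hψ1 : ∀ p, |ψ p| ≤ 1) {O : Set (ℝ × ℂ)} {F : ℝ × ℂ → R62} (hF : IsFamilyLift e f O F)
    (hz : (0, z) ∈ O) (hU : e.symm z ∈ U) :
    variationDensity e (fun t p => f (t * ψ p) p) z =
      fderiv ℝ jetWillmore (jet (fun w => F (0, w)) z)
        (jet (fun w => ψ (e.symm w) • dirDeriv (1, 0) F (0, w)) z) := by
  have hψe : ContDiffOn ℝ ∞ (fun w => ψ (e.symm w)) e.target := fun w hw => by
    have := (contMDiffAt_iff_coord hF.coord (e.map_target hw)).1 (hψ _)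
    rw [e.right_inv hw] at this
    exact this.contDiffWithinAt
  have hg : ContDiffOn ℝ ∞ (fun q : ℝ × ℂ => (q.1 * ψ (e.symm q.2), q.2))
      (Prod.snd ⁻¹' e.target) :=
    (contDiffOn_fst.mul (hψe.comp contDiffOn_snd fun q hq => hq)).prodMk contDiffOn_snd
  set O' : Set (ℝ × ℂ) :=
    Prod.snd ⁻¹' e.target ∩ (fun q : ℝ × ℂ => (q.1 * ψ (e.symm q.2), q.2)) ⁻¹' O
  have hO' : IsOpen O' := hg.continuousOn.isOpen_inter_preimage
    (e.open_target.preimage continuous_snd) hF.isOpen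
  have hF' : IsFamilyLift e (fun t p => f (t * ψ p) p) O'
      (fun q => F (q.1 * ψ (e.symm q.2), q.2)) :=
    ⟨hF.coord, hO', fun q hq => hq.1, hF.smooth.comp (hg.mono fun q hq => hq.1) fun q hq => hq.2,
      fun q hq => hF.lift _ hq.2⟩
  have hmem : ∀ w, (0, w) ∈ O → (0, w) ∈ O' := fun w hw =>
    ⟨hF.subset _ hw, by simpa using hw⟩
  rw [(hf.cut hψ hψ1).variationDensity_eq hy hF' (hmem z hz) hU]
  simp only [zero_mul]
  congr 1
  refine jet_congr_on (isOpen_slice hF.isOpen 0) (fun w hw => ?_) hz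
  have h1 := hasDerivAt_line hF'.isOpen hF'.smooth (hmem w hw)
  have h2 : HasDerivAt (fun t => F (t, w)) (dirDeriv (1, 0) F (0, w)) (0 * ψ (e.symm w)) := by
    rw [zero_mul]; exact hasDerivAt_line hF.isOpen hF.smooth hw
  have h3 : HasDerivAt (fun t : ℝ => t * ψ (e.symm w)) (ψ (e.symm w)) 0 := by
    simpa using (hasDerivAt_id (0 : ℝ)).mul_const (ψ (e.symm w))
  have h4 : HasDerivAt (fun t => F (t * ψ (e.symm w), w))
      (ψ (e.symm w) • dirDeriv (1, 0) F (0, w)) 0 :=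
    HasDerivAt.scomp (g₁ := fun t => F (t, w)) (0 : ℝ) h2 h3
  exact h1.unique h4

/-- Decomposition of the first variation by a partition of unity. -/
theorem IsVariation.sum_variationDensity_cut [IsManifold 𝓘(ℂ) ω M] (hf : IsVariation y U K f)
    (hy : IsConformalSpacelikeOn y U) {ι : Type*} [Fintype ι] {ψ : ι → M → ℝ}
    (hψ : ∀ i, ContMDiff 𝓘(ℝ, ℂ) 𝓘(ℝ, ℝ) ∞ (ψ i)) (hψ1 : ∀ i p, |ψ i p| ≤ 1)
    (hsum : ∀ p ∈ K, ∑ i, ψ i p = 1) (he : IsCoord e) (hz : z ∈ e.target) (hU : e.symm z ∈ U) :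
    variationDensity e f z = ∑ i, variationDensity e (fun t p => f (t * ψ i p) p) z := by
  obtain ⟨s₀, Y, hY, hzs, hs⟩ := exists_localLift hy.isOpen hy.smooth he hU (e.map_target hz)
  rw [e.right_inv hz] at hzs
  obtain ⟨O, F, hF, -, h0, hfix⟩ := hf.exists_familyLift hY hs
  have hψe : ∀ i, ContDiffOn ℝ ∞ (fun w => ψ i (e.symm w)) s₀ := fun i w hw => by
    have hw' := hY.subset hw
    have := (contMDiffAt_iff_coord he (e.map_target hw')).1 (hψ i _)
    rw [e.right_inv hw'] at this
    exact this.contDiffWithinAt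
  have hW : ContDiffOn ℝ ∞ (fun w => dirDeriv (1, 0) F (0, w)) s₀ :=
    (smooth_slice (smooth_dirDeriv hF.isOpen hF.smooth _) 0).mono fun z hz => (h0 z hz).1
  simp only [fun i => hf.variationDensity_cut hy (hψ i) (hψ1 i) hF (h0 z hzs).1 hU]
  rw [hf.variationDensity_eq hy hF (h0 z hzs).1 hU, ← map_sum,
    ← jet_sum Finset.univ (g := fun i w => ψ i (e.symm w) • dirDeriv (1, 0) F (0, w)) hY.isOpen
      (fun i => (hψe i).smul hW) hzs]
  congr 1
  refine jet_congr_on hY.isOpen (fun w hw => ?_) hzs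
  -- The functions add up to `1` only on `K`; off `K` the velocity itself is zero.
  by_cases hwK : e.symm w ∈ K
  · simp only [← Finset.sum_smul, hsum _ hwK, one_smul]
  · have h1 := hasDerivAt_line hF.isOpen hF.smooth (h0 w hw).1
    have h2 : (fun t => F (t, w)) = fun _ => Y w := funext fun t => hfix t w hw hwK
    simp only [h2] at h1
    have h3 := h1.unique (hasDerivAt_const _ _)
    simp only [h3, smul_zero, Finset.sum_const_zero]

/-- A surface with frames that solve the Euler-Lagrange equation is a Willmore surface. -/
theorem IsConformalSpacelikeOn.isSpacelikeWillmoreOn [IsManifold 𝓘(ℂ) ω M] [T2Space M]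
    [SecondCountableTopology M]
    (hy : IsConformalSpacelikeOn y U)
    (h : ∀ p ∈ U, ∃ (e : OpenPartialHomeomorph M ℂ) (s : Set ℂ) (Y L R : ℂ → R62),
      IsLocalLift y e s Y ∧ IsFrame s Y L R ∧ p ∈ e.source ∧ e p ∈ s ∧
      ∀ z ∈ s, ip (eulerLagrange Y z) (L z) = 0 ∧ ip (eulerLagrange Y z) (R z) = 0) :
    IsSpacelikeWillmoreOn y U := by
  have := isManifold_real (M := M)
  have : LocallyCompactSpace M := ChartedSpace.locallyCompactSpace ℂ M
  refine ⟨hy, fun K f hf n e A hA => ?_⟩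
  have h' : ∀ p : K, ∃ (c : OpenPartialHomeomorph M ℂ) (s : Set ℂ) (Y L R : ℂ → R62),
      IsLocalLift y c s Y ∧ IsFrame s Y L R ∧ (p : M) ∈ c.source ∧ c p ∈ s ∧
      (∀ z ∈ s, ip (eulerLagrange Y z) (L z) = 0 ∧ ip (eulerLagrange Y z) (R z) = 0) ∧
      ∀ z ∈ s, c.symm z ∈ U := fun p => by
    obtain ⟨c, s, Y, L, R, h1, h2, h3, h4, h5⟩ := h p (hf.subset p.2)
    have ho : IsOpen (s ∩ c.symm ⁻¹' U) :=
      (c.continuousOn_symm.mono h1.subset).isOpen_inter_preimage h1.isOpen hy.isOpen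
    have hs : s ∩ c.symm ⁻¹' U ⊆ s := Set.inter_subset_left
    refine ⟨c, s ∩ c.symm ⁻¹' U, Y, L, R, h1.mono ho hs, h2.mono ho hs, h3, ⟨h4, ?_⟩,
      fun z hz => h5 z (hs hz), fun z hz => hz.2⟩
    rw [Set.mem_preimage, c.left_inv h3]; exact hf.subset p.2
  choose c s Y L R hY hfr hpc hps hE hs using h'
  have hopen : ∀ p, IsOpen ((c p).source ∩ c p ⁻¹' s p) := fun p =>
    (c p).isOpen_inter_preimage (hY p).isOpen
  obtain ⟨T, hT⟩ := hf.compact.elim_finite_subcover _ hopen fun p hp =>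
    Set.mem_iUnion.2 ⟨⟨p, hp⟩, hpc ⟨p, hp⟩, hps ⟨p, hp⟩⟩
  obtain ⟨ψ, hψ⟩ := SmoothPartitionOfUnity.exists_isSubordinate 𝓘(ℝ, ℂ) hf.compact.isClosed
    (fun p : T => (c p).source ∩ c p ⁻¹' s p) (fun p => hopen p) (by
      intro p hp
      obtain ⟨q, hq, hpq⟩ := Set.mem_iUnion₂.1 (hT hp)
      exact Set.mem_iUnion.2 ⟨⟨q, hq⟩, hpq⟩)
  have hψs : ∀ i, ContMDiff 𝓘(ℝ, ℂ) 𝓘(ℝ, ℝ) ∞ (ψ i) := fun i => (ψ i).contMDiff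
  have hψ1 : ∀ i p, |ψ i p| ≤ 1 := fun i p => by
    rw [abs_of_nonneg (ψ.nonneg i p)]; exact ψ.le_one i p
  have hsum : ∀ p ∈ K, ∑ i, ψ i p = 1 := fun p hp => by
    rw [← finsum_eq_sum_of_fintype]; exact ψ.sum_eq_one hp
  have hcut : ∀ i : T, IsVariation y U (K ∩ tsupport (ψ i)) (fun t p => f (t * ψ i p) p) :=
    fun i => hf.cut (hψs i) (hψ1 i)
  -- The first variation is linear in the velocity, so it is the sum of those of the cut-off
  -- variations, each supported in the domain of one frame solving the Euler-Lagrange equation.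
  have key : ∑ i, ∫ z in e i '' A i, variationDensity (e i) f z = 0 := by
    have h1 : ∀ i, ∫ z in e i '' A i, variationDensity (e i) f z = ∑ j : T,
        ∫ z in e i '' A i, variationDensity (e i) (fun t p => f (t * ψ j p) p) z := fun i => by
      obtain ⟨C, hC, hAC, hCU⟩ := hA.compact i
      have hmem : ∀ z ∈ e i '' C, z ∈ (e i).target ∩ (e i).symm ⁻¹' U := by
        rintro _ ⟨p, hp, rfl⟩
        refine ⟨(e i).map_source (hCU hp).1, ?_⟩
        rw [Set.mem_preimage, (e i).left_inv (hCU hp).1]; exact (hCU hp).2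
      rw [← integral_finsetSum]
      · refine setIntegral_congr_fun (hA.measurable i) fun z hz => ?_
        obtain ⟨h3, h4⟩ := hmem z (Set.image_mono hAC hz)
        exact hf.sum_variationDensity_cut hy hψs hψ1 hsum (hA.coord i) h3 h4
      · intro j _
        refine (ContinuousOn.integrableOn_compact (hC.image_of_continuousOn
          ((e i).continuousOn.mono fun p hp => (hCU hp).1))
          (((hcut j).continuousOn_variationDensity hy (hA.coord i)).mono hmem)).mono_set
          (Set.image_mono hAC)
    rw [Finset.sum_congr rfl fun i _ => h1 i, Finset.sum_comm]
    refine Finset.sum_eq_zero fun j _ => ?_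
    have hsub : K ∩ tsupport (ψ j) ⊆ (c j).source := fun p hp => (hψ j hp.2).1
    have hA' : IsDissection U (K ∩ tsupport (ψ j)) e A :=
      ⟨hA.coord, hA.compact, hA.measurable, hA.disjoint, fun p hp => hA.cover hp.1⟩
    rw [(hcut j).sum_integral_eq hy (hY j).coord hsub hA']
    refine (hfr j).integral_variationDensity_eq_zero (hY j) (fun z hz => (hE j z hz).1)
      (fun z hz => (hE j z hz).2) (hs j) hy (hcut j) hsub ?_
    rintro _ ⟨p, hp, rfl⟩
    exact (hψ j hp.2).2
  have := hf.hasDerivAt_willmoreFunctional hy hA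
  rwa [key] at this

end

/-! ### Oriented frames of a surface -/

section OrientedFrames

variable {M : Type*} [TopologicalSpace M] [ChartedSpace ℂ M] {e c : OpenPartialHomeomorph M ℂ}
  {y : M → Q41} {s s' : Set ℂ} {Y N L R Y' L' R' : ℂ → R62} {z : ℂ} {ε : ℝ}

/-- A canonical lift of `y` with null normal fields `L`, `R` whose orientation is the sign of
`ε`. For `ε = 1` it is an adapted frame, for `ε = -1` it is one after exchanging `L` and `R`. -/
structure IsOrientedFrame (ε : ℝ) (y : M → Q41) (e : OpenPartialHomeomorph M ℂ) (s : Set ℂ)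
    (Y L R : ℂ → R62) : Prop where
  lift : IsLocalLift y e s Y
  frame : IsFrame s Y L R
  oriented : ∀ z ∈ s, 0 < ε * frameDet Y L R z

theorem IsOrientedFrame.mono (h : IsOrientedFrame ε y e s Y L R) (hs' : IsOpen s') (hss : s' ⊆ s) :
    IsOrientedFrame ε y e s' Y L R :=
  ⟨h.lift.mono hs' hss, h.frame.mono hs' hss, fun z hz => h.oriented z (hss hz)⟩

theorem IsOrientedFrame.swap (h : IsOrientedFrame ε y e s Y L R) :
    IsOrientedFrame (-ε) y e s Y R L :=
  ⟨h.lift, h.frame.swap, fun z hz => by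
    rw [IsFrame.frameDet_swap, neg_mul_neg]; exact h.oriented z hz⟩

theorem IsAdaptedFrame.isFrame (h : IsAdaptedFrame y e s Y N L R) : IsFrame s Y L R :=
  have hY : ∀ z, Y z ∈ Submodule.span ℝ {Y z, du Y z, dv Y z, lap Y z} := fun z =>
    Submodule.subset_span (by simp)
  have hu : ∀ z, du Y z ∈ Submodule.span ℝ {Y z, du Y z, dv Y z, lap Y z} := fun z =>
    Submodule.subset_span (by simp)
  have hv : ∀ z, dv Y z ∈ Submodule.span ℝ {Y z, du Y z, dv Y z, lap Y z} := fun z =>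
    Submodule.subset_span (by simp)
  have hl : ∀ z, lap Y z ∈ Submodule.span ℝ {Y z, du Y z, dv Y z, lap Y z} := fun z =>
    Submodule.subset_span (by simp)
  { isOpen := h.lift.isOpen
    smooth := h.lift.smooth
    null := h.lift.null
    uu := fun z hz => (h.canonical z hz).1
    vv := fun z hz => (h.canonical z hz).2.1
    uv := fun z hz => (h.canonical z hz).2.2
    smooth_L := h.smooth_L
    smooth_R := h.smooth_R
    LY := fun z hz => (h.normal z hz _ (hY z)).1
    LU := fun z hz => (h.normal z hz _ (hu z)).1
    LV := fun z hz => (h.normal z hz _ (hv z)).1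
    LH := fun z hz => (h.normal z hz _ (hl z)).1
    RY := fun z hz => (h.normal z hz _ (hY z)).2
    RU := fun z hz => (h.normal z hz _ (hu z)).2
    RV := fun z hz => (h.normal z hz _ (hv z)).2
    RH := fun z hz => (h.normal z hz _ (hl z)).2
    LL := fun z hz => (h.null z hz).1
    RR := fun z hz => (h.null z hz).2.1
    LR := fun z hz => (h.null z hz).2.2 }

/-- Nullity of `N` together with `⟨N, Y⟩ = -1` forces `⟨N, dualN⟩ = 0`, after which all frame
components agree. -/
theorem IsAdaptedFrame.eq_dualN (h : IsAdaptedFrame y e s Y N L R) (hz : z ∈ s) :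
    N z = dualN Y z := by
  have hf := h.isFrame.nullFrame hz
  obtain ⟨h1, h2, h3, h4⟩ := h.N_eq z hz
  obtain ⟨h5, h6⟩ := h.normal z hz _ (h.N_mem z hz)
  rw [ip_comm] at h5 h6
  have h7 := hf.ip_expand (N z) (N z)
  rw [h1, h2, h3, h4, h5, h6] at h7
  have h8 : ip (N z) (dualN Y z) = 0 := by linarith
  rw [hf.expand (N z), h1, h2, h4, h5, h6, h8]
  simp

theorem IsAdaptedFrame.isOrientedFrame (h : IsAdaptedFrame y e s Y N L R) :
    IsOrientedFrame 1 y e s Y L R :=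
  ⟨h.lift, h.isFrame, fun z hz => by
    rw [one_mul, frameDet, ← h.eq_dualN hz]; exact h.oriented z hz⟩

theorem IsFrame.normal_span (h : IsFrame s Y L R) (hz : z ∈ s) {x : R62}
    (hx : x ∈ Submodule.span ℝ {Y z, du Y z, dv Y z, lap Y z}) : ip (L z) x = 0 := by
  have h1 : Submodule.span ℝ {Y z, du Y z, dv Y z, lap Y z}
      ≤ LinearMap.ker (ipL (L z) : R62 →ₗ[ℝ] ℝ) := by
    rw [Submodule.span_le]
    rintro w (rfl | rfl | rfl | rfl)
    exacts [h.LY z hz, h.LU z hz, h.LV z hz, h.LH z hz]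
  exact h1 hx

theorem IsOrientedFrame.isAdaptedFrame (h : IsOrientedFrame 1 y e s Y L R) :
    IsAdaptedFrame y e s Y (dualN Y) L R where
  lift := h.lift
  smooth_N := h.frame.smooth_dualN
  smooth_L := h.frame.smooth_L
  smooth_R := h.frame.smooth_R
  canonical := fun z hz => ⟨h.frame.uu z hz, h.frame.vv z hz, h.frame.uv z hz⟩
  N_mem := fun z _ => Submodule.add_mem _
    (Submodule.smul_mem _ _ (Submodule.subset_span (by simp)))
    (Submodule.smul_mem _ _ (Submodule.subset_span (by simp)))
  N_eq := fun z hz => by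
    have hf := h.frame.nullFrame hz
    exact ⟨by rw [ip_comm]; exact hf.UN, by rw [ip_comm]; exact hf.VN, hf.NN,
      by rw [ip_comm]; exact hf.YN⟩
  normal := fun z hz x hx => ⟨h.frame.normal_span hz hx, h.frame.swap.normal_span hz hx⟩
  null := fun z hz => ⟨h.frame.LL z hz, h.frame.RR z hz, h.frame.LR z hz⟩
  oriented := fun z hz => by
    have h1 := h.oriented z hz
    rwa [one_mul] at h1

/-- On `U`, the surface `l` is given by the field `L` of oriented frames of `y`. -/
def IsPolarOn (ε : ℝ) (y l : M → Q41) (U : Set M) : Prop :=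
  ∀ p ∈ U, ∃ (e : OpenPartialHomeomorph M ℂ) (s : Set ℂ) (Y L R : ℂ → R62),
    IsOrientedFrame ε y e s Y L R ∧ p ∈ e.source ∧ e p ∈ s ∧
      ∀ z ∈ s, Represents (L z) (l (e.symm z))

theorem isLeftPolarOn_iff {l : M → Q41} {U : Set M} : IsLeftPolarOn y l U ↔ IsPolarOn 1 y l U := by
  refine forall₂_congr fun p _ => ⟨?_, ?_⟩
  · rintro ⟨e, s, Y, N, L, R, h, h1, h2, h3⟩
    exact ⟨e, s, Y, L, R, h.isOrientedFrame, h1, h2, h3⟩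
  · rintro ⟨e, s, Y, L, R, h, h1, h2, h3⟩
    exact ⟨e, s, Y, dualN Y, L, R, h.isAdaptedFrame, h1, h2, h3⟩

/-- A right polar field becomes a left one after the two null normals are exchanged, at the price of
the opposite orientation. -/
theorem isRightPolarOn_iff {r : M → Q41} {U : Set M} :
    IsRightPolarOn y r U ↔ IsPolarOn (-1) y r U := by
  refine forall₂_congr fun p _ => ⟨?_, ?_⟩
  · rintro ⟨e, s, Y, N, L, R, h, h1, h2, h3⟩
    exact ⟨e, s, Y, R, L, h.isOrientedFrame.swap, h1, h2, h3⟩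
  · rintro ⟨e, s, Y, L, R, h, h1, h2, h3⟩
    have h' := h.swap
    rw [neg_neg] at h'
    exact ⟨e, s, Y, dualN Y, R, L, h'.isAdaptedFrame, h1, h2, h3⟩

/-- The points at which the polar surface `[L]` is non-degenerate. -/
def nondegenerateSet (ε : ℝ) (y : M → Q41) : Set M :=
  {p | ∃ (e : OpenPartialHomeomorph M ℂ) (s : Set ℂ) (Y L R : ℂ → R62),
    IsOrientedFrame ε y e s Y L R ∧ p ∈ e.source ∧ e p ∈ s ∧ ip (du L (e p)) (du L (e p)) ≠ 0}

-- Hopf coefficients and non-degeneracy.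

theorem dz_dz_toC (hs : IsOpen s) (hY : ContDiffOn ℝ ∞ Y s) (hz : z ∈ s) :
    dz (dz fun w => toC (Y w)) z
      = (1 / 2 : ℂ) • toC (hopfRe Y z) - (Complex.I / 2) • toC (du (dv Y) z) := by
  have hu := smooth_du hs hY
  have hv := smooth_dv hs hY
  have h1 : Set.EqOn (dz fun w => toC (Y w))
      (fun w => (1 / 2 : ℂ) • (toC (du Y w) - Complex.I • toC (dv Y w))) s := fun w hw => by
    unfold dz
    rw [show du (fun w => toC (Y w)) w = toC (du Y w) from fderiv_toC (diff_at hs hY hw) 1,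
      show dv (fun w => toC (Y w)) w = toC (dv Y w) from fderiv_toC (diff_at hs hY hw) Complex.I]
  have d1 : DifferentiableAt ℝ (fun w => toC (du Y w)) z :=
    toCL.differentiableAt.comp z (diff_at hs hu hz)
  have d2 : DifferentiableAt ℝ (fun w => toC (dv Y w)) z :=
    toCL.differentiableAt.comp z (diff_at hs hv hz)
  have h2 : ∀ a : ℂ, fderiv ℝ (dz fun w => toC (Y w)) z a = (1 / 2 : ℂ) •
      (toC (fderiv ℝ (du Y) z a) - Complex.I • toC (fderiv ℝ (dv Y) z a)) := fun a => by
    rw [fderiv_congr_on hs h1 hz, fderiv_fun_const_smul (d1.fun_sub (d2.fun_const_smul _)),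
      fderiv_fun_sub d1 (d2.fun_const_smul _), fderiv_fun_const_smul d2]
    simp only [smul_apply, sub_apply]
    rw [fderiv_toC (diff_at hs hu hz), fderiv_toC (diff_at hs hv hz)]
  have hc : dv (du Y) z = du (dv Y) z := dv_du_comm (smooth_at hs hY hz)
  have h3 : dz (dz fun w => toC (Y w)) z = (1 / 2 : ℂ) •
      ((1 / 2 : ℂ) • (toC (du (du Y) z) - Complex.I • toC (du (dv Y) z))
        - Complex.I • ((1 / 2 : ℂ) • (toC (dv (du Y) z) - Complex.I • toC (dv (dv Y) z)))) := by
    have hu' : du (dz fun w => toC (Y w)) z = _ := h2 1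
    have hv' : dv (dz fun w => toC (Y w)) z = _ := h2 Complex.I
    rw [dz, hu', hv']
    rfl
  rw [h3, hc]
  ext i
  simp only [hopfRe, toC, Pi.smul_apply, Pi.sub_apply, smul_eq_mul, Complex.ofReal_mul,
    Complex.ofReal_sub, Complex.ofReal_div, Complex.ofReal_one, Complex.ofReal_ofNat]
  linear_combination ((dv (dv Y) z i : ℂ) / 4) * Complex.I_sq

theorem IsFrame.hopfCoefficients (h : IsFrame s Y L R) (hz : z ∈ s) :
    HopfCoefficients Y L R z (ip (hopfRe Y z) (dualN Y z) - Complex.I * ip (du (dv Y) z) (dualN Y z))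
      (-(1 / 2) * (ip (hopfRe Y z) (R z) - Complex.I * ip (du (dv Y) z) (R z)))
      (-(1 / 2) * (ip (hopfRe Y z) (L z) - Complex.I * ip (du (dv Y) z) (L z))) := by
  have hN := h.nullFrame hz
  have h1 := hN.expand (hopfRe Y z)
  have h2 := hN.expand (du (dv Y) z)
  rw [h.hopfRe_Y hz, h.hopfRe_u hz, h.hopfRe_v hz] at h1
  rw [h.uvY hz, h.uvu hz, h.uvv hz] at h2
  rw [HopfCoefficients, dz_dz_toC h.isOpen h.smooth hz]
  ext i
  have e1 := congrArg (fun x : R62 => (x i : ℂ)) h1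
  have e2 := congrArg (fun x : R62 => (x i : ℂ)) h2
  simp only [Pi.add_apply, Pi.sub_apply, Pi.smul_apply, smul_eq_mul, Complex.ofReal_add,
    Complex.ofReal_sub, Complex.ofReal_mul, Complex.ofReal_neg, Complex.ofReal_zero] at e1 e2
  simp only [Pi.add_apply, Pi.sub_apply, Pi.smul_apply, smul_eq_mul, toC]
  linear_combination (1 / 2) * e1 - (Complex.I / 2) * e2

/-- Pairing with `L` isolates `l₂`, because `L` is null, orthogonal to `Y`, and `⟨L, R⟩ = -1`. -/
theorem IsFrame.hopfCoefficients_unique (h : IsFrame s Y L R) (hz : z ∈ s) {σ l₁ l₂ : ℂ}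
    (hH : HopfCoefficients Y L R z σ l₁ l₂) :
    l₂ = -(1 / 2) * (ip (hopfRe Y z) (L z) - Complex.I * ip (du (dv Y) z) (L z)) := by
  rw [HopfCoefficients, dz_dz_toC h.isOpen h.smooth hz] at hH
  have := congrArg (fun x => ipC x (toC (L z))) hH
  simp only [sub_eq_add_neg, ← neg_smul, ipC_add_left, ipC_smul_left, ipC_toC, h.LL z hz,
    ip_comm (Y z) (L z), h.LY z hz, ip_comm (R z) (L z), h.LR z hz] at this
  push_cast at this
  linear_combination this

/-- Both conditions say that `P² + Q² ≠ 0`: this is `4|λ₂|²` and also the conformal factor of the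
metric of `L`. -/
theorem IsFrame.exists_hopfCoefficients_iff (h : IsFrame s Y L R) (hz : z ∈ s) :
    (∃ σ l₁ l₂, HopfCoefficients Y L R z σ l₁ l₂ ∧ l₂ ≠ 0) ↔ ip (du L z) (du L z) ≠ 0 := by
  have key : -(1 / 2) * ((ip (hopfRe Y z) (L z) : ℂ) - Complex.I * ip (du (dv Y) z) (L z)) ≠ 0 ↔
      ip (du L z) (du L z) ≠ 0 := by
    rw [(h.metric_L hz).1, not_iff_not]
    constructor
    · intro h0
      have h1 := congrArg Complex.re h0
      have h2 := congrArg Complex.im h0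
      simp at h1 h2
      rw [h1, h2]; ring
    · intro h0
      have h1 : ip (hopfRe Y z) (L z) = 0 := by nlinarith [sq_nonneg (ip (du (dv Y) z) (L z))]
      have h2 : ip (du (dv Y) z) (L z) = 0 := by nlinarith [sq_nonneg (ip (hopfRe Y z) (L z))]
      rw [h1, h2]; simp
  rw [← key]
  constructor
  · rintro ⟨σ, l₁, l₂, h1, h2⟩
    rwa [h.hopfCoefficients_unique hz h1] at h2
  · intro h1
    exact ⟨_, _, _, h.hopfCoefficients hz, h1⟩

theorem HopfCoefficients.swap {σ l₁ l₂ : ℂ} (h : HopfCoefficients Y L R z σ l₁ l₂) :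
    HopfCoefficients Y R L z σ l₂ l₁ := by
  rw [HopfCoefficients] at h ⊢
  rw [h]; abel

theorem lam2NeZero_eq (y : M → Q41) : lam2NeZero y = nondegenerateSet 1 y := by
  ext p
  constructor
  · rintro ⟨e, s, Y, N, L, R, σ, l₁, l₂, h, h1, h2, h3, h4⟩
    exact ⟨e, s, Y, L, R, h.isOrientedFrame, h1, h2,
      (h.isFrame.exists_hopfCoefficients_iff h2).1 ⟨σ, l₁, l₂, h3, h4⟩⟩
  · rintro ⟨e, s, Y, L, R, h, h1, h2, h3⟩
    obtain ⟨σ, l₁, l₂, h4, h5⟩ := (h.frame.exists_hopfCoefficients_iff h2).2 h3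
    exact ⟨e, s, Y, dualN Y, L, R, σ, l₁, l₂, h.isAdaptedFrame, h1, h2, h4, h5⟩

theorem lam1NeZero_eq (y : M → Q41) : lam1NeZero y = nondegenerateSet (-1) y := by
  ext p
  constructor
  · rintro ⟨e, s, Y, N, L, R, σ, l₁, l₂, h, h1, h2, h3, h4⟩
    exact ⟨e, s, Y, R, L, h.isOrientedFrame.swap, h1, h2,
      (h.isFrame.swap.exists_hopfCoefficients_iff h2).1 ⟨σ, l₂, l₁, h3.swap, h4⟩⟩
  · rintro ⟨e, s, Y, L, R, h, h1, h2, h3⟩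
    obtain ⟨σ, l₁, l₂, h4, h5⟩ := (h.frame.exists_hopfCoefficients_iff h2).2 h3
    have h' := h.swap
    rw [neg_neg] at h'
    exact ⟨e, s, Y, dualN Y, R, L, σ, l₂, l₁, h'.isAdaptedFrame, h1, h2, h4.swap, h5⟩

end OrientedFrames

/-! ### Frames in different coordinates -/

section Comp

variable {s t : Set ℂ} {Y L R X Z : ℂ → R62} {z : ℂ} {φ : ℂ → ℂ} {r : ℂ → ℝ}

theorem ip_lap_of_normal (ht : IsOpen t) (hX : ContDiffOn ℝ ∞ X t) (hZ : ContDiffOn ℝ ∞ Z t)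
    (hu : ∀ w ∈ t, ip (X w) (du Z w) = 0) (hv : ∀ w ∈ t, ip (X w) (dv Z w) = 0) (hz : z ∈ t) :
    ip (X z) (lap Z z) = -(ip (du X z) (du Z z) + ip (dv X z) (dv Z z)) := by
  have h1 := ip_du_of_const ht hX (smooth_du ht hZ) hu hz
  have h2 := ip_dv_of_const ht hX (smooth_dv ht hZ) hv hz
  rw [lap, ip_add_right]
  linarith

theorem smooth_holomorphic (ht : IsOpen t) (hφ : DifferentiableOn ℂ φ t) : ContDiffOn ℝ ∞ φ t :=
  (hφ.contDiffOn ht).restrict_scalars ℝ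

theorem du_smul_comp (hs : IsOpen s) (ht : IsOpen t) (hY : ContDiffOn ℝ ∞ Y s)
    (hφ : DifferentiableOn ℂ φ t) (hm : Set.MapsTo φ t s) (hr : ContDiffOn ℝ ∞ r t) (hz : z ∈ t) :
    du (fun w => r w • Y (φ w)) z = r z • ((deriv φ z).re • du Y (φ z) + (deriv φ z).im • dv Y (φ z))
      + du r z • Y (φ z) := by
  have hd := (hφ.differentiableAt (ht.mem_nhds hz)).hasDerivAt
  have hYφ : ContDiffOn ℝ ∞ (fun w => Y (φ w)) t := hY.comp (smooth_holomorphic ht hφ) hm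
  rw [du_smul (diff_at ht hr hz) (diff_at ht hYφ hz), du_comp (diff_at hs hY (hm hz)) hd]

theorem dv_smul_comp (hs : IsOpen s) (ht : IsOpen t) (hY : ContDiffOn ℝ ∞ Y s)
    (hφ : DifferentiableOn ℂ φ t) (hm : Set.MapsTo φ t s) (hr : ContDiffOn ℝ ∞ r t) (hz : z ∈ t) :
    dv (fun w => r w • Y (φ w)) z
      = r z • (-(deriv φ z).im • du Y (φ z) + (deriv φ z).re • dv Y (φ z))
      + dv r z • Y (φ z) := by
  have hd := (hφ.differentiableAt (ht.mem_nhds hz)).hasDerivAt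
  have hYφ : ContDiffOn ℝ ∞ (fun w => Y (φ w)) t := hY.comp (smooth_holomorphic ht hφ) hm
  rw [dv_smul (diff_at ht hr hz) (diff_at ht hYφ hz), dv_comp (diff_at hs hY (hm hz)) hd]

namespace IsFrame

/-- Invariance of the normal plane. Orthogonality to the new Laplacian is the trace-freeness of the
`L`-component of the Hessian, a condition that rotations and dilations of the coordinate preserve.
-/
theorem comp_normal (h : IsFrame s Y L R) (ht : IsOpen t) (hφ : DifferentiableOn ℂ φ t)
    (hm : Set.MapsTo φ t s) (hr : ContDiffOn ℝ ∞ r t) (hz : z ∈ t) :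
    ip (L (φ z)) (du (fun w => r w • Y (φ w)) z) = 0 ∧
    ip (L (φ z)) (dv (fun w => r w • Y (φ w)) z) = 0 ∧
    ip (L (φ z)) (lap (fun w => r w • Y (φ w)) z) = 0 := by
  have hu : ∀ w ∈ t, ip (L (φ w)) (du (fun w => r w • Y (φ w)) w) = 0 := fun w hw => by
    rw [du_smul_comp h.isOpen ht h.smooth hφ hm hr hw]
    simp only [ip_add_right, ip_smul_right, h.LY _ (hm hw), h.LU _ (hm hw), h.LV _ (hm hw)]
    ring
  have hv : ∀ w ∈ t, ip (L (φ w)) (dv (fun w => r w • Y (φ w)) w) = 0 := fun w hw => by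
    rw [dv_smul_comp h.isOpen ht h.smooth hφ hm hr hw]
    simp only [ip_add_right, ip_smul_right, h.LY _ (hm hw), h.LU _ (hm hw), h.LV _ (hm hw)]
    ring
  refine ⟨hu z hz, hv z hz, ?_⟩
  have hφs := smooth_holomorphic ht hφ
  have hd := (hφ.differentiableAt (ht.mem_nhds hz)).hasDerivAt
  have hLd := diff_at h.isOpen h.smooth_L (hm hz)
  rw [ip_lap_of_normal ht (X := fun w => L (φ w)) (Z := fun w => r w • Y (φ w))
    (h.smooth_L.comp hφs hm) (hr.smul (h.smooth.comp hφs hm)) hu hv hz,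
    du_smul_comp h.isOpen ht h.smooth hφ hm hr hz, dv_smul_comp h.isOpen ht h.smooth hφ hm hr hz,
    du_comp hLd hd, dv_comp hLd hd]
  simp only [ip_add_left, ip_add_right, ip_smul_left, ip_smul_right, h.LuY (hm hz), h.LvY (hm hz),
    h.LuU (hm hz), h.LuV (hm hz), h.LvU (hm hz), h.LvV (hm hz)]
  ring

/-- Holomorphic reparametrization of a frame. -/
theorem comp (h : IsFrame s Y L R) (ht : IsOpen t) (hφ : DifferentiableOn ℂ φ t)
    (hm : Set.MapsTo φ t s) (hr : ContDiffOn ℝ ∞ r t)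
    (hr1 : ∀ z ∈ t, r z ^ 2 * ((deriv φ z).re ^ 2 + (deriv φ z).im ^ 2) = 1) :
    IsFrame t (fun w => r w • Y (φ w)) (fun w => L (φ w)) (fun w => R (φ w)) := by
  have hφs := smooth_holomorphic ht hφ
  have hL := fun z hz => h.comp_normal (z := z) ht hφ hm hr hz
  have hR := fun z hz => h.swap.comp_normal (z := z) ht hφ hm hr hz
  refine
  { isOpen := ht
    smooth := hr.smul (h.smooth.comp hφs hm)
    null := fun z hz => by simp only [ip_smul_left, ip_smul_right, h.null _ (hm hz), mul_zero]
    uu := fun z hz => ?_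
    vv := fun z hz => ?_
    uv := fun z hz => ?_
    smooth_L := h.smooth_L.comp hφs hm
    smooth_R := h.smooth_R.comp hφs hm
    LY := fun z hz => by rw [ip_smul_right, h.LY _ (hm hz), mul_zero]
    LU := fun z hz => (hL z hz).1
    LV := fun z hz => (hL z hz).2.1
    LH := fun z hz => (hL z hz).2.2
    RY := fun z hz => by rw [ip_smul_right, h.RY _ (hm hz), mul_zero]
    RU := fun z hz => (hR z hz).1
    RV := fun z hz => (hR z hz).2.1
    RH := fun z hz => (hR z hz).2.2
    LL := fun z hz => h.LL _ (hm hz)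
    RR := fun z hz => h.RR _ (hm hz)
    LR := fun z hz => h.LR _ (hm hz) }
  all_goals
    have hN := h.nullFrame (hm hz)
    simp only [du_smul_comp h.isOpen ht h.smooth hφ hm hr hz,
      dv_smul_comp h.isOpen ht h.smooth hφ hm hr hz, ip_add_left, ip_add_right, ip_smul_left,
      ip_smul_right, hN.YY, hN.YU, hN.YV, hN.UU, hN.UV, hN.VV, ip_comm (du Y (φ z)) (Y (φ z)),
      ip_comm (dv Y (φ z)) (Y (φ z)), ip_comm (dv Y (φ z)) (du Y (φ z))]
  · linear_combination hr1 z hz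
  · linear_combination hr1 z hz
  · ring

/-- Holomorphic maps preserve orientation: the tangent block has determinant `r²|φ'|² = 1`, and the
factors `r` of `Y` and `1/r` of `N` compensate each other. -/
theorem comp_frameDet (h : IsFrame s Y L R) (ht : IsOpen t) (hφ : DifferentiableOn ℂ φ t)
    (hm : Set.MapsTo φ t s) (hr : ContDiffOn ℝ ∞ r t)
    (hr1 : ∀ z ∈ t, r z ^ 2 * ((deriv φ z).re ^ 2 + (deriv φ z).im ^ 2) = 1) (hz : z ∈ t) :
    frameDet (fun w => r w • Y (φ w)) (fun w => L (φ w)) (fun w => R (φ w)) z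
      * frameDet Y L R (φ z) = 1 := by
  have h' := h.comp ht hφ hm hr hr1
  have hN := h.nullFrame (hm hz)
  have hN' := h'.nullFrame hz
  have hr0 : r z ≠ 0 := fun h0 => by have := hr1 z hz; rw [h0] at this; norm_num at this
  unfold frameDet
  rw [det_mul_det_eq_det_gram]
  set N' := dualN (fun w => r w • Y (φ w)) z
  set a := (deriv φ z).re
  set b := (deriv φ z).im
  have hNY : ip N' (Y (φ z)) = -(r z)⁻¹ := by
    have h1 := hN'.YN
    simp only [ip_smul_left] at h1
    rw [ip_comm] at h1
    field_simp
    linarith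
  have hNL : ip N' (L (φ z)) = 0 := hN'.NL
  have hNR : ip N' (R (φ z)) = 0 := hN'.NR
  have hu := du_smul_comp h.isOpen ht h.smooth hφ hm hr hz
  have hv := dv_smul_comp h.isOpen ht h.smooth hφ hm hr hz
  have : (Matrix.of fun i j => ip (![r z • Y (φ z), du (fun w => r w • Y (φ w)) z,
      dv (fun w => r w • Y (φ w)) z, N', R (φ z), L (φ z)] i)
      (![Y (φ z), du Y (φ z), dv Y (φ z), dualN Y (φ z), R (φ z), L (φ z)] j)) =
      !![0, 0, 0, -r z, 0, 0; 0, r z * a, r z * b, -du r z, 0, 0;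
        0, -(r z * b), r z * a, -dv r z, 0, 0;
        -(r z)⁻¹, ip N' (du Y (φ z)), ip N' (dv Y (φ z)), ip N' (dualN Y (φ z)), 0, 0;
        0, 0, 0, 0, 0, -1; 0, 0, 0, 0, -1, 0] := by
    ext i j
    fin_cases i <;> fin_cases j <;>
      simp [hu, hv, ip_smul_left, ip_add_left, ip_neg_left, hNY, hNL, hNR, a, b,
        hN.YY, hN.YU, hN.YV, hN.YN, hN.YL, hN.YR, hN.UU, hN.UV, hN.UN, hN.UL, hN.UR, hN.VV, hN.VN,
        hN.VL, hN.VR, hN.NL, hN.NR, hN.LL, hN.LR, hN.RR, ip_comm (du Y (φ z)) (Y (φ z)),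
        ip_comm (dv Y (φ z)) (Y (φ z)),
        ip_comm (dv Y (φ z)) (du Y (φ z)), ip_comm (L (φ z)) (Y (φ z)),
        ip_comm (L (φ z)) (du Y (φ z)), ip_comm (L (φ z)) (dv Y (φ z)),
        ip_comm (L (φ z)) (dualN Y (φ z)), ip_comm (R (φ z)) (L (φ z)),
        ip_comm (R (φ z)) (Y (φ z)), ip_comm (R (φ z)) (du Y (φ z)),
        ip_comm (R (φ z)) (dv Y (φ z)), ip_comm (R (φ z)) (dualN Y (φ z))]
  rw [this]
  simp [Matrix.det_succ_row_zero, Fin.sum_univ_succ, Fin.succAbove]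
  have h1 := hr1 z hz
  field_simp
  linear_combination h1

end IsFrame
end Comp

section

variable {M : Type*} [TopologicalSpace M] [ChartedSpace ℂ M] {e c : OpenPartialHomeomorph M ℂ}
  {y : M → Q41} {s s' : Set ℂ} {Y L R Y' L' R' : ℂ → R62} {z : ℂ} {ε : ℝ}

/-- Change of coordinates in a frame. -/
theorem IsOrientedFrame.comp [IsManifold 𝓘(ℂ) ω M] (h : IsOrientedFrame ε y c s Y L R)
    (he : IsCoord e) :
    IsOrientedFrame ε y e (overlap e c ∩ transition e c ⁻¹' s)
      (fun w => ‖deriv (transition e c) w‖⁻¹ • Y (transition e c w))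
      (fun w => L (transition e c w)) (fun w => R (transition e c w)) := by
  have hl := h.lift.comp he
  set t := overlap e c ∩ transition e c ⁻¹' s
  have hφ : DifferentiableOn ℂ (transition e c) t :=
    (differentiableOn_transition he h.lift.coord).mono fun z hz => hz.1
  have hm : Set.MapsTo (transition e c) t s := fun z hz => hz.2
  have h0 : ∀ z ∈ t, deriv (transition e c) z ≠ 0 := fun z hz =>
    deriv_transition_ne_zero he h.lift.coord hz.1
  have hr : ContDiffOn ℝ ∞ (fun w => ‖deriv (transition e c) w‖⁻¹) t := fun z hz => by
    have h1 := ((smooth_deriv_transition he h.lift.coord).mono (fun z hz => hz.1) : ContDiffOn ℝ ∞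
      (deriv (transition e c)) t) z hz
    exact (h1.norm ℝ (h0 z hz)).inv (norm_ne_zero_iff.2 (h0 z hz))
  have hr1 : ∀ z ∈ t, (‖deriv (transition e c) z‖⁻¹) ^ 2 *
      ((deriv (transition e c) z).re ^ 2 + (deriv (transition e c) z).im ^ 2) = 1 := fun z hz => by
    have h1 : ‖deriv (transition e c) z‖ ^ 2
        = (deriv (transition e c) z).re ^ 2 + (deriv (transition e c) z).im ^ 2 := by
      rw [← Complex.normSq_eq_norm_sq, Complex.normSq_apply]; ring
    have h2 := norm_ne_zero_iff.2 (h0 z hz)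
    rw [← h1]; field_simp
  refine ⟨hl.smul hr fun z hz => inv_ne_zero (norm_ne_zero_iff.2 (h0 z hz)),
    h.frame.comp hl.isOpen hφ hm hr hr1, fun z hz => ?_⟩
  have h1 := h.frame.comp_frameDet hl.isOpen hφ hm hr hr1 hz
  have h2 := h.oriented _ (hm hz)
  set d := frameDet Y L R (transition e c z)
  set d' := frameDet (fun w => ‖deriv (transition e c) w‖⁻¹ • Y (transition e c w))
      (fun w => L (transition e c w)) (fun w => R (transition e c w)) z
  -- As `d' d = 1`, both determinants have the same sign.
  have h3 : ε * d' = ε * d * d' ^ 2 := by linear_combination -(ε * d') * h1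
  have h4 : d' ≠ 0 := fun h4 => by rw [h4] at h1; norm_num at h1
  rw [h3]; positivity

/-- Two oriented frames in the same coordinate. -/
theorem IsOrientedFrame.unique (h : IsOrientedFrame ε y e s Y L R)
    (h' : IsOrientedFrame ε y e s' Y' L' R') (hz : z ∈ s) (hz' : z ∈ s') :
    ∃ k : ℝ, k ≠ 0 ∧ L' z = k • L z ∧ R' z = k⁻¹ • R z := by
  obtain ⟨ρ, hρ, hYρ⟩ := h.lift.exists_factor h'.lift
  have ho : IsOpen (s ∩ s') := h.frame.isOpen.inter h'.frame.isOpen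
  have hsub : s ∩ s' ⊆ s := Set.inter_subset_left
  have hρ1 : ∀ w ∈ s ∩ s', ρ w ^ 2 = 1 := fun w hw => by
    have h1 := (ip_fderiv_smul ho (h.frame.smooth.mono hsub) (fun x hx => h.frame.null x hx.1)
      hρ hw).1
    rw [← du_congr_on ho (f := Y') (fun x hx => (hYρ x hx).2) hw, h.frame.uu w hw.1,
      h'.frame.uu w hw.2] at h1
    linarith
  -- Two canonical lifts differ by a sign that may change between components. On this open
  -- neighbourhood it is constant, so the derivatives of the two lifts can be compared.
  set t : Set ℂ := (s ∩ s') ∩ (fun w => ρ w * ρ z) ⁻¹' Set.Ioi 0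
  have ht : IsOpen t := (hρ.continuousOn.mul continuousOn_const).isOpen_inter_preimage ho isOpen_Ioi
  have hzt : z ∈ t := ⟨⟨hz, hz'⟩, by
    change 0 < ρ z * ρ z
    have := hρ1 z ⟨hz, hz'⟩
    nlinarith⟩
  have hconst : ∀ w ∈ t, Y' w = ρ z • Y w := fun w hw => by
    have h1 : ρ w = ρ z := by
      have h2 := hρ1 w hw.1
      have h3 := hρ1 z ⟨hz, hz'⟩
      have h4 : 0 < ρ w * ρ z := hw.2
      have h5 : (ρ w - ρ z) * (ρ w + ρ z) = 0 := by linear_combination h2 - h3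
      rcases mul_eq_zero.1 h5 with h6 | h6
      · linarith
      · exfalso
        have : ρ w = -ρ z := by linarith
        rw [this] at h4; nlinarith
    rw [← h1]; exact (hYρ w hw.1).2
  refine (h.frame.mono ht fun w hw => hw.1.1).unique (h'.frame.mono ht fun w hw => hw.1.2)
    (hρ1 z ⟨hz, hz'⟩) hconst hzt ?_
  have h1 := mul_pos (h.oriented z hz) (h'.oriented z hz')
  have h2 : ε * frameDet Y L R z * (ε * frameDet Y' L' R' z)
      = ε ^ 2 * (frameDet Y L R z * frameDet Y' L' R' z) := by ring
  rw [h2] at h1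
  exact pos_of_mul_pos_right h1 (sq_nonneg ε)

/-- The polar surface is given by the field `L` of any oriented frame. -/
theorem IsPolarOn.represents [IsManifold 𝓘(ℂ) ω M] {l : M → Q41} {U : Set M}
    (hl : IsPolarOn ε y l U)
    (h : IsOrientedFrame ε y e s Y L R) (hz : z ∈ s) (hU : e.symm z ∈ U) :
    Represents (L z) (l (e.symm z)) := by
  obtain ⟨c, s', Y', L', R', h', h1, h2, h3⟩ := hl _ hU
  have hzo : z ∈ overlap e c := ⟨h.lift.subset hz, h1⟩
  obtain ⟨k, hk, hkL, -⟩ := (h'.comp h.lift.coord).unique h ⟨hzo, h2⟩ hz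
  rw [hkL, ← symm_transition hzo]
  exact (h3 _ h2).smul hk

theorem IsPolarOn.isLocalLift [IsManifold 𝓘(ℂ) ω M] {l : M → Q41} {U : Set M}
    (hl : IsPolarOn ε y l U)
    (h : IsOrientedFrame ε y e s Y L R) (hs : ∀ z ∈ s, e.symm z ∈ U) : IsLocalLift l e s L :=
  ⟨h.lift.coord, h.frame.isOpen, h.lift.subset, h.frame.smooth_L, fun z hz =>
    hl.represents h hz (hs z hz)⟩

/-- Non-degeneracy of the polar surface can be read off in any coordinate. -/
theorem exists_frame_of_mem_nondegenerateSet [IsManifold 𝓘(ℂ) ω M] (he : IsCoord e) {p : M}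
    (hp : p ∈ nondegenerateSet ε y) (hpe : p ∈ e.source) :
    ∃ s Y L R, IsOrientedFrame ε y e s Y L R ∧ e p ∈ s ∧ ip (du L (e p)) (du L (e p)) ≠ 0 := by
  obtain ⟨c, s, Y, L, R, h, hpc, hps, h0⟩ := hp
  have hz : e p ∈ overlap e c := ⟨e.map_source hpe, by
    rw [Set.mem_preimage, e.left_inv hpe]; exact hpc⟩
  have hφ : transition e c (e p) = c p := by rw [transition, e.left_inv hpe]
  refine ⟨_, _, _, _, h.comp he, ⟨hz, by rw [Set.mem_preimage, hφ]; exact hps⟩, ?_⟩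
  have hd := hasDerivAt_transition he h.lift.coord hz
  rw [du_comp (by rw [hφ]; exact diff_at h.frame.isOpen h.frame.smooth_L hps) hd, hφ]
  have h1 := h.frame.metric_L hps
  simp only [ip_add_left, ip_add_right, ip_smul_left, ip_smul_right, h1.2.2,
    ip_comm (dv L (c p)) (du L (c p)), h1.2.1, ← h1.1]
  have h2 : ‖deriv (transition e c) (e p)‖ ^ 2
      = (deriv (transition e c) (e p)).re ^ 2 + (deriv (transition e c) (e p)).im ^ 2 := by
    rw [← Complex.normSq_eq_norm_sq, Complex.normSq_apply]; ring
  have h3 := norm_ne_zero_iff.2 (deriv_transition_ne_zero he h.lift.coord hz)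
  intro h4
  have h5 : ‖deriv (transition e c) (e p)‖ ^ 2 * ip (du L (c p)) (du L (c p)) = 0 := by
    rw [h2]; linear_combination h4
  exact (mul_ne_zero (pow_ne_zero 2 h3) h0) h5

end

/-! ### Harmonicity of the conformal Gauss map -/

theorem bivectorPairing_wedge (x y a b : R62) :
    bivectorPairing (wedge x y) a b = ip x a * ip y b - ip x b * ip y a := by
  rw [mul_comm (ip x b)]
  simp only [bivectorPairing, wedge, ip, Finset.sum_mul_sum, ← Finset.sum_sub_distrib]
  exact Finset.sum_congr rfl fun i _ => Finset.sum_congr rfl fun j _ => by ring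

theorem bivectorPairing_add (B C : Fin 6 → Fin 6 → ℝ) (a b : R62) :
    bivectorPairing (B + C) a b = bivectorPairing B a b + bivectorPairing C a b := by
  simp only [bivectorPairing, ← Finset.sum_add_distrib, Pi.add_apply]
  exact Finset.sum_congr rfl fun i _ => Finset.sum_congr rfl fun j _ => by ring

theorem bivectorPairing_smul (k : ℝ) (B : Fin 6 → Fin 6 → ℝ) (a b : R62) :
    bivectorPairing (k • B) a b = k * bivectorPairing B a b := by
  simp only [bivectorPairing, Finset.mul_sum, Pi.smul_apply, smul_eq_mul]
  exact Finset.sum_congr rfl fun i _ => Finset.sum_congr rfl fun j _ => by ring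

/-- The wedge product as a continuous bilinear map. -/
def wedgeL : R62 →L[ℝ] R62 →L[ℝ] (Fin 6 → Fin 6 → ℝ) :=
  (LinearMap.mk₂ ℝ wedge
    (fun x y z => by ext i j; simp only [wedge, Pi.add_apply]; ring)
    (fun c x y => by ext i j; simp only [wedge, Pi.smul_apply, smul_eq_mul]; ring)
    (fun x y z => by ext i j; simp only [wedge, Pi.add_apply]; ring)
    (fun c x y => by ext i j; simp only [wedge, Pi.smul_apply, smul_eq_mul]; ring)
    ).toContinuousBilinearMap

theorem wedgeL_apply (x y : R62) : wedgeL x y = wedge x y := rfl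

section LapWedge

variable {L R : ℂ → R62} {s : Set ℂ} {z : ℂ}

theorem fderiv_wedge (hL : DifferentiableAt ℝ L z) (hR : DifferentiableAt ℝ R z) (a : ℂ) :
    fderiv ℝ (fun w => wedge (L w) (R w)) z a
      = wedge (fderiv ℝ L z a) (R z) + wedge (L z) (fderiv ℝ R z a) := by
  have h := (wedgeL.hasFDerivAt_of_bilinear hL.hasFDerivAt hR.hasFDerivAt).fderiv
  simp only [wedgeL_apply] at h
  rw [h]
  simp [wedgeL_apply, add_comm]

theorem smooth_wedge (hL : ContDiffOn ℝ ∞ L s) (hR : ContDiffOn ℝ ∞ R s) :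
    ContDiffOn ℝ ∞ (fun w => wedge (L w) (R w)) s :=
  (wedgeL.contDiff.comp_contDiffOn hL).clm_apply hR

theorem lap_wedge (hs : IsOpen s) (hL : ContDiffOn ℝ ∞ L s) (hR : ContDiffOn ℝ ∞ R s)
    (hz : z ∈ s) :
    lap (fun w => wedge (L w) (R w)) z = wedge (lap L z) (R z) + (2 : ℝ) • wedge (du L z) (du R z)
      + (2 : ℝ) • wedge (dv L z) (dv R z) + wedge (L z) (lap R z) := by
  have key : ∀ a : ℂ, fderiv ℝ (fun w => fderiv ℝ (fun w => wedge (L w) (R w)) w a) z a =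
      wedge (fderiv ℝ (fun w => fderiv ℝ L w a) z a) (R z)
        + (2 : ℝ) • wedge (fderiv ℝ L z a) (fderiv ℝ R z a)
        + wedge (L z) (fderiv ℝ (fun w => fderiv ℝ R w a) z a) := fun a => by
    have hLa : ContDiffOn ℝ ∞ (fun w => fderiv ℝ L w a) s :=
      (smooth_fderiv hs hL).clm_apply contDiffOn_const
    have hRa : ContDiffOn ℝ ∞ (fun w => fderiv ℝ R w a) s :=
      (smooth_fderiv hs hR).clm_apply contDiffOn_const
    rw [fderiv_congr_on hs (fun w hw => fderiv_wedge (diff_at hs hL hw) (diff_at hs hR hw) a) hz,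
      fderiv_fun_add (diff_at hs (smooth_wedge hLa hR) hz) (diff_at hs (smooth_wedge hL hRa) hz)]
    simp only [add_apply]
    rw [fderiv_wedge (diff_at hs hLa hz) (diff_at hs hR hz),
      fderiv_wedge (diff_at hs hL hz) (diff_at hs hRa hz)]
    module
  have h1 : du (du fun w => wedge (L w) (R w)) z = wedge (du (du L) z) (R z)
      + (2 : ℝ) • wedge (du L z) (du R z) + wedge (L z) (du (du R) z) := key 1
  have h2 : dv (dv fun w => wedge (L w) (R w)) z = wedge (dv (dv L) z) (R z)
      + (2 : ℝ) • wedge (dv L z) (dv R z) + wedge (L z) (dv (dv R) z) := key Complex.I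
  have hadd : wedge (lap L z) (R z) = wedge (du (du L) z) (R z) + wedge (dv (dv L) z) (R z) := by
    ext i j; simp only [wedge, lap, Pi.add_apply]; ring
  have hadd' : wedge (L z) (lap R z) = wedge (L z) (du (du R) z) + wedge (L z) (dv (dv R) z) := by
    ext i j; simp only [wedge, lap, Pi.add_apply]; ring
  rw [hadd, hadd', lap, h1, h2]
  module

end LapWedge

section

variable {M : Type*} [TopologicalSpace M] [ChartedSpace ℂ M] [IsManifold 𝓘(ℂ) ω M] [T2Space M]
  {y : M → Q41} {U : Set M}

/-- The conformal Gauss map of a Willmore surface is harmonic. -/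
theorem IsSpacelikeWillmoreOn.hasHarmonicGaussMapOn (hy : IsSpacelikeWillmoreOn y U) :
    HasHarmonicGaussMapOn y U := by
  intro e s Y N L R h z hz hU a ha b hb
  have hf := h.isFrame
  have hL := hf.harmonicEq hz (hy.eulerLagrange h.lift hf hz hU)
  have hR := hf.swap.harmonicEq hz (hy.eulerLagrange h.lift hf.swap hz hU)
  have hbL : ip b (L z) = 0 := by rw [ip_comm]; exact hf.normal_span hz hb
  have hbR : ip b (R z) = 0 := by rw [ip_comm]; exact hf.swap.normal_span hz hb
  obtain ⟨α, β, rfl⟩ := Submodule.mem_span_pair.1 ha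
  rw [lap_wedge hf.isOpen hf.smooth_L hf.smooth_R hz]
  -- For `a = L` the pairing is `⟨ΔL, b⟩ - 2(⟨R_u, L⟩⟨L_u, b⟩ + ⟨R_v, L⟩⟨L_v, b⟩)`, the defect in
  -- `HarmonicEq`; for `a = R` it is its mirror image up to sign.
  simp only [bivectorPairing_add, bivectorPairing_smul, bivectorPairing_wedge, ip_add_right,
    ip_smul_right, hf.LL z hz, hf.RR z hz, hf.LR z hz, ip_comm (R z) (L z), hf.LuL hz, hf.LvL hz,
    hf.swap.LuL hz, hf.swap.LvL hz, ip_comm (L z) b, ip_comm (R z) b, hbL, hbR, hL b hbL hbR,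
    hR b hbR hbL]
  ring

end

/-! ### Polar surfaces of Willmore surfaces -/

theorem linearIndependent_of_metric {x u v : R62} {m : ℝ} (hx : x ≠ 0) (hm : m ≠ 0)
    (hxu : ip x u = 0) (hxv : ip x v = 0) (huu : ip u u = m) (hvv : ip v v = m)
    (huv : ip u v = 0) : LinearIndependent ℝ ![x, u, v] := by
  rw [Fintype.linearIndependent_iff]
  intro g hg
  simp only [Fin.sum_univ_three, Matrix.cons_val_zero, Matrix.cons_val_one, Matrix.cons_val] at hg
  have h1 : g 1 * m = 0 := by
    have := congrArg (fun w => ip w u) hg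
    simp only [ip_add_left, ip_smul_left, ip_zero_left, hxu, huu, ip_comm v u, huv] at this
    linarith
  have h2 : g 2 * m = 0 := by
    have := congrArg (fun w => ip w v) hg
    simp only [ip_add_left, ip_smul_left, ip_zero_left, hxv, hvv, huv] at this
    linarith
  have h1' := (mul_eq_zero.1 h1).resolve_right hm
  have h2' := (mul_eq_zero.1 h2).resolve_right hm
  rw [h1', h2'] at hg
  simp only [zero_smul, add_zero] at hg
  have h0 := (smul_eq_zero.1 hg).resolve_right hx
  intro i
  fin_cases i <;> assumption

theorem not_linearIndependent_of_mem_span_pair {a b x u v : R62}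
    (hx : x ∈ Submodule.span ℝ {a, b}) (hu : u ∈ Submodule.span ℝ {a, b})
    (hv : v ∈ Submodule.span ℝ {a, b}) : ¬LinearIndependent ℝ ![x, u, v] := by
  intro h
  classical
  have h1 := linearIndependent_le_span_aux' _ h (({a, b} : Finset R62) : Set R62) (by
    rintro _ ⟨i, rfl⟩
    rw [Finset.coe_pair]
    fin_cases i
    exacts [hx, hu, hv])
  have h2 : Finset.card {a, b} ≤ 2 := Finset.card_le_two
  simp only [Fintype.card_fin, Finset.coe_sort_coe, Fintype.card_coe] at h1
  omega

section

variable {M : Type*} [TopologicalSpace M] [ChartedSpace ℂ M]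
  {e : OpenPartialHomeomorph M ℂ} {y l : M → Q41} {U : Set M} {s : Set ℂ} {Y L R : ℂ → R62}
  {z : ℂ} {ε : ℝ} {p : M}

theorem isOpen_nondegenerateSet (ε : ℝ) (y : M → Q41) : IsOpen (nondegenerateSet ε y) := by
  rw [isOpen_iff_mem_nhds]
  rintro p ⟨e, s, Y, L, R, h, hpe, hps, h0⟩
  have hc : ContinuousOn (fun z => ip (du L z) (du L z)) s :=
    (smooth_ip (smooth_du h.frame.isOpen h.frame.smooth_L)
      (smooth_du h.frame.isOpen h.frame.smooth_L)).continuousOn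
  have ho : IsOpen (s ∩ (fun z => ip (du L z) (du L z)) ⁻¹' {0}ᶜ) :=
    hc.isOpen_inter_preimage h.frame.isOpen isOpen_compl_singleton
  filter_upwards [(e.isOpen_inter_preimage ho).mem_nhds ⟨hpe, hps, h0⟩] with q hq
  exact ⟨e, s, Y, L, R, h, hq.1, hq.2.1, hq.2.2⟩

/-- Near a point where the polar surface is non-degenerate, there are frames for which `L` is its
canonical lift. -/
theorem IsSpacelikeWillmoreOn.exists_normalized_frame [IsManifold 𝓘(ℂ) ω M] [T2Space M]
    (hy : IsSpacelikeWillmoreOn y U)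
    (hp : p ∈ U) (hp' : p ∈ nondegenerateSet ε y) :
    ∃ (e : OpenPartialHomeomorph M ℂ) (s : Set ℂ) (Y L R : ℂ → R62),
      IsOrientedFrame ε y e s Y L R ∧ p ∈ e.source ∧ e p ∈ s ∧ (∀ z ∈ s, e.symm z ∈ U) ∧
      (∀ z ∈ s, ip (hopfRe Y z) (L z) ^ 2 + ip (du (dv Y) z) (L z) ^ 2 = 1) ∧
      (∀ z ∈ s, ip (SpacelikeWillmore.eulerLagrange Y z) (L z) = 0) ∧
      ∀ z ∈ s, ip (SpacelikeWillmore.eulerLagrange Y z) (R z) = 0 := by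
  obtain ⟨e, s, Y, L, R, h, hpe, hps, h0⟩ := hp'
  have hLu := smooth_du h.frame.isOpen h.frame.smooth_L
  have hc := smooth_ip hLu hLu
  set m : ℂ → ℝ := fun z => ip (du L z) (du L z)
  set t : Set ℂ := (s ∩ e.symm ⁻¹' U) ∩ m ⁻¹' {0}ᶜ
  have hsU : IsOpen (s ∩ e.symm ⁻¹' U) :=
    (e.continuousOn_symm.mono h.lift.subset).isOpen_inter_preimage h.frame.isOpen
      hy.spacelike.isOpen
  have ht : IsOpen t := (hc.continuousOn.mono Set.inter_subset_left).isOpen_inter_preimage hsU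
    isOpen_compl_singleton
  have hts : t ⊆ s := fun z hz => hz.1.1
  have hm : ∀ z ∈ t, 0 < m z := fun z hz => by
    have h1 : m z = _ := (h.frame.metric_L (hts hz)).1
    have h2 : m z ≠ 0 := hz.2
    rw [h1] at h2 ⊢
    positivity
  -- The factor that gives `L` the metric `|dz|²`; rescaling `R` inversely preserves both the frame
  -- relations and the orientation.
  set k : ℂ → ℝ := fun z => (√(m z))⁻¹
  have hk : ContDiffOn ℝ ∞ k t := fun z hz =>
    (((hc.mono hts) z hz).sqrt (hm z hz).ne').inv (Real.sqrt_ne_zero'.2 (hm z hz))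
  have hk0 : ∀ z ∈ t, k z ≠ 0 := fun z hz => inv_ne_zero (Real.sqrt_ne_zero'.2 (hm z hz))
  have hf := (h.frame.mono ht hts).rescale hk hk0
  have hl := h.lift.mono ht hts
  refine ⟨e, t, Y, _, _, ⟨hl, hf, fun z hz => ?_⟩, hpe, ⟨⟨hps, ?_⟩, h0⟩, fun z hz => hz.1.2,
    fun z hz => ?_, fun z hz => hy.eulerLagrange hl hf hz hz.1.2,
    fun z hz => hy.eulerLagrange hl hf.swap hz hz.1.2⟩
  · rw [IsFrame.frameDet_rescale k (hk0 z hz)]; exact h.oriented z (hts hz)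
  · rw [Set.mem_preimage, e.left_inv hpe]; exact hp
  · have h1 : m z = _ := (h.frame.metric_L (hts hz)).1
    have h2 : k z ^ 2 * m z = 1 := by
      have := (hm z hz)
      simp only [k, inv_pow, Real.sq_sqrt this.le]
      exact inv_mul_cancel₀ this.ne'
    simp only [ip_smul_right]
    rw [h1] at h2
    linear_combination h2

theorem IsOrientedFrame.polar (h : IsOrientedFrame ε y e s Y L R) (hl : IsLocalLift l e s L)
    (hP : ∀ z ∈ s, ip (hopfRe Y z) (L z) ^ 2 + ip (du (dv Y) z) (L z) ^ 2 = 1)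
    (hE : ∀ z ∈ s, ip (eulerLagrange Y z) (L z) = 0) :
    IsOrientedFrame ε l e s L (adjoint Y L) Y := by
  refine ⟨hl, h.frame.polar hP hE, fun z hz => ?_⟩
  have h1 := h.frame.polar_frameDet hP hE hz
  have h2 := h.oriented z hz
  set d := frameDet Y L R z
  set d' := frameDet L (adjoint Y L) Y z
  have h3 : ε * d' = ε * d * d' ^ 2 := by linear_combination -(ε * d') * h1
  have h4 : d' ≠ 0 := fun h4 => by rw [h4] at h1; norm_num at h1
  rw [h3]; positivity

variable [IsManifold 𝓘(ℂ) ω M]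

/-- If the metric of `L` vanishes at a point, then `dL` has no `dY`-components and `L, L_u, L_v` lie
in the plane of `L` and `Y`; this is inherited by every lift. Otherwise the conformal metric gives
independence. -/
theorem IsPolarOn.isImmersionAt_iff (hU : IsOpen U) (hl : IsPolarOn ε y l U) (hp : p ∈ U) :
    IsImmersionAt l p ↔ p ∈ nondegenerateSet ε y := by
  constructor
  · rintro ⟨e, s, Z, hZ, hpe, hps, hind⟩
    obtain ⟨c, t, Y, L, R, h, hpc, hpt, -⟩ := hl p hp
    have h' := h.comp hZ.coord
    have hzo : e p ∈ overlap e c := ⟨e.map_source hpe, by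
      rw [Set.mem_preimage, e.left_inv hpe]; exact hpc⟩
    have hzt : e p ∈ overlap e c ∩ transition e c ⁻¹' t := ⟨hzo, by
      rw [Set.mem_preimage, transition, e.left_inv hpe]; exact hpt⟩
    refine ⟨e, _, _, _, _, h', hpe, hzt, fun h0 => ?_⟩
    set L' := fun w => L (transition e c w)
    set Y' := fun w => ‖deriv (transition e c) w‖⁻¹ • Y (transition e c w)
    set R' := fun w => R (transition e c w)
    set t' := overlap e c ∩ transition e c ⁻¹' t
    have ho : IsOpen (t' ∩ e.symm ⁻¹' U) :=
      (e.continuousOn_symm.mono h'.lift.subset).isOpen_inter_preimage h'.frame.isOpen hU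
    have h'' := h'.mono ho Set.inter_subset_left
    have hlift := hl.isLocalLift h'' fun z hz => hz.2
    have hz : e p ∈ t' ∩ e.symm ⁻¹' U := ⟨hzt, by
      rw [Set.mem_preimage, e.left_inv hpe]; exact hp⟩
    obtain ⟨ρ, hρ, hZρ⟩ := hlift.exists_factor hZ
    have ho' : IsOpen ((t' ∩ e.symm ⁻¹' U) ∩ s) := ho.inter hZ.isOpen
    have hz' : e p ∈ (t' ∩ e.symm ⁻¹' U) ∩ s := ⟨hz, hps⟩
    have hLd := diff_at h''.frame.isOpen h''.frame.smooth_L hz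
    have hN := h''.frame.nullFrame hz
    have hm := h''.frame.metric_L hz
    rw [h0] at hm
    have hP : ip (hopfRe Y' (e p)) (L' (e p)) = 0 := by
      nlinarith [hm.1, sq_nonneg (ip (du (dv Y') (e p)) (L' (e p)))]
    have hQ : ip (du (dv Y') (e p)) (L' (e p)) = 0 := by
      nlinarith [hm.1, sq_nonneg (ip (hopfRe Y' (e p)) (L' (e p)))]
    have mL : L' (e p) ∈ Submodule.span ℝ {L' (e p), Y' (e p)} :=
      Submodule.subset_span (by simp)
    have mu : du L' (e p) ∈ Submodule.span ℝ {L' (e p), Y' (e p)} := by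
      rw [hN.expand (du L' (e p)), h''.frame.LuY hz, h''.frame.LuU hz, h''.frame.LuV hz,
        h''.frame.LuL hz, hP, hQ, Submodule.mem_span_pair]
      exact ⟨-ip (du L' (e p)) (R' (e p)), -ip (du L' (e p)) (dualN Y' (e p)), by module⟩
    have mv : dv L' (e p) ∈ Submodule.span ℝ {L' (e p), Y' (e p)} := by
      rw [hN.expand (dv L' (e p)), h''.frame.LvY hz, h''.frame.LvU hz, h''.frame.LvV hz,
        h''.frame.LvL hz, hP, hQ, Submodule.mem_span_pair]
      exact ⟨-ip (dv L' (e p)) (R' (e p)), -ip (dv L' (e p)) (dualN Y' (e p)), by module⟩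
    have hZ' : Set.EqOn Z (fun w => ρ w • L' w) ((t' ∩ e.symm ⁻¹' U) ∩ s) :=
      fun w hw => (hZρ w hw).2
    refine not_linearIndependent_of_mem_span_pair (a := L' (e p)) (b := Y' (e p)) ?_ ?_ ?_ hind
    · rw [hZ' hz']; exact Submodule.smul_mem _ _ mL
    · rw [du_congr_on ho' hZ' hz', du_smul (diff_at ho' hρ hz') hLd]
      exact Submodule.add_mem _ (Submodule.smul_mem _ _ mu) (Submodule.smul_mem _ _ mL)
    · rw [dv_congr_on ho' hZ' hz', dv_smul (diff_at ho' hρ hz') hLd]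
      exact Submodule.add_mem _ (Submodule.smul_mem _ _ mv) (Submodule.smul_mem _ _ mL)
  · rintro ⟨e, s, Y, L, R, h, hpe, hps, h0⟩
    have ho : IsOpen (s ∩ e.symm ⁻¹' U) :=
      (e.continuousOn_symm.mono h.lift.subset).isOpen_inter_preimage h.frame.isOpen hU
    have hlift := hl.isLocalLift (h.mono ho Set.inter_subset_left) fun z hz => hz.2
    have hz : e p ∈ s ∩ e.symm ⁻¹' U := ⟨hps, by
      rw [Set.mem_preimage, e.left_inv hpe]; exact hp⟩
    refine ⟨e, _, L, hlift, hpe, hz, ?_⟩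
    have hm := h.frame.metric_L hps
    exact linearIndependent_of_metric (hlift.ne_zero hz) h0
      (by rw [ip_comm]; exact h.frame.LuL hps) (by rw [ip_comm]; exact h.frame.LvL hps) rfl
      (hm.2.1.trans hm.1.symm) hm.2.2

/-- A frame can be moved to any prescribed coordinate, and an arbitrary lift has the metric of `L`
multiplied by the positive factor `ρ²`. No Willmore equation is needed. -/
theorem IsPolarOn.isConformalSpacelikeOn (hU : IsOpen U) (hl : IsPolarOn ε y l U) :
    IsConformalSpacelikeOn l (U ∩ nondegenerateSet ε y) := by
  have key : ∀ e : OpenPartialHomeomorph M ℂ, IsCoord e → ∀ p ∈ U ∩ nondegenerateSet ε y,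
      p ∈ e.source → ∃ s Y L R, IsOrientedFrame ε y e s Y L R ∧ e p ∈ s ∧ IsLocalLift l e s L ∧
        ip (du L (e p)) (du L (e p)) ≠ 0 := fun e he p hp hpe => by
    obtain ⟨s, Y, L, R, h, hps, h0⟩ := exists_frame_of_mem_nondegenerateSet he hp.2 hpe
    have ho : IsOpen (s ∩ e.symm ⁻¹' U) :=
      (e.continuousOn_symm.mono h.lift.subset).isOpen_inter_preimage h.frame.isOpen hU
    have h' := h.mono ho Set.inter_subset_left
    refine ⟨_, Y, L, R, h', ⟨hps, ?_⟩, hl.isLocalLift h' fun z hz => hz.2, h0⟩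
    rw [Set.mem_preimage, e.left_inv hpe]; exact hp.1
  refine ⟨hU.inter (isOpen_nondegenerateSet ε y), fun p hp => ?_, fun e s Z hZ z hz hzU => ?_⟩
  · obtain ⟨s, Y, L, R, -, hps, hlift, -⟩ :=
      key _ (isCoord_chartAt p) p hp (mem_chart_source ℂ p)
    have := hlift.smoothAt hps
    rwa [(chartAt ℂ p).left_inv (mem_chart_source ℂ p)] at this
  · have hzt := hZ.subset hz
    obtain ⟨t, Y, L, R, h, hps, hlift, h0⟩ := key e hZ.coord _ hzU (e.map_target hzt)
    rw [e.right_inv hzt] at hps h0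
    obtain ⟨ρ, hρ, hZρ⟩ := hlift.exists_factor hZ
    have ho : IsOpen (t ∩ s) := hlift.isOpen.inter hZ.isOpen
    have hz' : z ∈ t ∩ s := ⟨hps, hz⟩
    have hZ' : Set.EqOn Z (fun w => ρ w • L w) (t ∩ s) := fun w hw => (hZρ w hw).2
    have hm := h.frame.metric_L hps
    have hsm := ip_fderiv_smul ho (hlift.smooth.mono Set.inter_subset_left)
      (fun w hw => hlift.null w hw.1) hρ hz'
    rw [conformal_iff (diff_at hZ.isOpen hZ.smooth hz), du_congr_on ho hZ' hz',
      dv_congr_on ho hZ' hz', hsm.1, hsm.2.1, hsm.2.2, hm.2.2, hm.2.1, hm.1]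
    rw [hm.1] at h0
    have := (hZρ z hz').1
    refine ⟨rfl, mul_zero _, by positivity⟩

variable [T2Space M]

/-- The original surface is a polar surface of its non-degenerate polar surfaces. -/
theorem IsPolarOn.symm (hy : IsSpacelikeWillmoreOn y U) (hl : IsPolarOn ε y l U) :
    IsPolarOn (-ε) l y (U ∩ nondegenerateSet ε y) := by
  rintro p ⟨hp, hp'⟩
  obtain ⟨e, s, Y, L, R, h, hpe, hps, hsU, hP, hE, -⟩ := hy.exists_normalized_frame hp hp'
  -- In the frame of `[L]` the field `Y` occupies the place of `R`, hence the exchange and the sign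
  -- `-ε`.
  exact ⟨e, s, L, Y, _, (h.polar (hl.isLocalLift h hsU) hP hE).swap, hpe, hps, h.lift.lift⟩

/-- Non-degenerate polar surfaces of Willmore surfaces are Willmore surfaces. -/
theorem IsPolarOn.isSpacelikeWillmoreOn [SecondCountableTopology M]
    (hy : IsSpacelikeWillmoreOn y U) (hl : IsPolarOn ε y l U) :
    IsSpacelikeWillmoreOn l (U ∩ nondegenerateSet ε y) := by
  refine (hl.isConformalSpacelikeOn hy.spacelike.isOpen).isSpacelikeWillmoreOn ?_
  rintro p ⟨hp, hp'⟩
  obtain ⟨e, s, Y, L, R, h, hpe, hps, hsU, hP, hE, hE'⟩ := hy.exists_normalized_frame hp hp'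
  exact ⟨e, s, L, _, Y, hl.isLocalLift h hsU, h.frame.polar hP hE, hpe, hps, fun z hz =>
    ⟨h.frame.polar_eulerLagrange_left hP hE hE' hz, h.frame.polar_eulerLagrange_right hP hE hz⟩⟩

/-- The two-step transforms of Willmore surfaces are Willmore surfaces. -/
theorem IsPolarOn.isSpacelikeWillmoreOn_immersion [SecondCountableTopology M]
    (hy : IsSpacelikeWillmoreOn y U) (hl : IsPolarOn ε y l U) :
    IsSpacelikeWillmoreOn l {p | p ∈ U ∧ IsImmersionAt l p} := by
  have : {p | p ∈ U ∧ IsImmersionAt l p} = U ∩ nondegenerateSet ε y := by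
    ext p
    exact and_congr_right fun hp => hl.isImmersionAt_iff hy.spacelike.isOpen hp
  rw [this]
  exact hl.isSpacelikeWillmoreOn hy

end

end

end SpacelikeWillmore

theorem theorem5p5 {M : Type*} [TopologicalSpace M] [T2Space M] [SecondCountableTopology M]
    [ChartedSpace ℂ M] [IsManifold 𝓘(ℂ) ω M]
    (y l r : M → Q41) (hy : IsSpacelikeWillmoreOn y Set.univ)
    (hl : IsLeftPolarOn y l Set.univ) (hr : IsRightPolarOn y r Set.univ) :
    -- the left polar surface is non-degenerate exactly where `λ₂ ≠ 0`; there it is Willmore,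
    -- with `y` as its right polar surface and with harmonic conformal Gauss map
    ((∀ p, IsImmersionAt l p ↔ p ∈ lam2NeZero y) ∧
      IsSpacelikeWillmoreOn l (lam2NeZero y) ∧
      IsRightPolarOn l y (lam2NeZero y) ∧
      HasHarmonicGaussMapOn l (lam2NeZero y)) ∧
    -- the same for the right polar surface, with `λ₁`
    ((∀ p, IsImmersionAt r p ↔ p ∈ lam1NeZero y) ∧
      IsSpacelikeWillmoreOn r (lam1NeZero y) ∧
      IsLeftPolarOn r y (lam1NeZero y) ∧
      HasHarmonicGaussMapOn r (lam1NeZero y)) ∧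
    -- the left and right adjoint (two-step) transforms
    (∀ yhat : M → Q41, IsLeftPolarOn l yhat (lam2NeZero y) →
      IsSpacelikeWillmoreOn yhat {p | p ∈ lam2NeZero y ∧ IsImmersionAt yhat p}) ∧
    (∀ ytilde : M → Q41, IsRightPolarOn r ytilde (lam1NeZero y) →
      IsSpacelikeWillmoreOn ytilde {p | p ∈ lam1NeZero y ∧ IsImmersionAt ytilde p}) := by
  rw [isLeftPolarOn_iff] at hl
  rw [isRightPolarOn_iff] at hr
  simp only [lam2NeZero_eq, lam1NeZero_eq, isLeftPolarOn_iff, isRightPolarOn_iff]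
  have hlW := hl.isSpacelikeWillmoreOn hy
  have hrW := hr.isSpacelikeWillmoreOn hy
  have hls := hl.symm hy
  have hrs := hr.symm hy
  rw [Set.univ_inter] at hlW hrW hls hrs
  rw [neg_neg] at hrs
  exact ⟨⟨fun p => hl.isImmersionAt_iff isOpen_univ (Set.mem_univ p), hlW, hls,
      hlW.hasHarmonicGaussMapOn⟩,
    ⟨fun p => hr.isImmersionAt_iff isOpen_univ (Set.mem_univ p), hrW, hrs,
      hrW.hasHarmonicGaussMapOn⟩,
    -- The two-step transform is a polar surface of the Willmore surface `l`, to which the one-step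
    -- result applies.
    fun _ h => h.isSpacelikeWillmoreOn_immersion hlW,
    fun _ h => h.isSpacelikeWillmoreOn_immersion hrW⟩
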